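/- Rings are commutative with unit. An ideal of definition of a topological ring is an open ideal consisting of topologically nilpotent elements. An admissible ring is a topological ring $A$ that has a descending chain $I_1\supseteq I_2\supseteq\cdots$ of ideals as a basis of neighbourhoods of $0$, is separated and complete, and has an ideal of definition. Its formal spectrum $\mathrm{Spf}\,A$ is the space of open prime ideals of $A$ (with the Zariski topology) with the sheaf of topological rings $\varprojlim_J \mathcal O_{\mathrm{Spec}\,A/J}$, where $J$ runs through the open ideals and the sheaves $\mathcal O_{\mathrm{Spec}\,A/J}$ are pseudo-discrete (sections over quasi-compact open sets are discrete). A formal scheme is a topologically ringed space (with a sheaf of topological rings) that is locally isomorphic to formal spectra of admissible rings; morphisms are morphisms of topologically ringed spaces that are local on stalks. A formal scheme is an ordinary scheme if it is covered by open subsets $\mathrm{Spf}\,R=\mathrm{Spec}\,R$ with $R$ discrete. It is Noetherian if it is quasi-compact and covered by open subsets $\mathrm{Spf}\,A$ with $A$ an admissible Noetherian ring whose topology is $I$-adic for some ideal $I$. For a closed ideal $I$ of an admissible ring $A$ let $I^\triangle\subseteq\mathcal O_{\mathrm{Spf}\,A}$ be the ideal sheaf $\varprojlim_J ((I+J)/J)^{\sim}$.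 An ideal sheaf $\mathcal I\subseteq\mathcal O_{\mathcal X}$ is closed if every point of $\mathcal X$ has an affine open neighbourhood $\mathrm{Spf}\,A$ with $\mathcal I|_{\mathrm{Spf}\,A}=I^\triangle$ for some closed ideal $I$ of $A$. A closed immersion is a morphism that is an isomorphism onto $(\mathrm{Supp}\,\mathcal O_{\mathcal X}/\mathcal I,\ \mathcal O_{\mathcal X}/\mathcal I)$ for some closed ideal sheaf $\mathcal I$; an open immersion is an isomorphism onto an open subspace with the restricted sheaf; an immersion is a closed immersion into an open subscheme, that is, a composite $\mathcal Y\to\mathcal U\to\mathcal X$ of a closed immersion and an open immersion. A pseudo-immersion is a morphism $\iota:\mathcal Y\to\mathcal X$ of formal schemes such that for every immersion $Z\to\mathcal Y$ with $Z$ an ordinary scheme the composite $Z\to\mathcal Y\to\mathcal X$ is an immersion. A subscheme (respectively pseudo-subscheme) of $\mathcal X$ is an equivalence class of immersions (respectively pseudo-immersions) into $\mathcal X$, where $f_1:\mathcal Y_1\to\mathcal X$ and $f_2:\mathcal Y_2\to\mathcal X$ are equivalent if $f_1=f_2\circ g$ for some isomorphism $g:\mathcal Y_1\to\mathcal Y_2$.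 **Theorem.** Let $\mathcal X$ be a Noetherian formal scheme. Every pseudo-subscheme of $\mathcal X$ is a subscheme of $\mathcal X$ (that is, every pseudo-immersion into $\mathcal X$ is an immersion) if and only if the underlying topological space of $\mathcal X$ is discrete. -/

import Mathlib

open CategoryTheory AlgebraicGeometry TopologicalSpace Opposite

universe u

noncomputable section

/-! ### Admissible rings -/

/-- An ideal of definition of a topological ring: an open ideal all of whose elements are
topologically nilpotent. -/
structure IsIdealOfDefinition {A : Type u} [CommRing A] [TopologicalSpace A] (I : Ideal A) :
    Prop where
  isOpen : IsOpen (I : Set A)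
  isTopologicallyNilpotent : ∀ f ∈ I, IsTopologicallyNilpotent f

/-- An admissible ring: a topological ring whose topology is given by a descending chain of
ideals, which is separated and complete, and which has an ideal of definition. -/
structure IsAdmissibleRing (A : Type u) [CommRing A] [TopologicalSpace A]
    [IsTopologicalRing A] : Prop where
  exists_basis : ∃ I : ℕ → Ideal A, Antitone I ∧
    (nhds (0 : A)).HasBasis (fun _ => True) (fun n => (I n : Set A))
  separated : T2Space A
  complete : @CompleteSpace A (IsTopologicalAddGroup.rightUniformSpace A)
  exists_idealOfDefinition : ∃ I : Ideal A, IsIdealOfDefinition I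

/-! ### The structure sheaf of `Spec R` as a sheaf of pseudo-discrete rings -/

/-- The ring of sections of the structure sheaf of `Spec R` over `U`. -/
def SpecSections (R : Type u) [CommRing R] (U : Opens (PrimeSpectrum.Top R)) : Type u :=
  (Spec.structureSheaf R).1.obj (op U)

namespace SpecSections

instance (R : Type u) [CommRing R] (U : Opens (PrimeSpectrum.Top R)) :
    CommRing (SpecSections R U) :=
  inferInstanceAs (CommRing ((Spec.structureSheaf R).1.obj (op U)))

/-- For a ring homomorphism `φ : R → S`, the map from sections over `U ⊆ Spec R` to sections over
an open subset `V ⊆ Spec S` that is mapped to `U`. For `φ = id` this is the restriction. -/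
def comap {R S : Type u} [CommRing R] [CommRing S] (φ : R →+* S)
    (U : Opens (PrimeSpectrum.Top R)) (V : Opens (PrimeSpectrum.Top S))
    (h : ∀ p ∈ V, PrimeSpectrum.comap φ p ∈ U) : SpecSections R U →+* SpecSections S V :=
  StructureSheaf.comap φ U V h

/-- Restriction of sections. -/
def res {R : Type u} [CommRing R] {U V : Opens (PrimeSpectrum.Top R)} (h : V ≤ U) :
    SpecSections R U →+* SpecSections R V :=
  ((Spec.structureSheaf R).1.map (homOfLE h).op).hom

/-- The topology on the sections over `U`: the limit of the discrete rings of sections over the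
quasi-compact open subsets of `U`. It is discrete if `U` is quasi-compact. -/
instance (R : Type u) [CommRing R] (U : Opens (PrimeSpectrum.Top R)) :
    TopologicalSpace (SpecSections R U) :=
  ⨅ W : {W : Opens (PrimeSpectrum.Top R) // W ≤ U ∧ IsCompact (W : Set (PrimeSpectrum.Top R))},
    TopologicalSpace.induced (res W.2.1) ⊥

instance (R : Type u) [CommRing R] (U : Opens (PrimeSpectrum.Top R)) :
    IsTopologicalRing (SpecSections R U) := by
  have hmul : ContinuousMul (SpecSections R U) := continuousMul_iInf fun W => by
    let : TopologicalSpace (SpecSections R W.1) := ⊥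
    have : DiscreteTopology (SpecSections R W.1) := ⟨rfl⟩
    exact continuousMul_induced (res W.2.1)
  have hadd : IsTopologicalAddGroup (SpecSections R U) := topologicalAddGroup_iInf fun W => by
    let : TopologicalSpace (SpecSections R W.1) := ⊥
    have : DiscreteTopology (SpecSections R W.1) := ⟨rfl⟩
    exact topologicalAddGroup_induced (res W.2.1)
  exact { }

end SpecSections

/-! ### The formal spectrum -/

/-- The open ideals of a topological ring. -/
abbrev OpenIdeal (A : Type u) [CommRing A] [TopologicalSpace A] : Type u :=
  {J : Ideal A // IsOpen (J : Set A)}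

/-- The underlying space of `Spf A`: the open prime ideals, with the Zariski topology. -/
abbrev SpfPoint (A : Type u) [CommRing A] [TopologicalSpace A] : Type u :=
  {p : PrimeSpectrum A // IsOpen (p.asIdeal : Set A)}

namespace Spf

variable (A : Type u) [CommRing A] [TopologicalSpace A] [IsTopologicalRing A]

/-- The underlying topological space of `Spf A`. -/
abbrev top : TopCat.{u} := TopCat.of (SpfPoint A)

variable {A}

/-- The inclusion `Spec (A / J) → Spf A` for an open ideal `J`, on points. -/
def ofSpec (J : OpenIdeal A) (p : PrimeSpectrum (A ⧸ J.1)) : SpfPoint A :=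
  ⟨PrimeSpectrum.comap (Ideal.Quotient.mk J.1) p, by
    have hle : J.1 ≤ (PrimeSpectrum.comap (Ideal.Quotient.mk J.1) p).asIdeal := by
      intro a ha
      have h0 : Ideal.Quotient.mk J.1 a = 0 := Ideal.Quotient.eq_zero_iff_mem.mpr ha
      change Ideal.Quotient.mk J.1 a ∈ p.asIdeal
      rw [h0]
      exact p.asIdeal.zero_mem
    exact AddSubgroup.isOpen_mono (H₁ := J.1.toAddSubgroup)
      (H₂ := (PrimeSpectrum.comap (Ideal.Quotient.mk J.1) p).asIdeal.toAddSubgroup) hle J.2⟩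

theorem continuous_ofSpec (J : OpenIdeal A) : Continuous (ofSpec J) :=
  Continuous.subtype_mk (PrimeSpectrum.continuous_comap _) _

/-- The open subset `U ∩ Spec (A / J)` of `Spec (A / J)`. -/
def openOf (U : Opens (top A)) (J : OpenIdeal A) : Opens (PrimeSpectrum.Top (A ⧸ J.1)) :=
  ⟨ofSpec J ⁻¹' (U : Set (SpfPoint A)), U.2.preimage (continuous_ofSpec J)⟩

theorem openOf_comap (U : Opens (top A)) {J K : OpenIdeal A} (h : J.1 ≤ K.1) :
    ∀ p ∈ openOf U K, PrimeSpectrum.comap (Ideal.Quotient.factor h) p ∈ openOf U J :=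
  fun _ hp => hp

theorem openOf_mono {U V : Opens (top A)} (h : V ≤ U) (J : OpenIdeal A) :
    openOf V J ≤ openOf U J :=
  fun _ hp => h hp

/-- The sections of the structure sheaf of `Spf A` over `U`: the limit of the topological rings of
sections of `Spec (A / J)` over `U ∩ Spec (A / J)`, where `J` runs through the open ideals. -/
def sections (U : Opens (top A)) : Subring (∀ J : OpenIdeal A, SpecSections (A ⧸ J.1) (openOf U J))
    where
  carrier := {s | ∀ (J K : OpenIdeal A) (h : J.1 ≤ K.1),
    SpecSections.comap (Ideal.Quotient.factor h) (openOf U J) (openOf U K) (openOf_comap U h)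
      (s J) = s K}
  mul_mem' hs ht J K h := by simp only [Pi.mul_apply, map_mul, hs J K h, ht J K h]
  one_mem' J K h := by simp only [Pi.one_apply, map_one]
  add_mem' hs ht J K h := by simp only [Pi.add_apply, map_add, hs J K h, ht J K h]
  zero_mem' J K h := by simp only [Pi.zero_apply, map_zero]
  neg_mem' hs J K h := by simp only [Pi.neg_apply, map_neg, hs J K h]

/-- Restriction of sections on `Spf A`. -/
def res {U V : Opens (top A)} (h : V ≤ U) : sections U →+* sections V where
  toFun s := ⟨fun J => SpecSections.res (openOf_mono h J) (s.1 J), fun J K hJK => by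
    change _ = SpecSections.res (openOf_mono h K) (s.1 K)
    rw [← s.2 J K hJK]
    rfl⟩
  map_one' := Subtype.ext (funext fun J => map_one (SpecSections.res (openOf_mono h J)))
  map_zero' := Subtype.ext (funext fun J => map_zero (SpecSections.res (openOf_mono h J)))
  map_mul' s t := Subtype.ext (funext fun J =>
    map_mul (SpecSections.res (openOf_mono h J)) (s.1 J) (t.1 J))
  map_add' s t := Subtype.ext (funext fun J =>
    map_add (SpecSections.res (openOf_mono h J)) (s.1 J) (t.1 J))

theorem continuous_res {U V : Opens (top A)} (h : V ≤ U) : Continuous (res h) := by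
  refine Continuous.subtype_mk (continuous_pi fun J => ?_) _
  refine Continuous.comp (g := SpecSections.res (openOf_mono h J)) ?_
    ((continuous_apply J).comp continuous_subtype_val)
  refine continuous_iInf_rng.mpr fun W => continuous_induced_rng.mpr ?_
  exact continuous_iInf_dom (i := ⟨W.1, W.2.1.trans (openOf_mono h J), W.2.2⟩)
    continuous_induced_dom

end Spf

/-- The formal spectrum of a topological ring, as a topologically ringed space. -/
def Spf (A : TopCommRingCat.{u}) : PresheafedSpace TopCommRingCat.{u} where
  carrier := Spf.top A
  presheaf :=
    { obj := fun U => TopCommRingCat.of (Spf.sections U.unop)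
      map := fun i => ⟨Spf.res i.unop.le, Spf.continuous_res i.unop.le⟩
      map_id := fun _ => rfl
      map_comp := fun _ _ => rfl }

/-! ### Formal schemes -/

/-- An affine open subset of a topologically ringed space: an open immersion from the formal
spectrum of an admissible ring. -/
structure AffineChart (X : PresheafedSpace TopCommRingCat.{u}) where
  /-- the admissible ring -/
  ring : TopCommRingCat.{u}
  isAdmissible : IsAdmissibleRing ring
  /-- the open immersion -/
  map : Spf ring ⟶ X
  isOpenImmersion : PresheafedSpace.IsOpenImmersion map

/-- The open subset of `X` given by an affine chart. -/
def AffineChart.range {X : PresheafedSpace TopCommRingCat.{u}} (c : AffineChart X) : Opens X :=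
  ⟨Set.range c.map.base, c.isOpenImmersion.base_open.isOpen_range⟩

/-- A formal scheme: a space with a sheaf of topological rings, which is covered by open subsets
that are isomorphic to formal spectra of admissible rings. -/
structure FormalScheme extends PresheafedSpace TopCommRingCat.{u} where
  isSheaf : presheaf.IsSheaf
  exists_chart : ∀ x : carrier, ∃ c : AffineChart toPresheafedSpace, x ∈ c.range

namespace FormalScheme

/-- The ringed space underlying a topologically ringed space. -/
abbrev forgetTopology : PresheafedSpace TopCommRingCat.{u} ⥤ PresheafedSpace CommRingCat.{u} :=
  (forget₂ TopCommRingCat.{u} CommRingCat.{u}).mapPresheaf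

/-- A morphism of formal schemes: a morphism of topologically ringed spaces such that the maps of
stalks are local homomorphisms. -/
@[ext]
structure Hom (X Y : FormalScheme.{u}) where
  /-- the morphism of topologically ringed spaces -/
  hom : X.toPresheafedSpace ⟶ Y.toPresheafedSpace
  isLocalHom : ∀ x : forgetTopology.obj X.toPresheafedSpace,
    IsLocalHom (PresheafedSpace.Hom.stalkMap (forgetTopology.map hom) x).hom

instance : Category FormalScheme.{u} where
  Hom := Hom
  id X := ⟨𝟙 _, fun x => by
    rw [CategoryTheory.Functor.map_id, PresheafedSpace.stalkMap.id]
    exact ⟨fun _ h => h⟩⟩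
  comp f g := ⟨f.hom ≫ g.hom, fun x => by
    rw [CategoryTheory.Functor.map_comp, PresheafedSpace.stalkMap.comp]
    exact @RingHom.isLocalHom_comp _ _ _ _ _ _ _ _ (f.isLocalHom x)
      (g.isLocalHom ((forgetTopology.map f.hom).base x))⟩
  id_comp f := Hom.ext (Category.id_comp f.hom)
  comp_id f := Hom.ext (Category.comp_id f.hom)
  assoc f g h := Hom.ext (Category.assoc f.hom g.hom h.hom)

/-- The ring of sections of the structure sheaf over `U`. -/
abbrev sections (X : FormalScheme.{u}) (U : Opens X.carrier) : TopCommRingCat.{u} :=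
  X.presheaf.obj (op U)

/-- Restriction of sections. -/
abbrev res (X : FormalScheme.{u}) {U V : Opens X.carrier} (h : V ≤ U) :
    X.sections U →+* X.sections V :=
  (X.presheaf.map (homOfLE h).op).1

/-- The inverse image of an open subset. -/
abbrev Hom.preimage {X Y : FormalScheme.{u}} (f : X ⟶ Y) (U : Opens Y.carrier) :
    Opens X.carrier :=
  (Opens.map f.hom.base).obj U

/-- The map `𝒪_Y(U) → 𝒪_X(f⁻¹ U)`. -/
abbrev Hom.app {X Y : FormalScheme.{u}} (f : X ⟶ Y) (U : Opens Y.carrier) :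
    Y.sections U →+* X.sections (Hom.preimage f U) :=
  (f.hom.c.app (op U)).1

/-- An ordinary scheme: a formal scheme that is covered by spectra of discrete rings. -/
def IsOrdinary (X : FormalScheme.{u}) : Prop :=
  ∀ x : X.carrier, ∃ c : AffineChart X.toPresheafedSpace, x ∈ c.range ∧ DiscreteTopology c.ring

/-- A Noetherian formal scheme: a quasi-compact formal scheme that is covered by formal spectra of
Noetherian adic rings. -/
structure IsNoetherian (X : FormalScheme.{u}) : Prop where
  compactSpace : CompactSpace X.carrier
  exists_chart : ∀ x : X.carrier, ∃ c : AffineChart X.toPresheafedSpace, x ∈ c.range ∧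
    IsNoetherianRing c.ring ∧ ∃ I : Ideal c.ring, IsAdic I

/-! ### Ideal sheaves -/

/-- A sheaf of ideals of the structure sheaf. -/
structure IdealSheaf (X : FormalScheme.{u}) where
  /-- the ideal of sections over an open set -/
  ideal : ∀ U : Opens X.carrier, Ideal (X.sections U)
  res_mem : ∀ {U V : Opens X.carrier} (h : V ≤ U), ∀ s ∈ ideal U, X.res h s ∈ ideal V
  mem_of_locally : ∀ (U : Opens X.carrier) (s : X.sections U),
    (∀ x ∈ U, ∃ (V : Opens X.carrier) (h : V ≤ U), x ∈ V ∧ X.res h s ∈ ideal V) → s ∈ ideal U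

/-- The sections over `U` of the ideal sheaf `I^△` on `Spf A` given by an ideal `I` of `A`: the
sections whose component on `Spec (A / J)` lies, for every open ideal `J`, in the quasi-coherent
ideal sheaf given by `(I + J) / J`, that is, vanishes on `Spec (A / (I + J))`. -/
def triangle {A : TopCommRingCat.{u}} (I : Ideal A) (U : Opens (Spf A).carrier) :
    Set ((Spf A).presheaf.obj (op U)) :=
  {s : Spf.sections (A := A) U | ∀ K : OpenIdeal A, I ≤ K.1 → s.1 K = 0}

/-- A closed ideal sheaf: every point has an affine neighbourhood `Spf A` on which the ideal sheaf
is `I^△` for some closed ideal `I` of `A`. -/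
def IdealSheaf.IsClosed {X : FormalScheme.{u}} (𝓘 : IdealSheaf X) : Prop :=
  ∀ x : X.carrier, ∃ c : AffineChart X.toPresheafedSpace, x ∈ c.range ∧
    ∃ I : Ideal c.ring, _root_.IsClosed (I : Set c.ring) ∧
      ∀ U : Opens X.carrier, U ≤ c.range → ∀ s : X.sections U,
        s ∈ 𝓘.ideal U ↔ (c.map.c.app (op U)).1 s ∈ triangle I ((Opens.map c.map.base).obj U)

/-- The support of `𝒪_X / 𝓘`: the points at which the stalk of `𝓘` does not contain `1`. -/
def IdealSheaf.support {X : FormalScheme.{u}} (𝓘 : IdealSheaf X) : Set X.carrier :=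
  {x | ∀ U : Opens X.carrier, x ∈ U → (1 : X.sections U) ∉ 𝓘.ideal U}

/-! ### Immersions -/

/-- The morphism `f : Y → X` is an isomorphism onto the closed subscheme
`(Supp (𝒪_X / 𝓘), 𝒪_X / 𝓘)`: it is a homeomorphism onto the support, and `f_* 𝒪_Y` is the quotient
sheaf of topological rings `𝒪_X / 𝓘`, that is, the kernel of `𝒪_X → f_* 𝒪_Y` is `𝓘` and, for all
`U` in a basis of open sets, `𝒪_Y(f⁻¹ U)` is the quotient of `𝒪_X(U)` with the quotient
topology. -/
structure IsIsoOntoClosedSubscheme {X Y : FormalScheme.{u}} (f : Y ⟶ X) (𝓘 : IdealSheaf X) :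
    Prop where
  isEmbedding : Topology.IsEmbedding f.hom.base
  range_eq : Set.range f.hom.base = 𝓘.support
  ker_eq : ∀ U : Opens X.carrier, RingHom.ker (Hom.app f U) = 𝓘.ideal U
  quotient : ∃ B : Set (Opens X.carrier), Opens.IsBasis B ∧
    ∀ U ∈ B, IsOpenQuotientMap (Hom.app f U)

/-- A closed immersion: an isomorphism onto the closed subscheme defined by a closed ideal
sheaf. -/
def IsClosedImmersion {X Y : FormalScheme.{u}} (f : Y ⟶ X) : Prop :=
  ∃ 𝓘 : IdealSheaf X, 𝓘.IsClosed ∧ IsIsoOntoClosedSubscheme f 𝓘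

/-- An open immersion: an isomorphism onto an open subscheme. -/
def IsOpenImmersion {X Y : FormalScheme.{u}} (f : Y ⟶ X) : Prop :=
  PresheafedSpace.IsOpenImmersion f.hom

/-- An immersion: an isomorphism onto a closed subscheme of an open subscheme. -/
def IsImmersion {X Y : FormalScheme.{u}} (f : Y ⟶ X) : Prop :=
  ∃ (W : FormalScheme.{u}) (i : Y ⟶ W) (j : W ⟶ X),
    IsClosedImmersion i ∧ IsOpenImmersion j ∧ i ≫ j = f

/-- A pseudo-immersion: a morphism `f : Y → X` whose composition with every immersion of an ordinary
scheme into `Y` is an immersion. -/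
def IsPseudoImmersion {X Y : FormalScheme.{u}} (f : Y ⟶ X) : Prop :=
  ∀ (Z : FormalScheme.{u}) (i : Z ⟶ Y), Z.IsOrdinary → IsImmersion i → IsImmersion (i ≫ f)

end FormalScheme

end

set_option linter.unusedSectionVars false

noncomputable section

/-! ### Sheaves of topological rings -/

namespace TopCommRingCat

/-! Necessity. Given a point of `X`, take a Noetherian adic chart `Spf A` around it, with topology
defined by `I`, and let `m` be a maximal ideal containing the corresponding open prime `p`; then `m`
is open too. Put `B = lim A / m ^ n` with the limit topology. `Spf B` has a single point, and `Spf B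
→ Spf A → X` is a pseudo-immersion: an ordinary scheme immersed in `Spf B` is empty or one point
with discrete sections, so `A` maps onto these sections (it is dense in `B`) with an open kernel,
and the scheme is the closed subscheme of `Spf A` cut out by that kernel
(`isClosedImmersion_comp_mapHom_of`). If this map is an immersion, it is open on sections near the
point, so the `I`-adic topology induces the limit topology on the image. Comparing neighbourhoods of
zero gives `m ^ n ⊆ m ^ (n + 1) + I` for some `n`. By Nakayama some `r ≡ 1` modulo `m` satisfies `r
m ^ n ⊆ I`; every open prime contains `I`, so `D(r)` contains no point but `m`. Thus `m` is an open
point of `Spf A`, and its generization `p` must coincide with it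
(`discreteTopology_of_isImmersion`).

Sufficiency. Let `X` be discrete and `f : Y → X` a pseudo-immersion. Testing on `Spec (R / J)`, for
`J` an ideal of definition of a chart ring `R` of `Y`, shows that `Y` is discrete. The residue
fields of all points of `Y` together form one ordinary closed subscheme, and testing on it shows
that `f` is injective. Testing on `Spec (R / K)` for smaller and smaller open `K` shows that `𝒪_X →
f_* 𝒪_Y` has dense image over each point. Passing from dense image to an open surjection is
Chevalley's theorem: a Noetherian chart ring of `X` is complete, and its quotients by open ideals
are Artinian since their spectra are discrete; in such a ring a descending chain of open ideals
defines the quotient topology modulo its intersection (`exists_le_sup_iInf`,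
`surjective_and_exists_le_map`). Finally the kernel of `𝒪_X → f_* 𝒪_Y` is a closed ideal sheaf,
because sections over a discrete space can be extended by zero (`isClosed_kerSheaf`). So `f` is even
a closed immersion. -/

/-- A presheaf of topological rings is a sheaf if sections glue uniquely and the topology on the
sections over a union is induced from the members of the cover. -/
theorem isSheaf_of_existsUnique_gluing {X : TopCat.{u}} (F : X.Presheaf TopCommRingCat.{u})
    (glue : ∀ (ι : Type u) (U : ι → Opens X) (s : ∀ i, F.obj (op (U i))),
      (∀ i j, (F.map (Opens.infLELeft (U i) (U j)).op).1 (s i) =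
        (F.map (Opens.infLERight (U i) (U j)).op).1 (s j)) →
      ∃! t : F.obj (op (iSup U)), ∀ i, (F.map (Opens.leSupr U i).op).1 t = s i)
    (ind : ∀ (ι : Type u) (U : ι → Opens X),
      (⨅ i, TopologicalSpace.induced (F.map (Opens.leSupr U i).op).1 inferInstance) ≤
        (F.obj (op (iSup U))).isTopologicalSpace) :
    F.IsSheaf := by
  intro E
  refine (isSheaf_iff_isSheaf_of_type _ _).mp
    ((TopCat.Presheaf.isSheaf_iff_isSheafUniqueGluing_types (F ⋙ coyoneda.obj (op E))).mpr ?_)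
  intro ι U sf hsf
  let sf' : ∀ i, E ⟶ F.obj (op (U i)) := sf
  have hcomp : ∀ (e : E) (i j), (F.map (Opens.infLELeft (U i) (U j)).op).1 ((sf' i).1 e) =
        (F.map (Opens.infLERight (U i) (U j)).op).1 ((sf' j).1 e) := by
    intro e i j
    have h : sf' i ≫ F.map (Opens.infLELeft (U i) (U j)).op =
      sf' j ≫ F.map (Opens.infLERight (U i) (U j)).op := hsf i j
    exact congrArg (fun g : E ⟶ F.obj (op (U i ⊓ U j)) => g.1 e) h
  -- The sheaf condition concerns morphisms out of an arbitrary `E`. Gluing is done separately at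
  -- each `e : E`; uniqueness makes the result a ring homomorphism and `ind` makes it continuous.
  choose g hg hg' using fun e : E => glue ι U (fun i => (sf' i).1 e) (hcomp e)
  dsimp only at hg hg'
  let G : E →+* F.obj (op (iSup U)) :=
    { toFun := g
      map_one' := (hg' 1 1 fun i => by rw [map_one, map_one]).symm
      map_zero' := (hg' 0 0 fun i => by rw [map_zero, map_zero]).symm
      map_mul' a b := (hg' _ _ fun i => by rw [map_mul, map_mul, hg a i, hg b i]).symm
      map_add' a b := (hg' _ _ fun i => by rw [map_add, map_add, hg a i, hg b i]).symm }
  have hG : Continuous G := by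
    refine continuous_le_rng (ind ι U) ?_
    refine continuous_iInf_rng.mpr fun i => continuous_induced_rng.mpr ?_
    convert (sf' i).2 using 1
    funext e
    exact hg e i
  refine ⟨(⟨G, hG⟩ : E ⟶ F.obj (op (iSup U))), fun i => ?_, fun t ht => ?_⟩
  · exact Subtype.ext (RingHom.ext fun e => hg e i)
  · refine Subtype.ext (RingHom.ext fun e => hg' e _ fun i => ?_)
    have h : (show E ⟶ F.obj (op (iSup U)) from t) ≫ F.map (Opens.leSupr U i).op = sf' i := ht i
    exact congrArg (fun g : E ⟶ F.obj (op (U i)) => g.1 e) h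

/-- The polynomial ring in one variable over the integers, with the discrete topology. -/
def polynomialRing : TopCommRingCat.{u} :=
  letI : TopologicalSpace (MvPolynomial PUnit.{u + 1} ℤ) := ⊥
  haveI : DiscreteTopology (MvPolynomial PUnit.{u + 1} ℤ) := ⟨rfl⟩
  of (MvPolynomial PUnit.{u + 1} ℤ)

/-- The morphism from the polynomial ring given by an element. -/
def polynomialRing.lift (R : TopCommRingCat.{u}) (r : R) : polynomialRing.{u} ⟶ R :=
  ⟨(MvPolynomial.aeval (R := ℤ) (fun _ : PUnit.{u + 1} => r)).toRingHom,
    continuous_bot⟩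

/-- The variable of the polynomial ring. -/
def polynomialRing.var : polynomialRing.{u} := (MvPolynomial.X PUnit.unit : MvPolynomial PUnit ℤ)

theorem polynomialRing.lift_var (R : TopCommRingCat.{u}) (r : R) :
    (polynomialRing.lift R r).1 polynomialRing.var = r :=
  MvPolynomial.aeval_X (R := ℤ) (fun _ : PUnit.{u + 1} => r) PUnit.unit

theorem polynomialRing.hom_ext {R : TopCommRingCat.{u}} {f g : polynomialRing.{u} ⟶ R}
    (h : f.1 polynomialRing.var = g.1 polynomialRing.var) : f = g :=
  Subtype.ext (MvPolynomial.ringHom_ext' (Subsingleton.elim _ _) fun _ => h)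

/-- Sections of a sheaf of topological rings glue uniquely. -/
theorem existsUnique_gluing {X : TopCat.{u}} {F : X.Presheaf TopCommRingCat.{u}} (hF : F.IsSheaf)
    {ι : Type u} (U : ι → Opens X) (s : ∀ i, F.obj (op (U i)))
    (hs : ∀ i j, (F.map (Opens.infLELeft (U i) (U j)).op).1 (s i) =
        (F.map (Opens.infLERight (U i) (U j)).op).1 (s j)) :
    ∃! t : F.obj (op (iSup U)), ∀ i, (F.map (Opens.leSupr U i).op).1 t = s i := by
  -- Morphisms from the discrete ring `ℤ[X]` are the elements of the target, so the sheaf condition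
  -- tested on this one object is unique gluing of elements.
  have H := (TopCat.Presheaf.isSheaf_iff_isSheafUniqueGluing_types
    (F ⋙ coyoneda.obj (op polynomialRing))).mp
      ((isSheaf_iff_isSheaf_of_type _ _).mpr (hF polynomialRing))
  obtain ⟨t, ht, ht'⟩ := H U (fun i => polynomialRing.lift _ (s i)) (fun i j => by
    refine polynomialRing.hom_ext (R := F.obj (op (U i ⊓ U j))) ?_
    change (F.map (Opens.infLELeft (U i) (U j)).op).1 ((polynomialRing.lift _ (s i)).1 _) =
      (F.map (Opens.infLERight (U i) (U j)).op).1 ((polynomialRing.lift _ (s j)).1 _)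
    rw [polynomialRing.lift_var, polynomialRing.lift_var]
    exact hs i j)
  let t' : polynomialRing ⟶ F.obj (op (iSup U)) := t
  refine ⟨t'.1 polynomialRing.var, fun i => ?_, fun r hr => ?_⟩
  · have h : t' ≫ F.map (Opens.leSupr U i).op = polynomialRing.lift _ (s i) := ht i
    have h2 := congrArg (fun g : polynomialRing ⟶ F.obj (op (U i)) => g.1 polynomialRing.var) h
    exact h2.trans (polynomialRing.lift_var _ _)
  · have h : polynomialRing.lift _ r = t' := ht' (polynomialRing.lift _ r) fun i => by
      refine polynomialRing.hom_ext (R := F.obj (op (U i))) ?_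
      change (F.map (Opens.leSupr U i).op).1 ((polynomialRing.lift _ r).1 _) = _
      rw [polynomialRing.lift_var, polynomialRing.lift_var]
      exact hr i
    rw [← h, polynomialRing.lift_var]

end TopCommRingCat

/-! ### Gluing of sections, and locality on stalks in terms of units -/

namespace FormalScheme

variable {X Y Z : FormalScheme.{u}}

theorem res_res {U V W : Opens X.carrier} (h : V ≤ U) (h' : W ≤ V) (s : X.sections U) :
    X.res h' (X.res h s) = X.res (h'.trans h) s := by
  have := X.presheaf.map_comp (homOfLE h).op (homOfLE h').op
  exact (congrArg (fun g : X.sections U ⟶ X.sections W => g.1 s) this).symm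

theorem res_self {U : Opens X.carrier} (h : U ≤ U) (s : X.sections U) : X.res h s = s := by
  have := X.presheaf.map_id (op U)
  exact (congrArg (fun g : X.sections U ⟶ X.sections U => g.1 s) this)

theorem app_res (f : Y ⟶ X) {U V : Opens X.carrier} (h : V ≤ U) (s : X.sections U) :
    Hom.app f V (X.res h s) = Y.res (fun _ hx => h hx : Hom.preimage f V ≤ Hom.preimage f U)
      (Hom.app f U s) := by
  have := f.hom.c.naturality (homOfLE h).op
  exact (congrArg (fun g : X.sections U ⟶ Y.sections (Hom.preimage f V) => g.1 s) this)

/-- Sections which agree locally are equal. -/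
theorem eq_of_locally_eq {U : Opens X.carrier} {s t : X.sections U}
    (h : ∀ x ∈ U, ∃ (V : Opens X.carrier) (hV : V ≤ U), x ∈ V ∧ X.res hV s = X.res hV t) :
    s = t := by
  choose V hV hxV hst using fun x : U => h x.1 x.2
  have hU : U ≤ iSup V := fun x hx => Opens.mem_iSup.mpr ⟨⟨x, hx⟩, hxV ⟨x, hx⟩⟩
  obtain ⟨r, -, hr⟩ := TopCommRingCat.existsUnique_gluing X.isSheaf V (fun x => X.res (hV x) s)
    fun i j => (res_res (hV i) _ s).trans (res_res (hV j) _ s).symm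
  have h₁ := hr (X.res (iSup_le hV) s) fun i => res_res _ _ s
  have h₂ := hr (X.res (iSup_le hV) t) fun i => (res_res _ _ t).trans (hst i).symm
  rw [← res_self le_rfl s, ← res_self le_rfl t, ← res_res (iSup_le hV) hU s,
    ← res_res (iSup_le hV) hU t, h₁, h₂]

theorem subsingleton_sections_bot : Subsingleton (X.sections ⊥) :=
  ⟨fun _ _ => eq_of_locally_eq fun _ hx => hx.elim⟩

theorem subsingleton_sections {U : Opens X.carrier} (hU : U = ⊥) : Subsingleton (X.sections U) := by
  subst hU
  exact subsingleton_sections_bot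

/-- Sections over two disjoint open sets glue. -/
theorem exists_gluing₂ {U V₁ V₂ : Opens X.carrier} (h₁ : V₁ ≤ U) (h₂ : V₂ ≤ U)
    (hU : U ≤ V₁ ⊔ V₂) (hV : V₁ ⊓ V₂ = ⊥) (s₁ : X.sections V₁) (s₂ : X.sections V₂) :
    ∃ t : X.sections U, X.res h₁ t = s₁ ∧ X.res h₂ t = s₂ := by
  let V : ULift.{u} Bool → Opens X.carrier := fun b => if b.down then V₁ else V₂
  let s : ∀ b, X.sections (V b) := fun b =>
    match b with
    | ⟨true⟩ => s₁
    | ⟨false⟩ => s₂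
  have hUV : U ≤ iSup V := fun x hx => Opens.mem_iSup.mpr
    ((hU hx).elim (fun h => ⟨⟨true⟩, h⟩) fun h => ⟨⟨false⟩, h⟩)
  obtain ⟨t, ht, -⟩ := TopCommRingCat.existsUnique_gluing X.isSheaf V s (by
    rintro ⟨_ | _⟩ ⟨_ | _⟩
    · rfl
    · exact @Subsingleton.elim _ (subsingleton_sections ((inf_comm _ _).trans hV)) _ _
    · exact @Subsingleton.elim _ (subsingleton_sections hV) _ _
    · rfl)
  refine ⟨X.res hUV t, ?_, ?_⟩
  · exact (res_res hUV h₁ t).trans (ht ⟨true⟩)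
  · exact (res_res hUV h₂ t).trans (ht ⟨false⟩)

/-- A section of a presheaf of rings whose germ at a point is invertible is invertible in a
neighbourhood of the point. -/
theorem exists_isUnit_res_of_isUnit_germ {X : TopCat.{u}} (F : X.Presheaf CommRingCat.{u})
    (U : Opens X) (f : F.obj (op U)) (x : X) (hx : x ∈ U) (h : IsUnit (F.germ U x hx f)) :
    ∃ (V : Opens X) (i : V ⟶ U) (_ : x ∈ V), IsUnit (F.map i.op f) := by
  obtain ⟨g', heq⟩ := h.exists_right_inv
  obtain ⟨V, hxV, g, rfl⟩ := F.exists_germ_eq g'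
  let W := U ⊓ V
  have hxW : x ∈ W := ⟨hx, hxV⟩
  replace heq : (F.germ _ x hxW) ((F.map (U.infLELeft V).op) f *
      (F.map (U.infLERight V).op) g) = (F.germ _ x hxW) 1 := by
    rwa [map_mul, map_one, F.germ_res_apply (Opens.infLELeft U V) x hxW f,
      F.germ_res_apply (Opens.infLERight U V) x hxW g]
  obtain ⟨W', hxW', i₁, i₂, heq'⟩ := F.germ_eq x hxW hxW _ _ heq
  use W', i₁ ≫ Opens.infLELeft U V, hxW'
  simp only [map_mul, map_one] at heq'
  simpa using IsUnit.of_mul_eq_one _ heq'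

/-- A morphism of ringed spaces is local on stalks if sections whose pullback is
invertible near a point are invertible near the image of the point. -/
theorem isLocalHom_stalkMap_of_isUnit_res {X Y : PresheafedSpace CommRingCat.{u}} (f : Y ⟶ X)
    (y : Y) (H : ∀ (U : Opens X) (s : X.presheaf.obj (op U)) (V : Opens Y)
      (hV : V ≤ (Opens.map f.base).obj U), y ∈ V →
      IsUnit ((Y.presheaf.map (homOfLE hV).op) (f.c.app (op U) s)) →
      ∃ (W : Opens X) (hW : W ≤ U), f.base y ∈ W ∧ IsUnit (X.presheaf.map (homOfLE hW).op s)) :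
    IsLocalHom (f.stalkMap y).hom := by
  refine ⟨fun a ha => ?_⟩
  obtain ⟨U, hyU, s, rfl⟩ := TopCat.Presheaf.exists_germ_eq X.presheaf a
  replace ha : IsUnit (f.stalkMap y (X.presheaf.germ U (f.base y) hyU s)) := ha
  rw [PresheafedSpace.stalkMap_germ_apply f U y hyU s] at ha
  obtain ⟨V, i, hyV, hV⟩ := exists_isUnit_res_of_isUnit_germ Y.presheaf _ _ _ _ ha
  obtain ⟨W, hW, hyW, h⟩ := H U s V i.le hyV hV
  rw [← TopCat.Presheaf.germ_res_apply X.presheaf (homOfLE hW) _ hyW s]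
  exact RingHom.isUnit_map (X.presheaf.germ W (f.base y) hyW).hom h

/-- A morphism of topologically ringed spaces is local on stalks if sections whose pullback is
invertible near a point are invertible near the image of the point. -/
theorem isLocalHom_stalkMap {X Y : PresheafedSpace TopCommRingCat.{u}} (f : Y ⟶ X) (y : Y)
    (H : ∀ (U : Opens X) (s : X.presheaf.obj (op U)) (V : Opens Y)
      (hV : V ≤ (Opens.map f.base).obj U), y ∈ V →
      IsUnit ((Y.presheaf.map (homOfLE hV).op).1 ((f.c.app (op U)).1 s)) →
      ∃ (W : Opens X) (hW : W ≤ U), f.base y ∈ W ∧ IsUnit ((X.presheaf.map (homOfLE hW).op).1 s)) :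
    IsLocalHom (PresheafedSpace.Hom.stalkMap (forgetTopology.map f) y).hom :=
  isLocalHom_stalkMap_of_isUnit_res (forgetTopology.map f) y H

end FormalScheme

/-! ### Sections of the structure sheaf of a prime spectrum -/

namespace SpecSections

variable {R S : Type u} [CommRing R] [CommRing S] {U V : Opens (PrimeSpectrum.Top R)}

/-- The value of a section at a point, in the localization at that point. -/
def value (p : PrimeSpectrum R) (hp : p ∈ U) :
    SpecSections R U →+* Localization.AtPrime p.asIdeal where
  toFun s := s.1 ⟨p, hp⟩
  map_one' := rfl
  map_zero' := rfl
  map_mul' _ _ := rfl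
  map_add' _ _ := rfl

theorem ext_value {s t : SpecSections R U}
    (h : ∀ (p : PrimeSpectrum R) (hp : p ∈ U), value p hp s = value p hp t) : s = t :=
  Subtype.ext (funext fun p => h p.1 p.2)

theorem value_res (h : V ≤ U) (p : PrimeSpectrum R) (hp : p ∈ V) (s : SpecSections R U) :
    value p hp (res h s) = value p (h hp) s := rfl

theorem value_comap (φ : R →+* S) {V : Opens (PrimeSpectrum.Top S)}
    (h : ∀ p ∈ V, PrimeSpectrum.comap φ p ∈ U) (q : PrimeSpectrum S) (hq : q ∈ V)
    (s : SpecSections R U) :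
    value q hq (comap φ U V h s) =
      Localization.localRingHom (PrimeSpectrum.comap φ q).asIdeal q.asIdeal φ rfl
        (value (PrimeSpectrum.comap φ q) (h q hq) s) :=
  StructureSheaf.comap_apply φ U V h s ⟨q, hq⟩

/-- The induced map of local rings is local, so invertibility at a point is not changed by pullback.
This makes `Spf.IsUnitAt` independent of the open ideal used to test it. -/
theorem isUnit_value_comap (φ : R →+* S) {V : Opens (PrimeSpectrum.Top S)}
    (h : ∀ p ∈ V, PrimeSpectrum.comap φ p ∈ U) (q : PrimeSpectrum S) (hq : q ∈ V)
    (s : SpecSections R U) :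
    IsUnit (value q hq (comap φ U V h s)) ↔ IsUnit (value (PrimeSpectrum.comap φ q) (h q hq) s) := by
  rw [value_comap]
  exact ⟨fun h => (Localization.isLocalHom_localRingHom _ _ φ rfl).map_nonunit _ h,
    fun h => h.map _⟩

/-- The section given by an element of the ring. -/
def ofRing (U : Opens (PrimeSpectrum.Top R)) : R →+* SpecSections R U :=
  algebraMap R ((structureSheafInType R R).obj.obj (op U))

theorem value_ofRing (p : PrimeSpectrum R) (hp : p ∈ U) (r : R) :
    value p hp (ofRing U r) = algebraMap R _ r := rfl

theorem comap_ofRing (φ : R →+* S) {V : Opens (PrimeSpectrum.Top S)}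
    (h : ∀ p ∈ V, PrimeSpectrum.comap φ p ∈ U) (r : R) :
    comap φ U V h (ofRing U r) = ofRing V (φ r) := by
  refine ext_value fun q hq => ?_
  rw [value_comap, value_ofRing, value_ofRing]
  exact Localization.localRingHom_to_map _ _ _ _ _

/-- Near every point a section is a fraction. -/
theorem exists_fraction (s : SpecSections R U) (p : PrimeSpectrum R) (hp : p ∈ U) :
    ∃ (g f : R), p ∈ PrimeSpectrum.basicOpen g ∧ ∃ h : PrimeSpectrum.basicOpen g ≤ U,
      ∀ (q : PrimeSpectrum R) (hq : q ∈ PrimeSpectrum.basicOpen g),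
        value q (h hq) s * algebraMap R _ g = algebraMap R _ f := by
  obtain ⟨g, hpg, i, f, h⟩ := StructureSheaf.exists_const U s p hp
  refine ⟨g, f, hpg, i, fun q hq => ?_⟩
  have h1 : Localization.mk f ⟨g, hq⟩ = value q (i hq) s := congrFun (congrArg Subtype.val h) ⟨q, hq⟩
  rw [← h1, Localization.mk_eq_mk']
  exact IsLocalization.mk'_spec _ f ⟨g, hq⟩

theorem isUnit_algebraMap_iff (p : PrimeSpectrum R) (r : R) :
    IsUnit (algebraMap R (Localization.AtPrime p.asIdeal) r) ↔
      p ∈ PrimeSpectrum.basicOpen r :=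
  IsLocalization.AtPrime.isUnit_to_map_iff _ p.asIdeal r

/-- Near each point `s * g = f` with `g` invertible, so there `s` is invertible exactly on `D(f)`.
-/
theorem isOpen_isUnit_value (s : SpecSections R U) :
    IsOpen {p : PrimeSpectrum R | ∃ hp : p ∈ U, IsUnit (value p hp s)} := by
  refine isOpen_iff_forall_mem_open.mpr ?_
  rintro p ⟨hp, hu⟩
  obtain ⟨g, f, hpg, i, h⟩ := exists_fraction s p hp
  have key : ∀ (q : PrimeSpectrum R) (hq : q ∈ PrimeSpectrum.basicOpen g),
      IsUnit (value q (i hq) s) ↔ q ∈ PrimeSpectrum.basicOpen f := fun q hq => by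
    rw [← isUnit_algebraMap_iff, ← h q hq,
      IsUnit.mul_iff, and_iff_left ((isUnit_algebraMap_iff q g).mpr hq)]
  exact ⟨(PrimeSpectrum.basicOpen g : Set _) ∩ PrimeSpectrum.basicOpen f,
    fun q hq => ⟨i hq.1, (key q hq.1).mpr hq.2⟩,
    (PrimeSpectrum.basicOpen g).2.inter (PrimeSpectrum.basicOpen f).2, hpg, (key p hpg).mp hu⟩

/-- The pointwise inverses form a section: where `s` is the fraction `f / g`, the element `f` is
invertible as well and the inverse is `g / f`. -/
theorem isUnit_iff {s : SpecSections R U} :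
    IsUnit s ↔ ∀ (p : PrimeSpectrum R) (hp : p ∈ U), IsUnit (value p hp s) := by
  refine ⟨fun h p hp => h.map _, fun h => ?_⟩
  choose v hv using fun p : U => (h p.1 p.2).exists_right_inv
  have hloc : (StructureSheaf.isLocallyFraction R R).pred v := by
    intro p
    obtain ⟨g, f, hpg, i, hs⟩ := exists_fraction s p.1 p.2
    have hf : ∀ (q : PrimeSpectrum R) (hq : q ∈ PrimeSpectrum.basicOpen g),
        q ∈ PrimeSpectrum.basicOpen f :=
      fun q hq => by
        rw [← isUnit_algebraMap_iff, ← hs q hq]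
        exact (h q (i hq)).mul ((isUnit_algebraMap_iff q g).mpr hq)
    refine ⟨PrimeSpectrum.basicOpen g, hpg, homOfLE i, g, f, fun q => ⟨hf q.1 q.2, ?_⟩⟩
    have h1 := hs q.1 q.2
    have h2 := hv ⟨q.1, i q.2⟩
    have h3 : v ⟨q.1, i q.2⟩ = Localization.mk g ⟨f, hf q.1 q.2⟩ := by
      rw [Localization.mk_eq_mk', IsLocalization.eq_mk'_iff_mul_eq]
      change v ⟨q.1, i q.2⟩ * algebraMap R _ f = _
      rw [← h1, ← mul_assoc, mul_comm (v _), h2, one_mul]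
    exact h3
  let t : SpecSections R U := ⟨v, hloc⟩
  exact IsUnit.of_mul_eq_one t (ext_value fun p hp => (map_mul _ _ _).trans (hv ⟨p, hp⟩))

theorem subsingleton (hU : ∀ p, p ∉ U) : Subsingleton (SpecSections R U) :=
  ⟨fun _ _ => ext_value fun p hp => (hU p hp).elim⟩

theorem nontrivial (p : PrimeSpectrum R) (hp : p ∈ U) : Nontrivial (SpecSections R U) :=
  (value p hp).domain_nontrivial

/-- A section over a reduced spectrum that is not invertible anywhere vanishes. -/
theorem eq_zero_of_forall_not_isUnit_value [IsReduced R] {s : SpecSections R U}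
    (hs : ∀ (p : PrimeSpectrum R) (hp : p ∈ U), ¬ IsUnit (value p hp s)) : s = 0 := by
  refine ext_value fun p hp => ?_
  obtain ⟨g, f, hpg, i, h⟩ := exists_fraction s p hp
  have hgf : f * g = 0 := by
    refine (IsNilpotent.eq_zero ?_ : f * g = 0)
    -- At a prime containing neither `f` nor `g` the value of `s` would be a unit, so `f * g` lies
    -- in every prime.
    rw [← mem_nilradical, nilradical_eq_sInf, Submodule.mem_sInf]
    intro q hq
    have : Ideal.IsPrime q := hq
    by_contra hfg
    have hg : (⟨q, hq⟩ : PrimeSpectrum R) ∈ PrimeSpectrum.basicOpen g :=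
      fun hg => hfg (Ideal.mul_mem_left _ _ hg)
    have hf : (⟨q, hq⟩ : PrimeSpectrum R) ∈ PrimeSpectrum.basicOpen f :=
      fun hf => hfg (Ideal.mul_mem_right _ _ hf)
    have h1 := (isUnit_algebraMap_iff (R := R) _ f).mpr hf
    rw [← h _ hg, IsUnit.mul_iff] at h1
    exact hs _ _ h1.1
  have hg := (isUnit_algebraMap_iff p g).mpr hpg
  rw [map_zero, ← hg.mul_left_inj, h p hpg, zero_mul, ← hg.mul_left_inj, ← map_mul, hgf, map_zero,
    zero_mul]

theorem exists_gluing {ι : Type u} (U : ι → Opens (PrimeSpectrum.Top R))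
    (W : Opens (PrimeSpectrum.Top R)) (hU : ∀ i, U i ≤ W) (hW : W ≤ iSup U)
    (s : ∀ i, SpecSections R (U i))
    (hs : ∀ i j, res (inf_le_left : U i ⊓ U j ≤ U i) (s i) =
      res (inf_le_right : U i ⊓ U j ≤ U j) (s j)) :
    ∃ t : SpecSections R W, ∀ i, res (hU i) t = s i := by
  obtain ⟨t, ht, -⟩ := (Spec.structureSheaf R).existsUnique_gluing' U W (fun i => homOfLE (hU i)) hW s hs
  exact ⟨t, ht⟩

theorem discreteTopology (hU : IsCompact (U : Set (PrimeSpectrum.Top R))) :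
    DiscreteTopology (SpecSections R U) := by
  refine ⟨le_bot_iff.mp ?_⟩
  refine (iInf_le _ ⟨U, le_rfl, hU⟩).trans ?_
  intro t _
  exact ⟨res le_rfl '' t, trivial, Set.preimage_image_eq _ fun _ _ h => h⟩

theorem ofRing_top_bijective : Function.Bijective (ofRing (R := R) ⊤) :=
  StructureSheaf.algebraMap_obj_top_bijective

theorem exists_pow_mul_eq_ofRing (g : R) (hU : U = PrimeSpectrum.basicOpen g)
    (s : SpecSections R U) : ∃ (n : ℕ) (a : R), s * ofRing U g ^ n = ofRing U a := by
  have hl : IsLocalization.Away g ((structureSheafInType R R).obj.obj (op U)) := by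
    rw [hU]
    infer_instance
  obtain ⟨⟨a, ⟨_, n, rfl⟩⟩, h⟩ := IsLocalization.surj (M := Submonoid.powers g)
    (S := (structureSheafInType R R).obj.obj (op U)) s
  refine ⟨n, a, ?_⟩
  rw [← map_pow]
  exact h

theorem comap_injective {φ : R →+* S} (hφ : Function.Bijective φ)
    {V : Opens (PrimeSpectrum.Top S)} (h : ∀ p ∈ V, PrimeSpectrum.comap φ p ∈ U)
    (h' : ∀ p, PrimeSpectrum.comap φ p ∈ U → p ∈ V) : Function.Injective (comap φ U V h) := by
  let e := RingEquiv.ofBijective φ hφ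
  have he : (e.symm : S →+* R).comp φ = RingHom.id R := RingHom.ext fun x => e.symm_apply_apply x
  have h2 : ∀ p ∈ U, PrimeSpectrum.comap (e.symm : S →+* R) p ∈ V := by
    intro p hp
    have h3 : ∀ p : PrimeSpectrum R,
        PrimeSpectrum.comap φ (PrimeSpectrum.comap (e.symm : S →+* R) p) = p := fun p => by
      rw [← PrimeSpectrum.comap_comp_apply, he]
      rfl
    exact h' _ (Eq.mpr (congrArg (· ∈ U) (h3 p)) hp)
  -- The composite is only propositionally the identity and occurs in the proof that points land in
  -- `U`; it is generalized before being substituted.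
  have key : ∀ (ψ : R →+* R) (_ : ψ = RingHom.id R) (hh : ∀ p ∈ U, PrimeSpectrum.comap ψ p ∈ U),
      comap ψ U U hh = RingHom.id _ := by
    rintro _ rfl hh
    exact StructureSheaf.comap_id' U
  have h3 : (comap (e.symm : S →+* R) V U h2).comp (comap φ U V h) = RingHom.id _ :=
    (StructureSheaf.comap_comp φ (e.symm : S →+* R) U V U h h2).symm.trans (key _ he _)
  exact Function.LeftInverse.injective (g := comap (e.symm : S →+* R) V U h2)
    fun s => congrArg (fun g : SpecSections R U →+* SpecSections R U => g s) h3

theorem comap_comap {T : Type u} [CommRing T] (φ : R →+* S) (ψ : S →+* T)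
    {V : Opens (PrimeSpectrum.Top S)} {W : Opens (PrimeSpectrum.Top T)}
    (h : ∀ p ∈ V, PrimeSpectrum.comap φ p ∈ U) (h' : ∀ p ∈ W, PrimeSpectrum.comap ψ p ∈ V)
    (χ : R →+* T) (hχ : χ = ψ.comp φ) (h'' : ∀ p ∈ W, PrimeSpectrum.comap χ p ∈ U)
    (s : SpecSections R U) : comap ψ V W h' (comap φ U V h s) = comap χ U W h'' s := by
  subst hχ
  exact (congrArg (fun g : SpecSections R U →+* SpecSections T W => g s)
    (StructureSheaf.comap_comp φ ψ U V W h h')).symm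

theorem continuous_res_of_isCompact (h : V ≤ U) (hV : IsCompact (V : Set (PrimeSpectrum.Top R))) :
    Continuous (res h) := by
  refine continuous_le_rng ?_ (continuous_le_dom (iInf_le _ (⟨V, h, hV⟩ :
    {W : Opens (PrimeSpectrum.Top R) // W ≤ U ∧ IsCompact (W : Set (PrimeSpectrum.Top R))}))
      continuous_induced_dom)
  exact bot_le

end SpecSections

/-! ### Sections over a formal spectrum -/

theorem Ideal.isOpen_of_le {A : Type*} [CommRing A] [TopologicalSpace A] [IsTopologicalRing A]
    {J K : Ideal A} (h : J ≤ K) (hJ : IsOpen (J : Set A)) : IsOpen (K : Set A) :=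
  AddSubgroup.isOpen_mono (H₁ := Submodule.toAddSubgroup J) (H₂ := Submodule.toAddSubgroup K) h hJ

/-- A map that is constant on the cosets of an open ideal is continuous. -/
theorem continuous_of_isOpen_of_sub_mem {A : Type*} [CommRing A] [TopologicalSpace A]
    [IsTopologicalRing A] {T : Type*} [TopologicalSpace T] {J : Ideal A}
    (hJ : IsOpen (J : Set A)) {f : A → T} (hf : ∀ a b, a - b ∈ J → f a = f b) : Continuous f := by
  refine ⟨fun t _ => isOpen_iff_forall_mem_open.mpr fun a ha => ?_⟩
  refine ⟨(fun b => b - a) ⁻¹' (J : Set A), fun b hb => ?_, hJ.preimage (by fun_prop), ?_⟩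
  · change f b ∈ t
    rw [hf b a hb]
    exact ha
  · simp

/-- Open prime ideals contain all topologically nilpotent elements. -/
theorem SpfPoint.mem_of_isTopologicallyNilpotent {A : Type u} [CommRing A] [TopologicalSpace A]
    (p : SpfPoint A) {a : A} (ha : IsTopologicallyNilpotent a) : a ∈ p.1.asIdeal := by
  obtain ⟨n, hn⟩ := (ha.eventually (p.2.mem_nhds p.1.asIdeal.zero_mem)).exists
  exact p.1.isPrime.mem_of_pow_mem n hn

theorem IsIdealOfDefinition.le {A : Type u} [CommRing A] [TopologicalSpace A] {J : Ideal A}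
    (hJ : IsIdealOfDefinition J) (p : SpfPoint A) : J ≤ p.1.asIdeal :=
  fun a ha => p.mem_of_isTopologicallyNilpotent (hJ.isTopologicallyNilpotent a ha)

namespace Spf

variable {A : Type u} [CommRing A] [TopologicalSpace A] [IsTopologicalRing A]
  {U V : Opens (top A)}

theorem sections_ext {s t : sections U} (h : ∀ J : OpenIdeal A, s.1 J = t.1 J) : s = t :=
  Subtype.ext (funext h)

theorem component_eq_zero {s : sections U} {J K : OpenIdeal A} (h : J.1 ≤ K.1)
    (hs : s.1 J = 0) : s.1 K = 0 := by
  rw [← s.2 J K h, hs, map_zero]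

theorem component_eq {s t : sections U} {J K : OpenIdeal A} (h : J.1 ≤ K.1)
    (hs : s.1 J = t.1 J) : s.1 K = t.1 K := by
  rw [← s.2 J K h, hs, t.2 J K h]

/-- The intersection of two open ideals. -/
def _root_.OpenIdeal.inf (J K : OpenIdeal A) : OpenIdeal A :=
  ⟨J.1 ⊓ K.1, J.2.inter K.2⟩

/-- Every neighbourhood of zero contains all sections with a vanishing component. -/
theorem exists_openIdeal_of_mem_nhds {N : Set (sections U)} (hN : N ∈ nhds 0) :
    ∃ J : OpenIdeal A, ∀ s : sections U, s.1 J = 0 → s ∈ N := by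
  obtain ⟨N', hN', hNN'⟩ := mem_nhds_subtype _ _ _ |>.mp hN
  rw [nhds_pi, Filter.mem_pi] at hN'
  obtain ⟨F, hF, t, ht, htN⟩ := hN'
  -- A basic neighbourhood in the product constrains finitely many components, and vanishing at the
  -- intersection of those open ideals forces all of them to vanish.
  refine ⟨⟨⨅ J ∈ F, J.1, ?_⟩, fun s hs => hNN' (htN fun J hJ => ?_)⟩
  · have : ((⨅ J ∈ F, J.1 : Ideal A) : Set A) = ⋂ J ∈ F, (J.1 : Set A) := by simp
    rw [this]
    exact hF.isOpen_biInter fun J _ => J.2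
  · have : s.1 J = 0 := component_eq_zero (iInf₂_le J hJ) hs
    rw [this]
    exact mem_of_mem_nhds (ht J)

/-- Quasi-compactness makes the component ring discrete. Together with
`exists_openIdeal_of_mem_nhds` this describes the neighbourhoods of zero by vanishing of components.
-/
theorem isOpen_component_eq_zero (J : OpenIdeal A)
    (hU : IsCompact (openOf U J : Set (PrimeSpectrum.Top (A ⧸ J.1)))) :
    IsOpen {s : sections U | s.1 J = 0} := by
  have := SpecSections.discreteTopology hU
  have hc : Continuous fun s : sections U => s.1 J := (continuous_apply J).comp continuous_subtype_val
  exact (isOpen_discrete {(0 : SpecSections (A ⧸ J.1) (openOf U J))}).preimage hc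

/-- The section given by an element of the ring. -/
def ofRing (U : Opens (top A)) : A →+* sections U where
  toFun a := ⟨fun J => SpecSections.ofRing _ (Ideal.Quotient.mk J.1 a), fun _ _ h =>
    SpecSections.comap_ofRing _ _ _⟩
  map_one' := sections_ext fun J => by
    change SpecSections.ofRing _ (Ideal.Quotient.mk J.1 1) = 1
    rw [map_one, map_one]
  map_zero' := sections_ext fun J => by
    change SpecSections.ofRing _ (Ideal.Quotient.mk J.1 0) = 0
    rw [map_zero, map_zero]
  map_mul' a b := sections_ext fun J => by
    change SpecSections.ofRing _ (Ideal.Quotient.mk J.1 (a * b)) =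
      SpecSections.ofRing _ (Ideal.Quotient.mk J.1 a) * SpecSections.ofRing _ (Ideal.Quotient.mk J.1 b)
    rw [map_mul, map_mul]
  map_add' a b := sections_ext fun J => by
    change SpecSections.ofRing _ (Ideal.Quotient.mk J.1 (a + b)) =
      SpecSections.ofRing _ (Ideal.Quotient.mk J.1 a) + SpecSections.ofRing _ (Ideal.Quotient.mk J.1 b)
    rw [map_add, map_add]

theorem continuous_ofRing : Continuous (ofRing U : A → sections U) := by
  refine Continuous.subtype_mk (continuous_pi fun J => ?_) _
  refine continuous_of_isOpen_of_sub_mem J.2 fun a b hab => ?_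
  rw [Ideal.Quotient.eq.mpr hab]

/-- If the intersection of `U` with `Spec (A / J)` is everything, then components at `J` come
from elements of the ring. -/
theorem exists_ofRing_component_eq {J : OpenIdeal A} (hJ : openOf U J = ⊤) (s : sections U) :
    ∃ a : A, s.1 J = (ofRing U a).1 J := by
  have key : ∀ (W : Opens (PrimeSpectrum.Top (A ⧸ J.1))), W = ⊤ → ∀ s : SpecSections (A ⧸ J.1) W,
      ∃ a, s = SpecSections.ofRing W a := by
    rintro _ rfl s
    obtain ⟨a, ha⟩ := SpecSections.ofRing_top_bijective.2 s
    exact ⟨a, ha.symm⟩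
  obtain ⟨a, ha⟩ := key _ hJ (s.1 J)
  obtain ⟨a, rfl⟩ := Ideal.Quotient.mk_surjective a
  exact ⟨a, ha⟩

theorem ofRing_component_eq_zero_iff {J : OpenIdeal A} (hJ : openOf U J = ⊤) (a : A) :
    (ofRing U a).1 J = 0 ↔ a ∈ J.1 := by
  have key : ∀ (W : Opens (PrimeSpectrum.Top (A ⧸ J.1))), W = ⊤ → ∀ a : A ⧸ J.1,
      SpecSections.ofRing W a = 0 ↔ a = 0 := by
    rintro _ rfl a
    exact map_eq_zero_iff _ SpecSections.ofRing_top_bijective.1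
  exact (key _ hJ _).trans Ideal.Quotient.eq_zero_iff_mem

/-! ### Points of the formal spectrum -/

theorem ofSpec_injective (J : OpenIdeal A) : Function.Injective (ofSpec J) := fun _ _ h =>
  PrimeSpectrum.comap_injective_of_surjective _ Ideal.Quotient.mk_surjective
    (congrArg Subtype.val h)

theorem isEmbedding_ofSpec (J : OpenIdeal A) : Topology.IsEmbedding (ofSpec J) := by
  refine Topology.IsEmbedding.of_comp (continuous_ofSpec J) continuous_subtype_val ?_
  exact (PrimeSpectrum.isClosedEmbedding_comap_of_surjective _ _
    Ideal.Quotient.mk_surjective).isEmbedding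

theorem le_ofSpec (J : OpenIdeal A) (q : PrimeSpectrum (A ⧸ J.1)) :
    J.1 ≤ (ofSpec J q).1.asIdeal := by
  intro a ha
  change Ideal.Quotient.mk J.1 a ∈ q.asIdeal
  rw [Ideal.Quotient.eq_zero_iff_mem.mpr ha]
  exact q.asIdeal.zero_mem

theorem exists_ofSpec_eq {J : OpenIdeal A} {p : SpfPoint A} (h : J.1 ≤ p.1.asIdeal) :
    ∃ q, ofSpec J q = p := by
  have h1 : p.1 ∈ Set.range (PrimeSpectrum.comap (Ideal.Quotient.mk J.1)) := by
    rw [range_comap_of_surjective _ _ Ideal.Quotient.mk_surjective,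
      Ideal.mk_ker]
    exact h
  obtain ⟨q, hq⟩ := h1
  exact ⟨q, Subtype.ext hq⟩

/-- A section is invertible at a point if its value in the residue field is nonzero. -/
def IsUnitAt (s : sections U) (p : SpfPoint A) (hp : p ∈ U) : Prop :=
  ∃ (J : OpenIdeal A) (q : PrimeSpectrum (A ⧸ J.1)) (hq : ofSpec J q = p),
    IsUnit (SpecSections.value (U := openOf U J) q (by subst hq; exact hp) (s.1 J))

/-- Two open ideals `J`, `K` are compared over `A / (J ∩ K)`: both points come from the same point
of its spectrum, and the transition maps preserve and reflect invertibility there. -/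
theorem isUnitAt_iff (s : sections U) {J : OpenIdeal A} (q : PrimeSpectrum (A ⧸ J.1))
    (hq : ofSpec J q ∈ U) :
    IsUnitAt s (ofSpec J q) hq ↔
      IsUnit (SpecSections.value (U := openOf U J) q hq (s.1 J)) := by
  refine ⟨?_, fun h => ⟨J, q, rfl, h⟩⟩
  rintro ⟨K, r, hr, h⟩
  have h₁ : (J.inf K).1 ≤ J.1 := inf_le_left
  have h₂ : (J.inf K).1 ≤ K.1 := inf_le_right
  have heq : PrimeSpectrum.comap (Ideal.Quotient.factor h₁) q =
      PrimeSpectrum.comap (Ideal.Quotient.factor h₂) r := ofSpec_injective _ hr.symm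
  rw [← s.2 _ _ h₂, SpecSections.isUnit_value_comap] at h
  rw [← s.2 _ _ h₁]
  refine (SpecSections.isUnit_value_comap _ (openOf_comap U h₁) q hq _).mpr ?_
  have key : ∀ (x y : PrimeSpectrum (A ⧸ (J.inf K).1)) (_ : x = y) (hx : x ∈ openOf U (J.inf K))
      (hy : y ∈ openOf U (J.inf K)) (t : SpecSections (A ⧸ (J.inf K).1) (openOf U (J.inf K))),
      IsUnit (SpecSections.value y hy t) → IsUnit (SpecSections.value x hx t) := by
    rintro x _ rfl hx hy t h
    exact h
  exact key _ _ heq _ _ _ h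

theorem isUnitAt_res (h : V ≤ U) (s : sections U) (p : SpfPoint A) (hp : p ∈ V) :
    IsUnitAt (res h s) p hp ↔ IsUnitAt s p (h hp) := Iff.rfl

/-- Componentwise inverses exist by the case of `Spec (A / J)`, and they are compatible because
inverses are unique. -/
theorem isUnit_iff {s : sections U} : IsUnit s ↔ ∀ p hp, IsUnitAt s p hp := by
  constructor
  · intro h p hp
    -- An open prime is itself an open ideal, and it gives a point of the corresponding spectrum.
    -- `clear_value` removes the dependence of `J` on `p`, so that `p` can be substituted.
    let J : OpenIdeal A := ⟨p.1.asIdeal, p.2⟩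
    obtain ⟨q, hq⟩ := exists_ofSpec_eq (J := J) (p := p) le_rfl
    clear_value J
    subst hq
    refine (isUnitAt_iff s q hp).mpr ?_
    exact ((h.map (sections U).subtype).map (Pi.evalRingHom _ J)).map _
  · intro h
    have h1 : ∀ J, IsUnit (s.1 J) := fun J =>
      SpecSections.isUnit_iff.mpr fun q hq => (isUnitAt_iff s q hq).mp (h _ _)
    choose t ht using fun J => (h1 J).exists_right_inv
    refine IsUnit.of_mul_eq_one ⟨t, fun J K hJK => ?_⟩ (sections_ext ht)
    refine (h1 K).mul_left_cancel ?_
    rw [ht K, ← s.2 J K hJK, ← map_mul, ht J, map_one]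

theorem isUnitAt_one_sub {s : sections U} {p : SpfPoint A} {hp : p ∈ U} (h : ¬ IsUnitAt s p hp) :
    IsUnitAt (1 - s) p hp := by
  let J : OpenIdeal A := ⟨p.1.asIdeal, p.2⟩
  obtain ⟨q, hq⟩ := exists_ofSpec_eq (J := J) (p := p) le_rfl
  clear_value J
  subst hq
  rw [isUnitAt_iff] at h ⊢
  have := (IsLocalRing.isUnit_or_isUnit_one_sub_self
    (SpecSections.value (U := openOf U J) q hp (s.1 J))).resolve_left h
  rwa [← map_one (SpecSections.value (U := openOf U J) q hp), ← map_sub] at this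

theorem nontrivial_sections (p : SpfPoint A) (hp : p ∈ U) : Nontrivial (sections U) := by
  let J : OpenIdeal A := ⟨p.1.asIdeal, p.2⟩
  obtain ⟨q, hq⟩ := exists_ofSpec_eq (J := J) (p := p) le_rfl
  clear_value J
  subst hq
  have := SpecSections.nontrivial (U := openOf U J) q hp
  exact ((Pi.evalRingHom (fun J : OpenIdeal A => SpecSections (A ⧸ J.1) (openOf U J)) J).comp
    (sections U).subtype).domain_nontrivial

/-- For an ideal of definition `J` the map `Spec (A / J) → Spf A` is a homeomorphism. -/
theorem isHomeomorph_ofSpec {J : Ideal A} (hJ : IsIdealOfDefinition J) :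
    IsHomeomorph (ofSpec ⟨J, hJ.isOpen⟩) := by
  rw [isHomeomorph_iff_isEmbedding_surjective]
  exact ⟨isEmbedding_ofSpec _, fun p => exists_ofSpec_eq (hJ.le p)⟩

/-- For an ideal of definition `J` the space is that of `Spec (A / J)`, so openness can be checked
on a single ordinary scheme. -/
theorem isOpen_isUnitAt (hA : IsAdmissibleRing A) (s : sections U) :
    IsOpen {p : SpfPoint A | ∃ hp : p ∈ U, IsUnitAt s p hp} := by
  obtain ⟨J, hJ⟩ := hA.exists_idealOfDefinition
  rw [← (isHomeomorph_ofSpec hJ).isQuotientMap.isOpen_preimage]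
  convert SpecSections.isOpen_isUnit_value (s.1 ⟨J, hJ.isOpen⟩) using 1
  ext q
  exact ⟨fun ⟨h, h'⟩ => ⟨h, (isUnitAt_iff s q h).mp h'⟩,
    fun ⟨h, h'⟩ => ⟨h, (isUnitAt_iff s q h).mpr h'⟩⟩

theorem exists_isUnit_res (hA : IsAdmissibleRing A) (s : sections U) {p : SpfPoint A} (hp : p ∈ U)
    (h : IsUnitAt s p hp) : ∃ (V : Opens (top A)) (hV : V ≤ U), p ∈ V ∧ IsUnit (res hV s) :=
  ⟨⟨_, isOpen_isUnitAt hA s⟩, fun _ h => h.1, ⟨hp, h⟩, isUnit_iff.mpr fun _ h => h.2⟩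

end Spf

/-! ### The formal spectrum as a formal scheme -/

/-- A quasi-compact subset of a prime spectrum covered by open sets is covered by finitely many
basic open sets each contained in a member of the cover. -/
theorem PrimeSpectrum.exists_finset_basicOpen_cover {R : Type*} [CommRing R] {ι : Type*}
    (U : ι → Opens (PrimeSpectrum R)) {K : Set (PrimeSpectrum R)} (hK : IsCompact K)
    (h : ∀ x ∈ K, ∃ i, x ∈ U i) :
    ∃ t : Finset R, (∀ g ∈ t, ∃ i, PrimeSpectrum.basicOpen g ≤ U i) ∧
      ∀ x ∈ K, ∃ g ∈ t, x ∈ PrimeSpectrum.basicOpen g := by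
  classical
  have h1 : ∀ x : K, ∃ (g : R) (i : ι), x.1 ∈ PrimeSpectrum.basicOpen g ∧
      PrimeSpectrum.basicOpen g ≤ U i := by
    intro x
    obtain ⟨i, hi⟩ := h x.1 x.2
    obtain ⟨_, ⟨g, rfl⟩, hx, hg⟩ :=
      (Opens.isBasis_iff_nbhd.mp PrimeSpectrum.isBasis_basic_opens) hi
    exact ⟨g, i, hx, hg⟩
  choose g i hg hi using h1
  obtain ⟨t, ht⟩ := hK.elim_nhds_subcover' (fun x hx => (PrimeSpectrum.basicOpen (g ⟨x, hx⟩) : Set _))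
    fun x hx => (PrimeSpectrum.basicOpen _).2.mem_nhds (hg ⟨x, hx⟩)
  refine ⟨t.image g, fun r hr => ?_, fun x hx => ?_⟩
  · obtain ⟨x, -, rfl⟩ := Finset.mem_image.mp hr
    exact ⟨i x, hi x⟩
  · obtain ⟨y, hy, hxy⟩ := Set.mem_iUnion₂.mp (ht hx)
    exact ⟨g y, Finset.mem_image_of_mem g hy, hxy⟩

namespace SpecSections

variable {R S : Type u} [CommRing R] [CommRing S] {U : Opens (PrimeSpectrum.Top R)}
  {V : Opens (PrimeSpectrum.Top S)}

/-- The image of a quasi-compact `W` lies in a finite union `W'` of basic open sets inside `U`, so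
pullback followed by restriction to `W` factors through the discrete ring of sections over `W'`. -/
theorem continuous_comap (φ : R →+* S) (h : ∀ p ∈ V, PrimeSpectrum.comap φ p ∈ U) :
    Continuous (comap φ U V h) := by
  refine continuous_iInf_rng.mpr fun W => continuous_induced_rng.mpr ?_
  obtain ⟨t, ht, ht'⟩ := PrimeSpectrum.exists_finset_basicOpen_cover (fun _ : Unit => U)
    (W.2.2.image (PrimeSpectrum.continuous_comap φ)) (by
      rintro _ ⟨q, hq, rfl⟩
      exact ⟨(), h q (W.2.1 hq)⟩)
  let W' : Opens (PrimeSpectrum.Top R) :=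
    ⟨⋃ g ∈ t, (PrimeSpectrum.basicOpen g : Set (PrimeSpectrum R)),
      isOpen_biUnion fun g _ => (PrimeSpectrum.basicOpen g).2⟩
  have hW'U : W' ≤ U := fun p hp => by
    obtain ⟨g, hg, hp⟩ := Set.mem_iUnion₂.mp hp
    obtain ⟨_, hi⟩ := ht g hg
    exact hi hp
  have hW' : IsCompact (W' : Set (PrimeSpectrum.Top R)) :=
    t.isCompact_biUnion fun g _ => PrimeSpectrum.isCompact_basicOpen g
  have hWW' : ∀ p ∈ W.1, PrimeSpectrum.comap φ p ∈ W' := fun p hp => by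
    obtain ⟨g, hg, h⟩ := ht' _ ⟨p, hp, rfl⟩
    exact Set.mem_iUnion₂.mpr ⟨g, hg, h⟩
  have heq : (res W.2.1 ∘ comap φ U V h : SpecSections R U → SpecSections S W.1) =
      comap φ W' W.1 hWW' ∘ res hW'U := rfl
  rw [heq]
  have := discreteTopology hW'
  exact @Continuous.mk _ _ _ ⊥ _ fun S _ =>
    (continuous_res_of_isCompact hW'U hW').isOpen_preimage (comap φ W' W.1 hWW' ⁻¹' S)
      (isOpen_discrete _)

end SpecSections

namespace Spf

variable {A : Type u} [CommRing A] [TopologicalSpace A] [IsTopologicalRing A]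

theorem exists_mem_openOf_of_mem_iSup {ι : Type*} (U : ι → Opens (top A)) {J : OpenIdeal A}
    {p : PrimeSpectrum (A ⧸ J.1)} (hp : p ∈ openOf (iSup U) J) : ∃ i, p ∈ openOf (U i) J := by
  have h : ofSpec J p ∈ iSup U := hp
  rwa [Opens.mem_iSup] at h

/-- The topology on the sections over a union is induced from the members of the cover. -/
theorem iInf_induced_res_le {ι : Type*} (U : ι → Opens (top A)) :
    (⨅ i, TopologicalSpace.induced (res (le_iSup U i)) inferInstance) ≤
      (inferInstance : TopologicalSpace (sections (iSup U))) := by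
  have hU : ∀ i, U i ≤ iSup U := le_iSup U
  let τ : TopologicalSpace (sections (iSup U)) :=
    ⨅ i, TopologicalSpace.induced (res (hU i)) inferInstance
  change τ ≤ TopologicalSpace.induced Subtype.val
    (⨅ J : OpenIdeal A, TopologicalSpace.induced (fun s => s J) (⨅ W, TopologicalSpace.induced _ ⊥))
  simp only [induced_iInf, induced_compose]
  refine le_iInf fun J => le_iInf fun W => ?_
  rintro _ ⟨S, -, rfl⟩
  -- A restriction to the quasi-compact `W` is determined by restrictions to finitely many basic
  -- open sets, each inside one member of the cover. Fixing these is a finite intersection of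
  -- conditions open for `τ`.
  obtain ⟨t, ht, ht'⟩ := PrimeSpectrum.exists_finset_basicOpen_cover
    (fun i => (openOf (U i) J : Opens (PrimeSpectrum (A ⧸ J.1)))) W.2.2
    (fun p hp => exists_mem_openOf_of_mem_iSup U (W.2.1 hp))
  have hD : ∀ g ∈ t, (PrimeSpectrum.basicOpen g : Opens (PrimeSpectrum.Top (A ⧸ J.1))) ≤
      openOf (iSup U) J := fun g hg => by
    obtain ⟨i, hi⟩ := ht g hg
    exact fun p hp => openOf_mono (hU i) J (hi hp)
  have hopen : ∀ (g) (hg : g ∈ t) (s₀ : sections (iSup U)),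
      @IsOpen _ τ {s : sections (iSup U) | SpecSections.res (hD g hg) (s.1 J) =
        SpecSections.res (hD g hg) (s₀.1 J)} := by
    intro g hg s₀
    obtain ⟨i, hi⟩ := ht g hg
    let D : Opens (PrimeSpectrum.Top (A ⧸ J.1)) := PrimeSpectrum.basicOpen g
    have hc : IsCompact (D : Set (PrimeSpectrum.Top (A ⧸ J.1))) :=
      PrimeSpectrum.isCompact_basicOpen g
    have hdisc := SpecSections.discreteTopology hc
    have h1 : @Continuous _ _ τ _ (res (hU i)) := continuous_iInf_dom continuous_induced_dom
    have h2 : Continuous fun s : sections (U i) => s.1 J :=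
      (continuous_apply J).comp continuous_subtype_val
    have h3 := SpecSections.continuous_res_of_isCompact (U := openOf (U i) J) (V := D) hi hc
    exact (@Continuous.comp _ _ _ τ _ _ _ _ (h3.comp h2) h1).isOpen_preimage
      {SpecSections.res (hD g hg) (s₀.1 J)} (isOpen_discrete _)
  refine (@isOpen_iff_forall_mem_open _ τ _).mpr fun s₀ hs₀ => ?_
  refine ⟨⋂ g : t, {s : sections (iSup U) | SpecSections.res (hD g.1 g.2) (s.1 J) =
        SpecSections.res (hD g.1 g.2) (s₀.1 J)}, fun s hs => ?_,
    @isOpen_iInter_of_finite _ _ τ _ _ fun g => hopen g.1 g.2 s₀, Set.mem_iInter.mpr fun g => rfl⟩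
  have heq : SpecSections.res W.2.1 (s.1 J) = SpecSections.res W.2.1 (s₀.1 J) := by
    refine SpecSections.ext_value fun p hp => ?_
    obtain ⟨g, hg, hpg⟩ := ht' p hp
    exact congrArg (SpecSections.value (R := A ⧸ J.1) (U := PrimeSpectrum.basicOpen g) p hpg)
      (Set.mem_iInter.mp hs ⟨g, hg⟩)
  change SpecSections.res W.2.1 (s.1 J) ∈ S
  rw [heq]
  exact hs₀

/-- Sections are glued separately on each `Spec (A / J)`. Compatibility of the glued components is
checked on values at points, where each is given by a member of the cover. -/
theorem isSheaf (A : TopCommRingCat.{u}) : (Spf A).presheaf.IsSheaf := by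
  refine TopCommRingCat.isSheaf_of_existsUnique_gluing _ (fun ι U s hs => ?_) fun ι U => ?_
  · replace hs : ∀ i j, res (inf_le_left : U i ⊓ U j ≤ U i) (s i) =
      res (inf_le_right : U i ⊓ U j ≤ U j) (s j) := hs
    have hU : ∀ i, U i ≤ iSup U := le_iSup U
    have hcov : ∀ (J : OpenIdeal A) (p) (_ : p ∈ openOf (iSup U) J), ∃ i, p ∈ openOf (U i) J :=
      fun J p hp => exists_mem_openOf_of_mem_iSup U hp
    let s' : ∀ i, sections (U i) := s
    have hglue : ∀ J : OpenIdeal A, ∃ t : SpecSections (A ⧸ J.1) (openOf (iSup U) J),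
        ∀ i, SpecSections.res (openOf_mono (hU i) J) t = (s' i).1 J := fun J =>
      SpecSections.exists_gluing (fun i => openOf (U i) J) _ (fun i => openOf_mono (hU i) J)
        (fun p hp => Opens.mem_iSup.mpr (hcov J p hp)) (fun i => (s' i).1 J)
        (fun i j => congrFun (congrArg Subtype.val (hs i j)) J)
    choose t ht using hglue
    have hval : ∀ (J : OpenIdeal A) (i) (p) (hp : p ∈ openOf (U i) J),
        SpecSections.value p (openOf_mono (hU i) J hp) (t J) =
          SpecSections.value p hp ((s' i).1 J) := by
      intro J i p hp
      rw [← ht J i]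
      rfl
    let T : sections (iSup U) := ⟨t, fun J K h => by
      refine SpecSections.ext_value fun p hp => ?_
      obtain ⟨i, hi⟩ := hcov K p hp
      refine Eq.trans ?_ (hval K i p hi).symm
      rw [← (s' i).2 J K h]
      refine (SpecSections.value_comap _ _ _ hp _).trans
        (Eq.trans ?_ (SpecSections.value_comap _ _ _ hi _).symm)
      exact congrArg _ (hval J i _ hi)⟩
    refine ⟨T, fun i => sections_ext fun J => ht J i, fun T' hT' => sections_ext fun J => ?_⟩
    replace hT' : ∀ i, res (hU i) T' = s' i := hT'
    refine SpecSections.ext_value fun p hp => ?_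
    obtain ⟨i, hi⟩ := hcov J p hp
    refine Eq.trans ?_ (hval J i p hi).symm
    rw [← hT' i]
    rfl
  · exact iInf_induced_res_le U

/-- The formal spectrum of an admissible ring as a formal scheme. -/
def formalScheme (A : TopCommRingCat.{u}) (hA : IsAdmissibleRing A) : FormalScheme.{u} where
  toPresheafedSpace := Spf A
  isSheaf := isSheaf A
  exists_chart x := ⟨⟨A, hA, 𝟙 _, inferInstance⟩, x, rfl⟩

/-! ### Morphisms of formal spectra -/

/-- The map of formal spectra given by a continuous ring homomorphism. -/
def mapPoint {A B : Type u} [CommRing A] [TopologicalSpace A] [CommRing B] [TopologicalSpace B]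
    {φ : A →+* B} (hφ : Continuous φ) (q : SpfPoint B) : SpfPoint A :=
  ⟨PrimeSpectrum.comap φ q.1, q.2.preimage hφ⟩

theorem continuous_mapPoint {A B : Type u} [CommRing A] [TopologicalSpace A] [CommRing B]
    [TopologicalSpace B] {φ : A →+* B} (hφ : Continuous φ) : Continuous (mapPoint hφ) :=
  Continuous.subtype_mk ((PrimeSpectrum.continuous_comap φ).comp continuous_subtype_val) _

section Map

variable {B : Type u} [CommRing B] [TopologicalSpace B] [IsTopologicalRing B] {φ : A →+* B} (hφ : Continuous φ)

/-- The inverse image of an open ideal. -/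
def comapIdeal (K : OpenIdeal B) : OpenIdeal A := ⟨K.1.comap φ, K.2.preimage hφ⟩

/-- The inverse image of an open set. -/
def mapOpen (U : Opens (top A)) : Opens (top B) :=
  ⟨mapPoint hφ ⁻¹' U, U.2.preimage (continuous_mapPoint hφ)⟩

/-- The homomorphism of quotients. -/
abbrev quotientMap (K : OpenIdeal B) : A ⧸ (comapIdeal hφ K).1 →+* B ⧸ K.1 :=
  Ideal.quotientMap K.1 φ le_rfl

theorem openOf_quotientMap (U : Opens (top A)) (K : OpenIdeal B) :
    ∀ p ∈ openOf (mapOpen hφ U) K,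
      PrimeSpectrum.comap (quotientMap hφ K) p ∈ openOf U (comapIdeal hφ K) :=
  fun _ hp => hp

/-- Pullback of sections. -/
def pullback (U : Opens (top A)) : sections U →+* sections (mapOpen hφ U) where
  toFun s := ⟨fun K => SpecSections.comap (quotientMap hφ K) _ _ (openOf_quotientMap hφ U K)
      (s.1 (comapIdeal hφ K)), fun K L h => by
    have hcomp : (comapIdeal hφ K).1 ≤ (comapIdeal hφ L).1 := Ideal.comap_mono h
    dsimp only
    -- Both sides become the pullback along the same homomorphism from `A / φ⁻¹(K)` to `B / L`.
    rw [← s.2 _ _ hcomp,SpecSections.comap_comap _ _ _ _ _ rfl (fun p hp => hp),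
      SpecSections.comap_comap _ _ _ _ ((Ideal.Quotient.factor h).comp (quotientMap hφ K)) ?_
        (fun p hp => hp)]
    exact Ideal.Quotient.ringHom_ext rfl⟩
  map_one' := sections_ext fun K => map_one _
  map_zero' := sections_ext fun K => map_zero _
  map_mul' s t := sections_ext fun K => map_mul _ _ _
  map_add' s t := sections_ext fun K => map_add _ _ _

theorem pullback_component (U : Opens (top A)) (s : sections U) (K : OpenIdeal B) :
    (pullback hφ U s).1 K = SpecSections.comap (quotientMap hφ K) _ _ (openOf_quotientMap hφ U K)
      (s.1 (comapIdeal hφ K)) := rfl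

theorem continuous_pullback (U : Opens (top A)) : Continuous (pullback hφ U) := by
  refine Continuous.subtype_mk (continuous_pi fun K => ?_) _
  exact (SpecSections.continuous_comap _ _).comp
    ((continuous_apply (comapIdeal hφ K)).comp continuous_subtype_val)

theorem pullback_ofRing (U : Opens (top A)) (a : A) :
    pullback hφ U (ofRing U a) = ofRing (mapOpen hφ U) (φ a) :=
  sections_ext fun _ => SpecSections.comap_ofRing _ _ _

theorem isUnitAt_pullback {U : Opens (top A)} (s : sections U) (q : SpfPoint B)
    (hq : q ∈ mapOpen hφ U) (h : IsUnitAt (pullback hφ U s) q hq) :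
    IsUnitAt s (mapPoint hφ q) hq := by
  obtain ⟨K, r, rfl, hr⟩ := h
  rw [pullback_component, SpecSections.isUnit_value_comap] at hr
  exact ⟨comapIdeal hφ K, PrimeSpectrum.comap (quotientMap hφ K) r, rfl, hr⟩

end Map

/-- The morphism of formal spectra given by a continuous ring homomorphism. -/
def map {A B : TopCommRingCat.{u}} (φ : A ⟶ B) : Spf B ⟶ Spf A where
  base := TopCat.ofHom ⟨mapPoint φ.2, continuous_mapPoint φ.2⟩
  c :=
    { app U := ⟨pullback φ.2 U.unop, continuous_pullback φ.2 U.unop⟩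
      naturality _ _ _ := rfl }

/-- The morphism of formal schemes given by a continuous homomorphism of admissible rings. -/
def mapHom {A B : TopCommRingCat.{u}} (hA : IsAdmissibleRing A) (hB : IsAdmissibleRing B)
    (φ : A ⟶ B) : formalScheme B hB ⟶ formalScheme A hA where
  hom := map φ
  isLocalHom q := by
    refine FormalScheme.isLocalHom_stalkMap (map φ) q fun U s V hV hq hu => ?_
    have h1 : IsUnitAt (pullback φ.2 U s) q (hV hq) :=
      (isUnitAt_res hV (pullback φ.2 U s) q hq).mp (isUnit_iff.mp hu q hq)
    exact exists_isUnit_res hA s _ (isUnitAt_pullback φ.2 s q _ h1)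

end Spf

/-! ### Affine charts as morphisms of formal schemes -/

namespace FormalScheme

theorem _root_.AlgebraicGeometry.PresheafedSpace.IsOpenImmersion.isIso_c_app
    {C : Type*} [Category C] {X Y : PresheafedSpace C}
    (f : Y ⟶ X) (hf : PresheafedSpace.IsOpenImmersion f) (U : Opens X)
    (hU : (U : Set X) ⊆ Set.range f.base) : IsIso (f.c.app (op U)) :=
  PresheafedSpace.IsOpenImmersion.c_iso' f ((Opens.map f.base).obj U)
    (Opens.ext (Set.image_preimage_eq_of_subset hU).symm)

/-- The homeomorphic ring isomorphism given by an isomorphism of topological rings. -/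
theorem _root_.TopCommRingCat.isHomeomorph_of_isIso {R S : TopCommRingCat.{u}} (f : R ⟶ S)
    [IsIso f] : IsHomeomorph f.1 := by
  refine isHomeomorph_iff_exists_inverse.mpr ⟨f.2, (inv f).1, fun x => ?_, fun x => ?_, (inv f).2⟩
  · exact congrArg (fun g : R ⟶ R => g.1 x) (IsIso.hom_inv_id f)
  · exact congrArg (fun g : S ⟶ S => g.1 x) (IsIso.inv_hom_id f)

/-- An affine chart as a morphism of formal schemes. -/
def chartHom {X : FormalScheme.{u}} (c : AffineChart X.toPresheafedSpace) :
    Spf.formalScheme c.ring c.isAdmissible ⟶ X where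
  hom := c.map
  isLocalHom q := by
    refine isLocalHom_stalkMap c.map q fun U s V hV hq hu => ?_
    have hop := c.isOpenImmersion.base_open
    -- Over the open image `W` of `V` the map on sections is an isomorphism, so invertibility over
    -- `V` descends to `W`.
    let W : Opens X.carrier := hop.functor.obj V
    have hWU : W ≤ U := by
      rintro _ ⟨v, hv, rfl⟩
      exact hV hv
    have hWV : (Opens.map c.map.base).obj W = V :=
      Opens.ext (Set.preimage_image_eq _ hop.injective)
    refine ⟨W, hWU, ⟨q, hq, rfl⟩, ?_⟩
    have := c.isOpenImmersion.c_iso V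
    have hb := (TopCommRingCat.isHomeomorph_of_isIso (c.map.c.app (op W))).bijective
    have hu' : IsUnit ((c.map.c.app (op W)).1 (X.res hWU s)) := by
      have h1 := c.map.c.naturality (homOfLE hWU).op
      have h2 := congrArg (fun g : X.sections U ⟶ (Spf c.ring).presheaf.obj (op _) => g.1 s) h1
      refine (congrArg IsUnit h2).mpr ?_
      exact hu.map ((Spf c.ring).presheaf.map (homOfLE hWV.le).op).1
    exact (MulEquiv.isUnit_map (RingEquiv.ofBijective (c.map.c.app (op W)).1 hb)).mp hu'

end FormalScheme

/-! ### Properties of immersions -/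

namespace FormalScheme

variable {X Y Z : FormalScheme.{u}}

theorem IsImmersion.isEmbedding {f : Y ⟶ X} (hf : IsImmersion f) :
    Topology.IsEmbedding f.hom.base := by
  obtain ⟨W, i, j, ⟨𝓘, -, hi⟩, hj, rfl⟩ := hf
  exact hj.base_open.isEmbedding.comp hi.isEmbedding

/-- Near every point of its source an immersion induces open quotient maps of rings of
sections. -/
theorem IsImmersion.exists_isOpenQuotientMap {f : Y ⟶ X} (hf : IsImmersion f) (y : Y.carrier)
    (V : Opens X.carrier) (hV : f.hom.base y ∈ V) :
    ∃ U : Opens X.carrier, U ≤ V ∧ f.hom.base y ∈ U ∧ IsOpenQuotientMap (Hom.app f U) := by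
  obtain ⟨W, i, j, ⟨𝓘, -, hi⟩, hj, rfl⟩ := hf
  obtain ⟨B, hB, hq⟩ := hi.quotient
  have hV' : i.hom.base y ∈ (Opens.map j.hom.base).obj V := hV
  obtain ⟨U, hU, hyU, hUV⟩ := (Opens.isBasis_iff_nbhd.mp hB) hV'
  have hop := hj.base_open
  let U' : Opens X.carrier := hop.functor.obj U
  have hU' : (Opens.map j.hom.base).obj U' = U :=
    Opens.ext (Set.preimage_image_eq _ hop.injective)
  refine ⟨U', ?_, ⟨_, hyU, rfl⟩, ?_⟩
  · rintro _ ⟨w, hw, rfl⟩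
    exact hUV hw
  · have h1 : IsOpenQuotientMap (Hom.app i ((Opens.map j.hom.base).obj U')) := hq _ (hU'.symm ▸ hU)
    have := hj.c_iso U
    have h2 := TopCommRingCat.isHomeomorph_of_isIso (j.hom.c.app (op U'))
    exact h1.comp ⟨h2.surjective, h2.continuous, h2.isOpenMap⟩

theorem IsClosedImmersion.isImmersion {f : Y ⟶ X} (hf : IsClosedImmersion f) : IsImmersion f :=
  ⟨X, f, 𝟙 X, hf, (inferInstance : PresheafedSpace.IsOpenImmersion (𝟙 X.toPresheafedSpace)),
    Category.comp_id f⟩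

theorem IsClosedImmersion.isImmersion_comp_chartHom (c : AffineChart X.toPresheafedSpace)
    {f : Y ⟶ Spf.formalScheme c.ring c.isAdmissible} (hf : IsClosedImmersion f) :
    IsImmersion (f ≫ chartHom c) :=
  ⟨_, f, chartHom c, hf, c.isOpenImmersion, rfl⟩

/-- The sections over an open subset of a chart. -/
theorem _root_.AffineChart.isHomeomorph_app (c : AffineChart X.toPresheafedSpace)
    {U : Opens X.carrier} (hU : U ≤ c.range) : IsHomeomorph (c.map.c.app (op U)).1 := by
  have := c.isOpenImmersion.isIso_c_app c.map U hU
  exact TopCommRingCat.isHomeomorph_of_isIso _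

end FormalScheme

/-! ### Ideal sheaves on formal spectra -/

namespace Spf

/-- The ideal sheaf `I^△` on a formal spectrum. -/
def triangleSheaf (A : TopCommRingCat.{u}) (hA : IsAdmissibleRing A) (I : Ideal A) :
    FormalScheme.IdealSheaf (formalScheme A hA) where
  ideal U :=
    { carrier := FormalScheme.triangle I U
      add_mem' := fun {s t} hs ht K hK => by
        change (s : sections U).1 K + (t : sections U).1 K = 0
        rw [hs K hK, ht K hK, add_zero]
      zero_mem' := fun K hK => rfl
      smul_mem' := fun s t ht K hK => by
        change (s : sections U).1 K * (t : sections U).1 K = 0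
        rw [ht K hK, mul_zero] }
  res_mem {U V} h s hs K hK := by
    change SpecSections.res (openOf_mono h K) ((s : sections U).1 K) = 0
    rw [hs K hK, map_zero]
  mem_of_locally U s hs K hK := by
    refine SpecSections.ext_value fun p hp => ?_
    obtain ⟨V, hV, hpV, h⟩ := hs (ofSpec K p) hp
    exact congrArg (SpecSections.value (U := openOf V K) p hpV) (h K hK)

theorem isClosed_triangleSheaf (A : TopCommRingCat.{u}) (hA : IsAdmissibleRing A) (I : Ideal A)
    (hI : IsClosed (I : Set A)) : (triangleSheaf A hA I).IsClosed := by
  intro x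
  exact ⟨⟨A, hA, 𝟙 (Spf A), (inferInstance : PresheafedSpace.IsOpenImmersion (𝟙 (Spf A)))⟩, ⟨x, rfl⟩, I, hI,
    fun U hU s => Iff.rfl⟩

/-- For an open ideal `I` the support of `𝒪 / I^△` is the set of points that contain `I`. -/
theorem mem_support_triangleSheaf {A : TopCommRingCat.{u}} {hA : IsAdmissibleRing A} {I : Ideal A}
    (hI : IsOpen (I : Set A)) (p : SpfPoint A) :
    p ∈ (triangleSheaf A hA I).support ↔ I ≤ p.1.asIdeal := by
  constructor
  · intro h
    by_contra hp
    -- On the complement of `V(I)` the components at open ideals containing `I` are sections over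
    -- the empty set, so `1` lies in `I^△` there.
    let U : Opens (top A) := ⟨{q | ¬ I ≤ q.1.asIdeal},
      ((PrimeSpectrum.isClosed_zeroLocus (I : Set A)).isOpen_compl).preimage
        continuous_subtype_val⟩
    refine h U hp fun K hK => ?_
    have := SpecSections.subsingleton (U := openOf U K) fun q hq => hq (hK.trans (le_ofSpec K q))
    exact Subsingleton.elim _ _
  · intro hp U hpU h
    obtain ⟨q, hq⟩ := exists_ofSpec_eq (J := ⟨I, hI⟩) (p := p) hp
    subst hq
    have := SpecSections.nontrivial (U := openOf U ⟨I, hI⟩) q hpU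
    exact one_ne_zero (h ⟨I, hI⟩ le_rfl)

/-! ### Completeness in terms of sequences -/

section Complete

variable {A : Type*} [CommRing A] [TopologicalSpace A] [IsTopologicalRing A] {I : ℕ → Ideal A}

theorem _root_.sub_mem_of_forall_succ_sub_mem {A : Type*} [CommRing A] {I : ℕ → Ideal A}
    (hI : Antitone I) {a : ℕ → A} (ha : ∀ n, a (n + 1) - a n ∈ I n) {m n : ℕ} (h : n ≤ m) :
    a m - a n ∈ I n := by
  induction m, h using Nat.le_induction with
  | base => simp
  | succ m hm ih => simpa using add_mem (hI hm (ha m)) ih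

/-- The ideals `I n` are open, hence closed, so the limit of the Cauchy sequence stays congruent to
`a n` modulo `I n`. -/
theorem _root_.exists_forall_sub_mem_of_completeSpace
    (hc : @CompleteSpace A (IsTopologicalAddGroup.rightUniformSpace A)) (hI : Antitone I)
    (hb : (nhds (0 : A)).HasBasis (fun _ => True) (fun n => (I n : Set A))) (a : ℕ → A)
    (ha : ∀ n, a (n + 1) - a n ∈ I n) : ∃ x, ∀ n, x - a n ∈ I n := by
  let := IsTopologicalAddGroup.rightUniformSpace A
  have : IsUniformAddGroup A := isUniformAddGroup_of_addCommGroup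
  have hbu := hb.uniformity_of_nhds_zero
  have hcau : CauchySeq a := hbu.cauchySeq_iff.mpr fun n _ => ⟨n, fun m hm k hk => by
    have := sub_mem (sub_mem_of_forall_succ_sub_mem hI ha hk)
      (sub_mem_of_forall_succ_sub_mem hI ha hm)
    simpa using this⟩
  obtain ⟨x, hx⟩ := cauchySeq_tendsto_of_complete hcau
  refine ⟨x, fun n => ?_⟩
  have hop : IsOpen (I n : Set A) := AddSubgroup.isOpen_of_mem_nhds
    (Submodule.toAddSubgroup (I n)) (hb.mem_of_mem trivial)
  have hcl : IsClosed (I n : Set A) :=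
    AddSubgroup.isClosed_of_isOpen (Submodule.toAddSubgroup (I n)) hop
  exact hcl.mem_of_tendsto (hx.sub_const (a n)) (Filter.eventually_atTop.mpr
    ⟨n, fun m hm => sub_mem_of_forall_succ_sub_mem hI ha hm⟩)

theorem _root_.completeSpace_of_forall_exists_sub_mem
    (hb : (nhds (0 : A)).HasBasis (fun _ => True) (fun n => (I n : Set A)))
    (h : ∀ a : ℕ → A, (∀ n, a (n + 1) - a n ∈ I n) → ∃ x, ∀ n, x - a n ∈ I n) :
    @CompleteSpace A (IsTopologicalAddGroup.rightUniformSpace A) := by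
  let := IsTopologicalAddGroup.rightUniformSpace A
  have : IsUniformAddGroup A := isUniformAddGroup_of_addCommGroup
  have : (nhds (0 : A)).IsCountablyGenerated := hb.isCountablyGenerated
  have := IsUniformAddGroup.uniformity_countably_generated (α := A)
  have hbu := hb.uniformity_of_nhds_zero
  refine UniformSpace.complete_of_cauchySeq_tendsto fun u hu => ?_
  have h1 : ∀ k, ∃ N, ∀ m ≥ N, ∀ n ≥ N, u n - u m ∈ I k := fun k =>
    hbu.cauchySeq_iff.mp hu k trivial
  choose N hN using h1
  -- Running maxima make the indices monotone, so consecutive terms of `u ∘ M` differ by elements of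
  -- `I k` and the hypothesis applies to this subsequence.
  let M : ℕ → ℕ := fun k => (Finset.range (k + 1)).sup N
  have hM : Monotone M := fun i j hij => Finset.sup_mono (by simpa using hij)
  have hNM : ∀ k, N k ≤ M k := fun k => Finset.le_sup (f := N) (by simp)
  obtain ⟨x, hx⟩ := h (fun k => u (M k)) fun k =>
    hN k _ (hNM k) _ ((hNM k).trans (hM (Nat.le_succ k)))
  refine ⟨x, ?_⟩
  rw [← tendsto_sub_nhds_zero_iff, hb.tendsto_right_iff]
  intro k _
  filter_upwards [Filter.eventually_ge_atTop (M k)] with n hn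
  have := sub_mem (hN k _ (hNM k) n ((hNM k).trans hn)) (hx k)
  simpa using this

end Complete

/-! ### Discrete rings -/

theorem _root_.IsAdmissibleRing.of_discreteTopology (A : Type u) [CommRing A] [TopologicalSpace A]
    [IsTopologicalRing A] [DiscreteTopology A] : IsAdmissibleRing A where
  exists_basis := ⟨fun _ => ⊥, antitone_const, by
    rw [nhds_discrete]
    exact ⟨fun t => by simp⟩⟩
  separated := inferInstance
  complete := completeSpace_of_forall_exists_sub_mem (I := fun _ => ⊥) (by
    rw [nhds_discrete]
    exact ⟨fun t => by simp⟩) fun a ha => ⟨a 0, fun n => by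
      induction n with
      | zero => simp
      | succ n ih =>
        have h1 := ha n
        rw [Ideal.mem_bot, sub_eq_zero] at h1 ih ⊢
        rw [h1, ih]⟩
  exists_idealOfDefinition := ⟨⊥, isOpen_discrete _, fun f hf => by
    rw [Ideal.mem_bot.mp hf]
    exact IsTopologicallyNilpotent.zero⟩

variable {A : Type u} [CommRing A] [TopologicalSpace A] [IsTopologicalRing A]

theorem sections_ext_bot [DiscreteTopology A] {U : Opens (top A)} {s t : sections U}
    (h : s.1 ⟨⊥, isOpen_discrete _⟩ = t.1 ⟨⊥, isOpen_discrete _⟩) : s = t :=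
  sections_ext fun _ => component_eq bot_le h

theorem discreteTopology_sections [DiscreteTopology A] {U : Opens (top A)}
    (hU : IsCompact (openOf U ⟨⊥, isOpen_discrete _⟩ : Set (PrimeSpectrum.Top (A ⧸ (⊥ : Ideal A))))) :
    DiscreteTopology (sections U) := by
  refine discreteTopology_of_isOpen_singleton_zero ?_
  convert isOpen_component_eq_zero _ hU
  ext s
  exact ⟨fun h => by rw [h]; rfl, fun h => sections_ext_bot h⟩

/-! ### Basic open subsets of a formal spectrum -/

/-- The basic open subset of the formal spectrum given by an element of the ring. -/
def basicOpen (g : A) : Opens (top A) :=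
  ⟨{p | g ∉ p.1.asIdeal}, (PrimeSpectrum.basicOpen g).2.preimage continuous_subtype_val⟩

theorem isBasis_basicOpen : Opens.IsBasis (Set.range (basicOpen : A → Opens (top A))) := by
  refine Opens.isBasis_iff_nbhd.mpr fun {U p} hp => ?_
  obtain ⟨V, hV, hUV⟩ := U.2
  have hpV : p.1 ∈ (⟨V, hV⟩ : Opens (PrimeSpectrum A)) := by
    change p ∈ Subtype.val ⁻¹' V
    rw [hUV]
    exact hp
  obtain ⟨_, ⟨g, rfl⟩, hpg, hg⟩ := (Opens.isBasis_iff_nbhd.mp PrimeSpectrum.isBasis_basic_opens) hpV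
  refine ⟨basicOpen g, ⟨g, rfl⟩, hpg, fun q hq => ?_⟩
  have : q ∈ Subtype.val ⁻¹' V := hg hq
  rwa [hUV] at this

theorem isCompact_openOf_basicOpen (g : A) (J : OpenIdeal A) :
    IsCompact (openOf (basicOpen g) J : Set (PrimeSpectrum.Top (A ⧸ J.1))) :=
  PrimeSpectrum.isCompact_basicOpen (Ideal.Quotient.mk J.1 g)

theorem isUnit_ofRing_basicOpen (g : A) : IsUnit (ofRing (basicOpen g) g) := by
  refine isUnit_iff.mpr fun p hp => ?_
  let J : OpenIdeal A := ⟨p.1.asIdeal, p.2⟩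
  obtain ⟨q, hq⟩ := exists_ofSpec_eq (J := J) (p := p) le_rfl
  clear_value J
  subst hq
  exact (isUnitAt_iff _ q hp).mpr ((SpecSections.isUnit_algebraMap_iff _ _).mpr hp)

/-! ### Closed subschemes given by open ideals -/

/-- The quotient of a topological ring by an open ideal is discrete. -/
theorem discreteTopology_quotient (J : OpenIdeal A) : DiscreteTopology (A ⧸ J.1) :=
  QuotientAddGroup.discreteTopology (N := J.1.toAddSubgroup) J.2

theorem continuous_mk (J : OpenIdeal A) : Continuous (Ideal.Quotient.mk J.1) :=
  continuous_quot_mk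

theorem bijective_quotientMap {B : Type u} [CommRing B] [TopologicalSpace B] {φ : A →+* B}
    [IsTopologicalRing B]
    (hφ : Continuous φ) (hs : Function.Surjective φ) (K : OpenIdeal B) :
    Function.Bijective (quotientMap hφ K) :=
  ⟨Ideal.quotientMap_injective, Ideal.quotientMap_surjective hs⟩

/-- A pullback along a surjective homomorphism vanishes if and only if all components at open
ideals containing the kernel vanish. -/
theorem pullback_eq_zero_iff {B : Type u} [CommRing B] [TopologicalSpace B] {φ : A →+* B}
    [IsTopologicalRing B] [DiscreteTopology B] (hφ : Continuous φ) (hs : Function.Surjective φ)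
    {U : Opens (top A)} (s : sections U) :
    pullback hφ U s = 0 ↔ ∀ K : OpenIdeal A, RingHom.ker φ ≤ K.1 → s.1 K = 0 := by
  constructor
  · intro h K hK
    -- As `K` contains the kernel, its image has preimage `K`, and `A / K → B / L` is bijective;
    -- hence the component at `K` can be read off in `B`.
    let L : OpenIdeal B := ⟨K.1.map φ, isOpen_discrete _⟩
    have hL : comapIdeal hφ L = K := Subtype.ext ((Ideal.comap_map_of_surjective φ hs K.1).trans
      (sup_eq_left.mpr hK))
    have h1 : (pullback hφ U s).1 L = 0 := by rw [h]; rfl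
    clear_value L
    subst hL
    rw [pullback_component] at h1
    refine SpecSections.comap_injective (bijective_quotientMap hφ hs L) _ ?_ (h1.trans (map_zero _).symm)
    exact fun p hp => hp
  · intro h
    refine sections_ext fun L => ?_
    rw [pullback_component, h _ (Ideal.comap_mono bot_le), map_zero]
    rfl

/-- A section over `D(φ g)` is a fraction `φ(c) / φ(g) ^ n`, and it lifts to `c / g ^ n` because `g`
is invertible on `D(g)`. Since `B` is discrete, only the component at the zero ideal has to be
checked. -/
theorem pullback_basicOpen_surjective {B : Type u} [CommRing B] [TopologicalSpace B] {φ : A →+* B}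
    [IsTopologicalRing B] [DiscreteTopology B] (hφ : Continuous φ) (hs : Function.Surjective φ)
    (g : A) : Function.Surjective (pullback hφ (basicOpen g)) := by
  intro t
  let O : OpenIdeal B := ⟨⊥, isOpen_discrete _⟩
  obtain ⟨n, a, h⟩ := SpecSections.exists_pow_mul_eq_ofRing
    (U := openOf (mapOpen hφ (basicOpen g)) O) (Ideal.Quotient.mk _ (φ g)) rfl (t.1 O)
  obtain ⟨b, rfl⟩ := Ideal.Quotient.mk_surjective a
  obtain ⟨c, rfl⟩ := hs b
  obtain ⟨v, hv⟩ := (isUnit_ofRing_basicOpen g).exists_right_inv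
  refine ⟨ofRing _ c * v ^ n, sections_ext_bot ?_⟩
  have hu : IsUnit (pullback hφ _ (ofRing (basicOpen g) g)) := (isUnit_ofRing_basicOpen g).map _
  have h1 : pullback hφ _ (ofRing _ c * v ^ n) * pullback hφ _ (ofRing (basicOpen g) g) ^ n =
      ofRing _ (φ c) := by
    rw [← pullback_ofRing, ← map_pow, ← map_mul, mul_assoc, ← mul_pow, mul_comm v, hv, one_pow,
      mul_one]
  have h2 := congrFun (congrArg Subtype.val h1) O
  have h3 : IsUnit ((pullback hφ _ (ofRing (basicOpen g) g)).1 O ^ n) :=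
    ((hu.map (sections _).subtype).map (Pi.evalRingHom _ O)).pow n
  refine h3.mul_right_cancel (h2.trans ?_)
  refine Eq.trans h.symm ?_
  rw [pullback_ofRing]
  rfl

theorem isEmbedding_mapPoint {B : Type u} [CommRing B] [TopologicalSpace B] {φ : A →+* B}
    (hφ : Continuous φ) (hs : Function.Surjective φ) : Topology.IsEmbedding (mapPoint hφ) := by
  refine Topology.IsEmbedding.of_comp (continuous_mapPoint hφ) continuous_subtype_val ?_
  exact (PrimeSpectrum.isClosedEmbedding_comap_of_surjective _ _ hs).isEmbedding.comp
    Topology.IsEmbedding.subtypeVal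

theorem range_mapPoint {B : Type u} [CommRing B] [TopologicalSpace B] [DiscreteTopology B]
    {φ : A →+* B} (hφ : Continuous φ) (hs : Function.Surjective φ) :
    Set.range (mapPoint hφ) = {p | RingHom.ker φ ≤ p.1.asIdeal} := by
  ext p
  constructor
  · rintro ⟨q, rfl⟩
    exact Ideal.comap_mono bot_le
  · intro hp
    have h1 : p.1 ∈ Set.range (PrimeSpectrum.comap φ) := by
      rw [range_comap_of_surjective _ _ hs]
      exact hp
    obtain ⟨q, hq⟩ := h1
    exact ⟨⟨q, isOpen_discrete _⟩, Subtype.ext hq⟩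

/-- A surjective continuous homomorphism to a discrete ring defines a closed immersion. -/
theorem isClosedImmersion_mapHom {A B : TopCommRingCat.{u}} [DiscreteTopology B]
    (hA : IsAdmissibleRing A) (hB : IsAdmissibleRing B) (φ : A ⟶ B)
    (hs : Function.Surjective φ.1) : FormalScheme.IsClosedImmersion (mapHom hA hB φ) := by
  have hker : IsOpen (RingHom.ker φ.1 : Set A) := by
    exact (isOpen_discrete {(0 : B)}).preimage φ.2
  refine ⟨triangleSheaf A hA (RingHom.ker φ.1), isClosed_triangleSheaf A hA _ ?_, ?_, ?_, ?_, ?_⟩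
  · exact (AddSubgroup.isClosed_of_isOpen (Submodule.toAddSubgroup (RingHom.ker φ.1)) hker)
  · exact isEmbedding_mapPoint φ.2 hs
  · refine (range_mapPoint φ.2 hs).trans (Set.ext fun p => ?_)
    exact (mem_support_triangleSheaf hker p).symm
  · intro U
    ext s
    exact pullback_eq_zero_iff φ.2 hs s
  · refine ⟨_, isBasis_basicOpen, ?_⟩
    rintro _ ⟨g, rfl⟩
    have : DiscreteTopology (sections (mapOpen φ.2 (basicOpen g))) :=
      discreteTopology_sections (isCompact_openOf_basicOpen (φ.1 g) _)
    exact ⟨pullback_basicOpen_surjective φ.2 hs g, continuous_pullback φ.2 _,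
      fun S _ => isOpen_discrete (α := sections (mapOpen φ.2 (basicOpen g))) _⟩

end Spf

/-! ### The limit of the quotients by the powers of an ideal -/

/-- The limit of the rings `A / m ^ n`. -/
def AdicLimit {A : Type u} [CommRing A] (m : Ideal A) : Type u :=
  {s : ∀ n : ℕ, A ⧸ m ^ n // ∀ (k n : ℕ) (h : k ≤ n),
    Ideal.Quotient.factor (Ideal.pow_le_pow_right h) (s n) = s k}

namespace AdicLimit

variable {A : Type u} [CommRing A] (m : Ideal A)

/-- The limit as a subring of the product. -/
def subring : Subring (∀ n : ℕ, A ⧸ m ^ n) where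
  carrier := {s | ∀ (k n : ℕ) (h : k ≤ n),
    Ideal.Quotient.factor (Ideal.pow_le_pow_right h) (s n) = s k}
  mul_mem' hs ht k n h := by simp only [Pi.mul_apply, map_mul, hs k n h, ht k n h]
  one_mem' k n h := by simp only [Pi.one_apply, map_one]
  add_mem' hs ht k n h := by simp only [Pi.add_apply, map_add, hs k n h, ht k n h]
  zero_mem' k n h := by simp only [Pi.zero_apply, map_zero]
  neg_mem' hs k n h := by simp only [Pi.neg_apply, map_neg, hs k n h]

instance : CommRing (AdicLimit m) := inferInstanceAs (CommRing (subring m))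

/-- The projection to `A / m ^ n`. -/
def proj (n : ℕ) : AdicLimit m →+* A ⧸ m ^ n :=
  (Pi.evalRingHom (fun n : ℕ => A ⧸ m ^ n) n).comp (subring m).subtype

/-- The canonical homomorphism to the limit. -/
def of : A →+* AdicLimit m :=
  RingHom.codRestrict (RingHom.pi fun n => Ideal.Quotient.mk (m ^ n)) (subring m)
    fun _ _ _ _ => rfl

variable {m}

theorem proj_of (n : ℕ) (a : A) : proj m n (of m a) = Ideal.Quotient.mk (m ^ n) a := rfl

theorem factor_proj {k n : ℕ} (h : k ≤ n) (x : AdicLimit m) :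
    Ideal.Quotient.factor (Ideal.pow_le_pow_right h) (proj m n x) = proj m k x :=
  x.2 k n h

theorem ext {x y : AdicLimit m} (h : ∀ n, proj m n x = proj m n y) : x = y :=
  Subtype.ext (funext h)

instance : TopologicalSpace (AdicLimit m) := ⨅ n, TopologicalSpace.induced (proj m n) ⊥

instance : IsTopologicalRing (AdicLimit m) := by
  have hmul : ContinuousMul (AdicLimit m) := continuousMul_iInf fun n => by
    let : TopologicalSpace (A ⧸ m ^ n) := ⊥
    have : DiscreteTopology (A ⧸ m ^ n) := ⟨rfl⟩
    exact continuousMul_induced (proj m n)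
  have hadd : IsTopologicalAddGroup (AdicLimit m) := topologicalAddGroup_iInf fun n => by
    let : TopologicalSpace (A ⧸ m ^ n) := ⊥
    have : DiscreteTopology (A ⧸ m ^ n) := ⟨rfl⟩
    exact topologicalAddGroup_induced (proj m n)
  exact { }

theorem antitone_ker_proj : Antitone fun n => RingHom.ker (proj m n) := fun k n h x hx => by
  rw [RingHom.mem_ker] at hx ⊢
  rw [← factor_proj h, hx, map_zero]

theorem hasBasis_nhds_zero :
    (nhds (0 : AdicLimit m)).HasBasis (fun _ => True) fun n => (RingHom.ker (proj m n) : Set _) := by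
  have h : nhds (0 : AdicLimit m) = ⨅ n, Filter.principal (RingHom.ker (proj m n) : Set _) := by
    rw [nhds_iInf]
    refine iInf_congr fun n => ?_
    let : TopologicalSpace (A ⧸ m ^ n) := ⊥
    have : DiscreteTopology (A ⧸ m ^ n) := ⟨rfl⟩
    rw [nhds_induced, nhds_discrete, Filter.comap_pure, map_zero]
    rfl
  rw [h]
  exact Filter.hasBasis_iInf_principal
    (Antitone.directed_ge fun _ _ h => antitone_ker_proj h)

theorem isOpen_ker_proj (n : ℕ) : IsOpen (RingHom.ker (proj m n) : Set (AdicLimit m)) :=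
  AddSubgroup.isOpen_of_mem_nhds (Submodule.toAddSubgroup (RingHom.ker (proj m n)))
    (hasBasis_nhds_zero.mem_of_mem trivial)

theorem exists_ker_proj_le {K : Ideal (AdicLimit m)} (hK : IsOpen (K : Set (AdicLimit m))) :
    ∃ n, RingHom.ker (proj m n) ≤ K := by
  obtain ⟨n, -, hn⟩ := hasBasis_nhds_zero.mem_iff.mp (hK.mem_nhds K.zero_mem)
  exact ⟨n, hn⟩

theorem exists_sub_of_mem_ker (x : AdicLimit m) (n : ℕ) :
    ∃ a : A, x - of m a ∈ RingHom.ker (proj m n) := by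
  obtain ⟨a, ha⟩ := Ideal.Quotient.mk_surjective (proj m n x)
  exact ⟨a, by rw [RingHom.mem_ker, map_sub, proj_of, ha, sub_self]⟩

theorem exists_sub_of_mem {K : Ideal (AdicLimit m)} (hK : IsOpen (K : Set (AdicLimit m)))
    (x : AdicLimit m) : ∃ a : A, x - of m a ∈ K := by
  obtain ⟨n, hn⟩ := exists_ker_proj_le hK
  obtain ⟨a, ha⟩ := exists_sub_of_mem_ker x n
  exact ⟨a, hn ha⟩

theorem of_mem_ker_proj {a : A} {n : ℕ} : of m a ∈ RingHom.ker (proj m n) ↔ a ∈ m ^ n := by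
  rw [RingHom.mem_ker, proj_of, Ideal.Quotient.eq_zero_iff_mem]

theorem exists_pow_le_comap {K : Ideal (AdicLimit m)} (hK : IsOpen (K : Set (AdicLimit m))) :
    ∃ n, m ^ n ≤ K.comap (of m) := by
  obtain ⟨n, hn⟩ := exists_ker_proj_le hK
  exact ⟨n, fun a ha => hn (of_mem_ker_proj.mpr ha)⟩

theorem isAdmissibleRing : IsAdmissibleRing (AdicLimit m) where
  exists_basis := ⟨_, antitone_ker_proj, hasBasis_nhds_zero⟩
  separated := by
    refine IsTopologicalAddGroup.t2Space_of_zero_sep fun x hx => ?_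
    by_contra! h
    exact hx (ext fun n => h _ (hasBasis_nhds_zero.mem_of_mem (i := n) trivial))
  complete := by
    refine completeSpace_of_forall_exists_sub_mem hasBasis_nhds_zero fun a ha => ?_
    have h1 : ∀ k n, k ≤ n → proj m k (a n) = proj m k (a k) := fun k n h => by
      have := sub_mem_of_forall_succ_sub_mem antitone_ker_proj ha h
      rwa [RingHom.mem_ker, map_sub, sub_eq_zero] at this
    let x : AdicLimit m := ⟨fun n => proj m n (a n), fun k n h => by rw [factor_proj h, h1 k n h]⟩
    refine ⟨x, fun n => ?_⟩
    rw [RingHom.mem_ker, map_sub, sub_eq_zero]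
    rfl
  exists_idealOfDefinition := by
    -- If `x` vanishes modulo `m`, then `x` agrees modulo `m ^ k` with some `a ∈ m`, so `x ^ k`
    -- agrees with `a ^ k ∈ m ^ k`.
    refine ⟨RingHom.ker (proj m 1), isOpen_ker_proj 1, fun x hx => ?_⟩
    refine hasBasis_nhds_zero.tendsto_right_iff.mpr fun n _ => ?_
    -- The bound `n + 1` guarantees `k ≥ 1`, so that the class modulo `m ^ k` determines the class
    -- modulo `m`.
    filter_upwards [Filter.eventually_ge_atTop (n + 1)] with k hk
    refine antitone_ker_proj (Nat.le_of_succ_le hk) ?_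
    change proj m k (x ^ k) = 0
    obtain ⟨a, ha⟩ := exists_sub_of_mem_ker x k
    have h1 : proj m k x = Ideal.Quotient.mk (m ^ k) a := by
      rwa [RingHom.mem_ker, map_sub, sub_eq_zero, proj_of] at ha
    have h2 : a ∈ m := by
      have h3 := factor_proj (show 1 ≤ k by omega) x
      rw [h1, RingHom.mem_ker.mp hx, Ideal.Quotient.factor_mk, Ideal.Quotient.eq_zero_iff_mem,
        pow_one] at h3
      exact h3
    rw [map_pow, h1, ← map_pow, Ideal.Quotient.eq_zero_iff_mem]
    exact Ideal.pow_mem_pow h2 k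

theorem continuous_of [TopologicalSpace A] [IsTopologicalRing A]
    (hm : ∀ n, IsOpen ((m ^ n : Ideal A) : Set A)) : Continuous (of m) := by
  refine continuous_iInf_rng.mpr fun n => continuous_induced_rng.mpr ?_
  refine @continuous_of_isOpen_of_sub_mem _ _ _ _ _ ⊥ _ (hm n) _ fun a b hab => ?_
  exact Ideal.Quotient.eq.mpr hab

/-- An open prime contains some `ker (proj m n)`, so its contraction contains `m ^ n` and hence the
maximal ideal `m`. -/
theorem comap_of_eq [hm : m.IsMaximal] {K : Ideal (AdicLimit m)} [hK : K.IsPrime]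
    (hK' : IsOpen (K : Set (AdicLimit m))) : K.comap (of m) = m := by
  obtain ⟨n, hn⟩ := exists_pow_le_comap hK'
  have hp : (K.comap (of m)).IsPrime := Ideal.comap_isPrime _ _
  exact (hm.eq_of_le hp.ne_top (hp.le_of_pow_le hn)).symm

/-- Modulo the open ideal `p ∩ q` every element comes from `A`, and `p` and `q` both contract to
`m`; so they have the same elements. -/
theorem subsingleton_spfPoint [m.IsMaximal] : Subsingleton (SpfPoint (AdicLimit m)) := by
  have key : ∀ p q : SpfPoint (AdicLimit m), p.1.asIdeal ≤ q.1.asIdeal := fun p q x hx => by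
    obtain ⟨a, ha⟩ := exists_sub_of_mem (K := p.1.asIdeal ⊓ q.1.asIdeal) (p.2.inter q.2) x
    have h1 : of m a ∈ p.1.asIdeal := by simpa using sub_mem hx ha.1
    have h2 : a ∈ p.1.asIdeal.comap (of m) := h1
    rw [comap_of_eq p.2, ← comap_of_eq q.2] at h2
    simpa using add_mem ha.2 h2
  exact ⟨fun p q => Subtype.ext (PrimeSpectrum.ext (le_antisymm (key p q) (key q p)))⟩

theorem nonempty_spfPoint [hm : m.IsMaximal] : Nonempty (SpfPoint (AdicLimit m)) := by
  have h : (m ^ 1).IsPrime := by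
    rw [pow_one]
    exact hm.isPrime
  exact ⟨⟨⟨RingHom.ker (proj m 1), RingHom.ker_isPrime _⟩, isOpen_ker_proj 1⟩⟩

end AdicLimit

/-! ### A pseudo-immersion that is not an immersion -/

theorem IsOpenMap.of_comp_of_surjective {X Y Z : Type*} [TopologicalSpace X] [TopologicalSpace Y]
    [TopologicalSpace Z] {f : X → Y} {g : Y → Z} (h : IsOpenMap (g ∘ f)) (hf : Continuous f)
    (hs : Function.Surjective f) : IsOpenMap g := fun S hS => by
  have h2 := h _ (hS.preimage hf)
  rwa [Set.image_comp, Set.image_preimage_eq S hs] at h2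

namespace Spf

/-- A closed point of an affine formal scheme is open if the completion at this point is an
immersion, provided that the ring is Noetherian and adic. -/
theorem exists_pow_le_of_isOpenMap_pullback {A : Type u} [CommRing A] [TopologicalSpace A]
    [IsTopologicalRing A] [IsNoetherianRing A] {m I : Ideal A} [m.IsMaximal]
    (hI : IsOpen (I : Set A)) (hφ : Continuous (AdicLimit.of m)) {U : Opens (top A)}
    (hU : ∀ q, mapPoint hφ q ∈ U) (h : IsOpenMap (pullback hφ U)) :
    ∃ n, m ^ n ≤ m ^ (n + 1) ⊔ I := by
  have htop : ∀ K, openOf (mapOpen hφ U) K = ⊤ := fun K => eq_top_iff.mpr fun q _ => hU (ofSpec K q)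
  have hN : IsOpen {s : sections U | s.1 ⟨I, hI⟩ = 0} :=
    isOpen_component_eq_zero ⟨I, hI⟩ (NoetherianSpace.isCompact (α := PrimeSpectrum (A ⧸ I)) _)
  -- The sections vanishing modulo `I` form a neighbourhood of zero. Its image is open, so it
  -- contains all sections vanishing at some open `J`, in particular those given by a power of `m`.
  obtain ⟨J, hJ⟩ := exists_openIdeal_of_mem_nhds ((h _ hN).mem_nhds ⟨0, rfl, map_zero _⟩)
  obtain ⟨n, hn⟩ := AdicLimit.exists_pow_le_comap J.2
  refine ⟨n, fun a ha => ?_⟩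
  have h1 : (ofRing (mapOpen hφ U) (AdicLimit.of m a)).1 J = 0 :=
    (ofRing_component_eq_zero_iff (htop J) _).mpr (hn ha)
  obtain ⟨s, hs, hsa⟩ := hJ _ h1
  -- `K` is chosen to contract to `m ^ (n + 1) + I`. As `s` vanishes modulo `I`, its pullback
  -- vanishes at `K`; but this pullback is the section given by `a`.
  let K : OpenIdeal (AdicLimit m) :=
    ⟨((m ^ (n + 1) ⊔ I).map (Ideal.Quotient.mk (m ^ (n + 1)))).comap (AdicLimit.proj m (n + 1)),
      Ideal.isOpen_of_le (Ideal.comap_mono bot_le) (AdicLimit.isOpen_ker_proj (n + 1))⟩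
  have hK : (comapIdeal hφ K).1 = m ^ (n + 1) ⊔ I := by
    change ((m ^ (n + 1) ⊔ I).map (Ideal.Quotient.mk (m ^ (n + 1)))).comap
      (Ideal.Quotient.mk (m ^ (n + 1))) = _
    rw [Ideal.comap_map_of_surjective _ Ideal.Quotient.mk_surjective]
    refine sup_eq_left.mpr (le_trans ?_ le_sup_left)
    rw [← RingHom.ker_eq_comap_bot, Ideal.mk_ker]
  have h2 : (pullback hφ U s).1 K = 0 := by
    rw [pullback_component, component_eq_zero (J := ⟨I, hI⟩) (le_sup_right.trans hK.ge) hs, map_zero]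
  rw [hsa, ofRing_component_eq_zero_iff (htop K)] at h2
  rw [← hK]
  exact h2

/-- A maximal ideal `m` with `m ^ n ⊆ m ^ (n + 1) + I` is an isolated point of the formal
spectrum. -/
theorem isOpen_singleton_of_pow_le {A : Type u} [CommRing A] [TopologicalSpace A]
    [IsTopologicalRing A] [IsNoetherianRing A] {I : Ideal A} (x : SpfPoint A)
    (hI : ∀ p : SpfPoint A, I ≤ p.1.asIdeal) (hx : x.1.asIdeal.IsMaximal) {n : ℕ}
    (h : x.1.asIdeal ^ n ≤ x.1.asIdeal ^ (n + 1) ⊔ I) : IsOpen {x} := by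
  -- Nakayama: `r ≡ 1` modulo `m` and `r m ^ n ⊆ I`. An open prime without `r` contains `m ^ n`, so
  -- it is `m`; the set `{x}` is `D(r)`.
  obtain ⟨r, hr, hle⟩ := Submodule.exists_sub_one_mem_and_smul_le_of_fg_of_le_sup
    (I := x.1.asIdeal) (N := I) (N' := x.1.asIdeal ^ n) (P := x.1.asIdeal ^ n)
    (IsNoetherian.noetherian _) le_rfl (by rwa [smul_eq_mul, ← pow_succ', sup_comm])
  convert (basicOpen r).2 using 1
  ext p
  constructor
  · rintro rfl hp
    refine hx.ne_top ((Ideal.eq_top_iff_one _).mpr ?_)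
    simpa using sub_mem hp hr
  · intro hp
    have h1 : x.1.asIdeal ^ n ≤ p.1.asIdeal := fun a ha =>
      (p.1.isPrime.mem_or_mem (hI p (hle (Submodule.smul_mem_pointwise_smul a r _ ha)))).resolve_left
        hp
    exact Subtype.ext (PrimeSpectrum.ext
      (hx.eq_of_le p.1.isPrime.ne_top (p.1.isPrime.le_of_pow_le h1)).symm)

end Spf

/-! ### The completion at a closed point is a pseudo-immersion; necessity of discreteness -/

namespace FormalScheme

variable {X Y Z : FormalScheme.{u}}

theorem res_eq_zero_iff {U V : Opens X.carrier} (h : V ≤ U) (h' : U ≤ V) (s : X.sections U) :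
    X.res h s = 0 ↔ s = 0 := by
  refine ⟨fun hs => ?_, fun hs => by rw [hs, map_zero]⟩
  rw [← res_self le_rfl s, ← res_res h h', hs, map_zero]

/-- The sections of an ordinary scheme with one point are discrete. -/
theorem IsOrdinary.discreteTopology_sections (hZ : Z.IsOrdinary) [Subsingleton Z.carrier]
    (z : Z.carrier) {V : Opens Z.carrier} (hz : z ∈ V) : DiscreteTopology (Z.sections V) := by
  obtain ⟨c, hzc, hc⟩ := hZ z
  have hV : V ≤ c.range := fun w _ => Subsingleton.elim z w ▸ hzc
  have htop : (Opens.map c.map.base).obj V = ⊤ :=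
    eq_top_iff.mpr fun p _ => show c.map.base p ∈ V from Subsingleton.elim z (c.map.base p) ▸ hz
  have hd : DiscreteTopology (Spf.sections (A := c.ring) ((Opens.map c.map.base).obj V)) := by
    refine Spf.discreteTopology_sections ?_
    rw [htop]
    exact isCompact_univ (X := PrimeSpectrum (c.ring ⧸ (⊥ : Ideal c.ring)))
  have h := c.isHomeomorph_app hV
  exact @Topology.IsEmbedding.discreteTopology _ _ _ _ _ hd h.isEmbedding

theorem nontrivial_sections {U : Opens X.carrier} {x : X.carrier} (hx : x ∈ U) :
    Nontrivial (X.sections U) := by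
  obtain ⟨c, p, rfl⟩ := X.exists_chart x
  have := Spf.nontrivial_sections (U := (Opens.map c.map.base).obj U) p hx
  exact RingHom.domain_nontrivial
    (show X.sections U →+* Spf.sections (A := c.ring) ((Opens.map c.map.base).obj U) from
      (c.map.c.app (op U)).1)

/-- The unit ideal defines the empty subscheme. The case is needed because the test schemes of a
pseudo-immersion may be empty. -/
theorem isClosedImmersion_of_isEmpty {A : TopCommRingCat.{u}} {hA : IsAdmissibleRing A}
    [IsEmpty Z.carrier] (f : Z ⟶ Spf.formalScheme A hA) : IsClosedImmersion f := by
  have hbot : ∀ V : Opens Z.carrier, Subsingleton (Z.sections V) := fun V =>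
    subsingleton_sections (eq_bot_iff.mpr fun z _ => isEmptyElim z)
  refine ⟨Spf.triangleSheaf A hA ⊤, Spf.isClosed_triangleSheaf A hA ⊤ isClosed_univ, ?_, ?_, ?_, ?_⟩
  · exact Topology.IsEmbedding.of_subsingleton _
  · ext p
    rw [Set.range_eq_empty]
    refine ⟨fun h => h.elim, fun h => ?_⟩
    exact p.1.isPrime.ne_top (top_le_iff.mp ((Spf.mem_support_triangleSheaf isOpen_univ p).mp h))
  · intro U
    ext s
    refine ⟨fun _ K hK => ?_, fun _ => (hbot _).elim _ _⟩
    have := SpecSections.subsingleton (U := Spf.openOf U K) fun q hq =>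
      (Spf.ofSpec K q).1.isPrime.ne_top (top_le_iff.mp (hK.trans (Spf.le_ofSpec K q)))
    exact Subsingleton.elim _ _
  · refine ⟨Set.univ, ?_, fun U _ => ?_⟩
    · exact Opens.isBasis_iff_nbhd.mpr fun {U x} hx => ⟨U, trivial, hx, le_rfl⟩
    · have := hbot (Hom.preimage f U)
      exact ⟨fun y => ⟨0, Subsingleton.elim _ _⟩, (f.hom.c.app (op U)).2,
        fun _ _ => isOpen_discrete _⟩

/-- An immersion of an ordinary scheme into the completion at a maximal ideal `m` is a closed
immersion into the formal spectrum of the ring. -/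
theorem isClosedImmersion_comp_mapHom_of {A B : TopCommRingCat.{u}} {hA : IsAdmissibleRing A}
    {hB : IsAdmissibleRing B} (φ : A ⟶ B) [Subsingleton (SpfPoint B)]
    (hdense : ∀ (K : OpenIdeal B) (b : B), ∃ a : A, b - φ.1 a ∈ K.1)
    (hpt : ∀ (K : OpenIdeal B) (p : SpfPoint A) (q : SpfPoint B),
      (Spf.comapIdeal φ.2 K).1 ≤ p.1.asIdeal → p = Spf.mapPoint φ.2 q)
    (hZ : Z.IsOrdinary) (i : Z ⟶ Spf.formalScheme B hB) (hi : IsImmersion i) :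
    IsClosedImmersion (i ≫ Spf.mapHom hA hB φ) := by
  rcases isEmpty_or_nonempty Z.carrier with hZe | ⟨⟨z⟩⟩
  · exact isClosedImmersion_of_isEmpty _
  let y : SpfPoint B := i.hom.base z
  let x : SpfPoint A := Spf.mapPoint φ.2 y
  have : Subsingleton Z.carrier := hi.isEmbedding.injective.subsingleton (β := SpfPoint B)
  have hbase : ∀ w, (i ≫ Spf.mapHom hA hB φ).hom.base w = x := fun w => by
    rw [Subsingleton.elim w z]
    rfl
  let α : ∀ V : Opens (Spf.top B), Spf.sections V →+* Z.sections (Hom.preimage i V) :=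
    fun V => Hom.app i V
  have hα : ∀ V, Continuous (α V) := fun V => (i.hom.c.app (op V)).2
  -- `Spf B` has only one point, so the neighbourhood on which an immersion is a quotient map is all
  -- of `V`.
  have hαs : ∀ V, y ∈ V → Function.Surjective (α V) := fun V hV => by
    obtain ⟨U, hUV, hyU, hq⟩ := hi.exists_isOpenQuotientMap z V hV
    obtain rfl : U = V := le_antisymm hUV fun w _ => Subsingleton.elim y w ▸ hyU
    exact hq.surjective
  let g : ∀ U : Opens (Spf.top A), Spf.sections U →+* Z.sections (Hom.preimage i (Spf.mapOpen φ.2 U)) :=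
    fun U => (α (Spf.mapOpen φ.2 U)).comp (Spf.pullback φ.2 U)
  have hdisc : ∀ U : Opens (Spf.top A), x ∈ U →
      DiscreteTopology (Z.sections (Hom.preimage i (Spf.mapOpen φ.2 U))) := fun U hU =>
    hZ.discreteTopology_sections z hU
  have htop : ∀ U : Opens (Spf.top A), x ∈ U → ∀ K, Spf.openOf U (Spf.comapIdeal φ.2 K) = ⊤ :=
    fun U hU K => eq_top_iff.mpr fun q _ => by
      change Spf.ofSpec _ q ∈ U
      rw [hpt K _ y (Spf.le_ofSpec _ q)]
      exact hU
  have htopB : ∀ U : Opens (Spf.top A), x ∈ U → ∀ K, Spf.openOf (Spf.mapOpen φ.2 U) K = ⊤ :=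
    fun U hU K => eq_top_iff.mpr fun q _ => by
      change Spf.ofSpec K q ∈ Spf.mapOpen φ.2 U
      rw [Subsingleton.elim (Spf.ofSpec K q) y]
      exact hU
  -- The sections of `Z` are discrete, so the continuous map `α` kills all sections vanishing at
  -- some open ideal.
  have hK : ∀ U : Opens (Spf.top A), x ∈ U → ∃ K : OpenIdeal B,
      ∀ t, t.1 K = 0 → α (Spf.mapOpen φ.2 U) t = 0 := fun U hU => by
    have := hdisc U hU
    refine Spf.exists_openIdeal_of_mem_nhds (N := {t | α (Spf.mapOpen φ.2 U) t = 0}) ?_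
    exact ((isOpen_discrete {0}).preimage (hα _)).mem_nhds (map_zero _)
  -- The ideal that cuts `Z` out of `Spf A`. It will be open since it contains the contraction of an
  -- open ideal of `B`.
  let I : Ideal A := RingHom.ker ((g ⊤).comp (Spf.ofRing ⊤))
  have hgI : ∀ U : Opens (Spf.top A), x ∈ U → ∀ a, g U (Spf.ofRing U a) = 0 ↔ a ∈ I :=
    fun U hU a => by
      have hle : Hom.preimage i (Spf.mapOpen φ.2 U) ≤ Hom.preimage i (Spf.mapOpen φ.2 ⊤) :=
        fun _ _ => trivial
      have h1 : g U (Spf.ofRing U a) = Z.res hle (g ⊤ (Spf.ofRing ⊤ a)) :=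
        app_res i (U := Spf.mapOpen φ.2 ⊤) (V := Spf.mapOpen φ.2 U) (fun _ _ => trivial)
          (Spf.pullback φ.2 ⊤ (Spf.ofRing ⊤ a))
      rw [h1, res_eq_zero_iff hle fun w _ => Subsingleton.elim z w ▸ hU]
      rfl
  have hKI : ∀ U : Opens (Spf.top A), x ∈ U → ∀ K : OpenIdeal B,
      (∀ t, t.1 K = 0 → α (Spf.mapOpen φ.2 U) t = 0) → (Spf.comapIdeal φ.2 K).1 ≤ I :=
    fun U hU K hK a ha => by
      rw [← hgI U hU]
      refine hK _ ?_
      rw [Spf.pullback_ofRing]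
      exact (Spf.ofRing_component_eq_zero_iff (htopB U hU K) _).mpr ha
  obtain ⟨K₀, hK₀⟩ := hK ⊤ trivial
  have hI : IsOpen (I : Set A) :=
    Ideal.isOpen_of_le (hKI ⊤ trivial K₀ hK₀) (Spf.comapIdeal φ.2 K₀).2
  have hIx : ∀ p : SpfPoint A, I ≤ p.1.asIdeal → p = x := fun p hp =>
    hpt K₀ p y ((hKI ⊤ trivial K₀ hK₀).trans hp)
  -- `I` is proper because `Z` is nonempty; a maximal ideal above it is an open prime, which by
  -- `hIx` is `x`.
  have hxI : I ≤ x.1.asIdeal := by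
    have hne : I ≠ ⊤ := fun h => by
      have h1 : (1 : A) ∈ I := h ▸ trivial
      have := nontrivial_sections (X := Z)
        (U := Hom.preimage i (Spf.mapOpen φ.2 ⊤)) (x := z) trivial
      refine one_ne_zero (α := Z.sections (Hom.preimage i (Spf.mapOpen φ.2 ⊤))) ?_
      rw [← map_one (g ⊤), ← map_one (Spf.ofRing ⊤)]
      exact h1
    obtain ⟨M, hM, hIM⟩ := I.exists_le_maximal hne
    have h1 := hIx ⟨⟨M, hM.isPrime⟩, Ideal.isOpen_of_le hIM hI⟩ hIM
    exact hIM.trans (congrArg (fun p : SpfPoint A => p.1.asIdeal) h1).le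
  -- Modulo the contraction of `K` the section `s` comes from an element `a` of `A`, and both
  -- conditions become `a ∈ I`.
  have hker : ∀ U : Opens (Spf.top A), x ∈ U → ∀ s, g U s = 0 ↔ s ∈ triangle I U :=
    fun U hU s => by
      obtain ⟨K, hK⟩ := hK U hU
      obtain ⟨a, ha⟩ := Spf.exists_ofRing_component_eq (htop U hU K) s
      have h1 : g U s = g U (Spf.ofRing U a) := by
        rw [← sub_eq_zero, ← map_sub]
        refine hK _ ?_
        rw [Spf.pullback_component]
        have h2 : (s - Spf.ofRing U a).1 (Spf.comapIdeal φ.2 K) = 0 := sub_eq_zero.mpr ha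
        rw [h2, map_zero]
      have htopI : Spf.openOf U ⟨I, hI⟩ = ⊤ := eq_top_iff.mpr fun q _ => by
        change Spf.ofSpec _ q ∈ U
        rw [hIx _ (Spf.le_ofSpec ⟨I, hI⟩ q)]
        exact hU
      have h2 : s.1 ⟨I, hI⟩ = 0 ↔ a ∈ I := by
        rw [Spf.component_eq (K := ⟨I, hI⟩) (hKI U hU K hK) ha]
        exact Spf.ofRing_component_eq_zero_iff htopI a
      rw [h1, hgI U hU, ← h2]
      exact ⟨fun h L hL => Spf.component_eq_zero hL h, fun h => h _ le_rfl⟩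
  -- A section of `Z` lifts to `Spf B`, agrees at `K` with an element of `B`, and by density with
  -- one of `A`.
  have hsurj : ∀ U : Opens (Spf.top A), x ∈ U → Function.Surjective (g U) := fun U hU t => by
    obtain ⟨K, hK⟩ := hK U hU
    obtain ⟨t, rfl⟩ := hαs (Spf.mapOpen φ.2 U) hU t
    obtain ⟨b, hb⟩ := Spf.exists_ofRing_component_eq (htopB U hU K) t
    obtain ⟨a, ha⟩ := hdense K b
    refine ⟨Spf.ofRing U a, ?_⟩
    change α _ (Spf.pullback φ.2 U (Spf.ofRing U a)) = _
    rw [Spf.pullback_ofRing, eq_comm, ← sub_eq_zero, ← map_sub]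
    refine hK _ ?_
    have h1 : (Spf.ofRing (Spf.mapOpen φ.2 U) (b - φ.1 a)).1 K = 0 :=
      (Spf.ofRing_component_eq_zero_iff (htopB U hU K) _).mpr ha
    rw [map_sub] at h1
    rw [← h1]
    exact congrArg (· - (Spf.ofRing (Spf.mapOpen φ.2 U) (φ.1 a)).1 K) hb
  have hbot : ∀ U : Opens (Spf.top A), x ∉ U →
      Subsingleton (Z.sections (Hom.preimage i (Spf.mapOpen φ.2 U))) := fun U hU => by
    refine subsingleton_sections (eq_bot_iff.mpr fun w hw => hU ?_)
    rw [← hbase w]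
    exact hw
  refine ⟨Spf.triangleSheaf A hA I, Spf.isClosed_triangleSheaf A hA I ?_, ?_, ?_, ?_, ?_⟩
  · exact AddSubgroup.isClosed_of_isOpen (Submodule.toAddSubgroup I) hI
  · exact Topology.IsEmbedding.of_subsingleton _
  · ext p
    refine Iff.trans ?_ (Spf.mem_support_triangleSheaf hI p).symm
    constructor
    · rintro ⟨w, rfl⟩
      rw [hbase w]
      exact hxI
    · intro hp
      exact ⟨z, (hbase z).trans (hIx p hp).symm⟩
  · intro U
    ext s
    by_cases hU : x ∈ U
    · exact hker U hU s
    · refine ⟨fun _ L hL => ?_, fun _ => (hbot U hU).elim _ _⟩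
      have := SpecSections.subsingleton (U := Spf.openOf U L) fun q hq => hU (by
        rw [← hIx _ (hL.trans (Spf.le_ofSpec L q))]
        exact hq)
      exact Subsingleton.elim _ _
  · refine ⟨Set.univ, ?_, fun U _ => ?_⟩
    · exact Opens.isBasis_iff_nbhd.mpr fun {U x} hx => ⟨U, trivial, hx, le_rfl⟩
    · by_cases hU : x ∈ U
      · have := hdisc U hU
        exact ⟨hsurj U hU, (hα _).comp (Spf.continuous_pullback φ.2 U), fun S _ =>
          isOpen_discrete (α := Z.sections (Hom.preimage i (Spf.mapOpen φ.2 U))) _⟩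
      · have := hbot U hU
        exact ⟨fun y => ⟨0, this.elim _ _⟩, (hα _).comp (Spf.continuous_pullback φ.2 U), fun S _ =>
          isOpen_discrete (α := Z.sections (Hom.preimage i (Spf.mapOpen φ.2 U))) _⟩

/-- If all pseudo-immersions into a Noetherian formal scheme are immersions, then its underlying
space is discrete. -/
theorem discreteTopology_of_isImmersion (hX : X.IsNoetherian)
    (H : ∀ (Y : FormalScheme.{u}) (f : Y ⟶ X), IsPseudoImmersion f → IsImmersion f) :
    DiscreteTopology X.carrier := by
  refine discreteTopology_iff_isOpen_singleton.mpr fun x₀ => ?_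
  obtain ⟨c, ⟨p, rfl⟩, hN, I, hI⟩ := hX.exists_chart x₀
  -- The completion is taken at a closed specialization `x` of `p`. Once `{x}` is known to be open,
  -- `p ⤳ x` forces `p = x`.
  obtain ⟨m, hm, hpm⟩ := p.1.asIdeal.exists_le_maximal p.1.isPrime.ne_top
  let x : SpfPoint c.ring := ⟨⟨m, hm.isPrime⟩, Ideal.isOpen_of_le hpm p.2⟩
  have hIpt : ∀ q : SpfPoint c.ring, I ≤ q.1.asIdeal := fun q => by
    obtain ⟨n, -, hn⟩ := hI.hasBasis_nhds_zero.mem_iff.mp (q.2.mem_nhds q.1.asIdeal.zero_mem)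
    exact q.1.isPrime.le_of_pow_le hn
  have hIo : ∀ n, IsOpen ((I ^ n : Ideal c.ring) : Set c.ring) := (isAdic_iff.mp hI).1
  have hφ : Continuous (AdicLimit.of m) := AdicLimit.continuous_of fun n =>
    Ideal.isOpen_of_le (Ideal.pow_right_mono (hIpt x) n) (hIo n)
  have hBs : Subsingleton (SpfPoint (AdicLimit m)) := AdicLimit.subsingleton_spfPoint
  let B : TopCommRingCat.{u} := TopCommRingCat.of (AdicLimit m)
  let φ : c.ring ⟶ B := ⟨AdicLimit.of m, hφ⟩
  have hmap : ∀ q : SpfPoint B, Spf.mapPoint φ.2 q = x := fun q =>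
    Subtype.ext (PrimeSpectrum.ext (AdicLimit.comap_of_eq q.2))
  have hB : IsAdmissibleRing B := AdicLimit.isAdmissibleRing
  let f : Spf.formalScheme B hB ⟶ X := Spf.mapHom c.isAdmissible hB φ ≫ chartHom c
  have hpseudo : IsPseudoImmersion f := fun Z i hZ hi => by
    rw [← Category.assoc]
    refine IsClosedImmersion.isImmersion_comp_chartHom c ?_
    refine isClosedImmersion_comp_mapHom_of φ (fun K b => AdicLimit.exists_sub_of_mem K.2 b)
      (fun K p q hKp => ?_) hZ i hi
    rw [hmap q]
    obtain ⟨n, hn⟩ := AdicLimit.exists_pow_le_comap K.2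
    exact Subtype.ext (PrimeSpectrum.ext (hm.eq_of_le p.1.isPrime.ne_top
      (p.1.isPrime.le_of_pow_le (hn.trans hKp))).symm)
  obtain ⟨q⟩ : Nonempty (SpfPoint B) := AdicLimit.nonempty_spfPoint (m := m)
  obtain ⟨U, hU, hxU, hq⟩ := (H _ f hpseudo).exists_isOpenQuotientMap q c.range ⟨_, rfl⟩
  have hopen : IsOpenMap (Spf.pullback hφ ((Opens.map c.map.base).obj U)) := by
    have h1 := c.isHomeomorph_app hU
    exact IsOpenMap.of_comp_of_surjective hq.isOpenMap h1.continuous h1.surjective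
  obtain ⟨n, hn⟩ := Spf.exists_pow_le_of_isOpenMap_pullback (I := I) (by simpa using hIo 1) hφ
    (fun q' => show _ from Subsingleton.elim q q' ▸ hxU) hopen
  have hx : IsOpen {x} := Spf.isOpen_singleton_of_pow_le x hIpt hm hn
  have hpx : p ⤳ x := Topology.IsInducing.subtypeVal.specializes_iff.mp
    ((PrimeSpectrum.le_iff_specializes p.1 x.1).mp hpm)
  have hp : IsOpen {p} := by
    rwa [show p = x from hpx.mem_open hx rfl]
  have h := c.isOpenImmersion.base_open.isOpenMap _ hp
  rwa [Set.image_singleton] at h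

end FormalScheme

/-! ### Chains of open ideals in complete rings with Artinian quotients -/

section Chevalley

variable {A : Type u} [CommRing A] {𝔞 I : ℕ → Ideal A}

/-- In a complete ring whose quotients by the members of a chain `𝔞` defining the topology are
Artinian, the topology defined by a chain of open ideals is the quotient topology. -/
theorem exists_le_sup_iInf (h𝔞 : Antitone 𝔞)
    (hart : ∀ k, IsArtinianRing (A ⧸ 𝔞 k))
    (hc : ∀ a : ℕ → A, (∀ n, a (n + 1) - a n ∈ 𝔞 n) → ∃ x, ∀ n, x - a n ∈ 𝔞 n)
    (hI : Antitone I) (hIo : ∀ n, ∃ k, 𝔞 k ≤ I n) (k : ℕ) : ∃ n, I n ≤ 𝔞 k ⊔ ⨅ n, I n := by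
  -- The descending chain of images of the `I n` stabilizes in the Artinian ring `A / 𝔞 k`.
  have hstab : ∀ k, ∃ n, ∀ m, n ≤ m → I n ⊔ 𝔞 k = I m ⊔ 𝔞 k := fun k => by
    have := hart k
    let F : ℕ →o (Ideal (A ⧸ 𝔞 k))ᵒᵈ :=
      ⟨fun n => OrderDual.toDual ((I n).map (Ideal.Quotient.mk (𝔞 k))),
        fun i j h => Ideal.map_mono (hI h)⟩
    obtain ⟨n, hn⟩ := IsArtinian.monotone_stabilizes F
    refine ⟨n, fun m hm => ?_⟩
    have h1 : (I n).map (Ideal.Quotient.mk (𝔞 k)) = (I m).map (Ideal.Quotient.mk (𝔞 k)) := hn m hm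
    have h2 := congrArg (Ideal.comap (Ideal.Quotient.mk (𝔞 k))) h1
    simpa only [Ideal.comap_map_of_surjective _ Ideal.Quotient.mk_surjective,
      ← RingHom.ker_eq_comap_bot, Ideal.mk_ker] using h2
  choose N hN using hstab
  -- `Q k` is the stable value, the intersection of all `I n + 𝔞 k`. The point of `hstep` is that `Q
  -- (k + 1)` surjects onto `Q k` modulo `𝔞 k`, so elements can be lifted step by step to a limit in
  -- every `I n`.
  let Q : ℕ → Ideal A := fun k => I (N k) ⊔ 𝔞 k
  have hQ : ∀ k n, Q k ≤ I n ⊔ 𝔞 k := fun k n => by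
    rcases le_total (N k) n with h | h
    · exact (hN k n h).le
    · exact sup_le_sup_right (hI h) _
  have hstep : ∀ k, ∀ a ∈ Q k, ∃ b ∈ Q (k + 1), b - a ∈ 𝔞 k := fun k a ha => by
    obtain ⟨b, hb, c, hc, rfl⟩ := Submodule.mem_sup.mp (hQ k (N (k + 1)) ha)
    exact ⟨b, Submodule.mem_sup_left hb, by simpa using hc⟩
  refine ⟨N k, fun a ha => ?_⟩
  let seq : ∀ n, {a : A // a ∈ Q (k + n)} := fun n => Nat.rec ⟨a, Submodule.mem_sup_left ha⟩
    (fun n b => ⟨(hstep (k + n) b.1 b.2).choose, (hstep (k + n) b.1 b.2).choose_spec.1⟩) n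
  have hseq : ∀ n, (seq (n + 1)).1 - (seq n).1 ∈ 𝔞 (k + n) := fun n =>
    (hstep (k + n) (seq n).1 (seq n).2).choose_spec.2
  obtain ⟨u, hu0, humem, hustep⟩ : ∃ u : ℕ → A, u 0 = a ∧ (∀ n, u n ∈ Q (k + n)) ∧
      ∀ n, u (n + 1) - u n ∈ 𝔞 (k + n) := ⟨fun n => (seq n).1, rfl, fun n => (seq n).2, hseq⟩
  -- The sequence `u` starts at level `k`, while completeness counts from level zero; truncated
  -- subtraction pads it with the constant `u 0`.
  obtain ⟨x, hx⟩ := hc (fun n => u (n - k)) fun n => by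
    rcases lt_or_ge n k with h | h
    · have h1 : n + 1 - k = 0 := by omega
      have h2 : n - k = 0 := by omega
      rw [h1, h2, sub_self]
      exact zero_mem _
    · have h1 : n + 1 - k = (n - k) + 1 := by omega
      have h2 := hustep (n - k)
      rw [show k + (n - k) = n by omega] at h2
      rwa [h1]
  replace hx : ∀ j, x - u j ∈ 𝔞 (k + j) := fun j => by
    have h := hx (k + j)
    rwa [Nat.add_sub_cancel_left] at h
  have hxI : x ∈ ⨅ n, I n := by
    refine (Ideal.mem_iInf).mpr fun n => ?_
    obtain ⟨j, hj⟩ := hIo n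
    have h1 : u j ∈ I n :=
      sup_le le_rfl ((h𝔞 (Nat.le_add_left j k)).trans hj) (hQ _ n (humem j))
    simpa using add_mem (hj (h𝔞 (Nat.le_add_left j k) (hx j))) h1
  have hxa : x - a ∈ 𝔞 k := hu0 ▸ hx 0
  have h2 : a = -(x - a) + x := by ring
  rw [h2]
  exact add_mem (Submodule.mem_sup_left (neg_mem hxa)) (Submodule.mem_sup_right hxI)

/-- A homomorphism with dense image from a complete ring as above to a separated ring whose
topology is given by a chain `𝔫` of ideals is surjective and open. -/
theorem surjective_and_exists_le_map {S : Type*} [CommRing S] {𝔫 : ℕ → Ideal S} (β : A →+* S)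
    (h𝔞 : Antitone 𝔞) (hart : ∀ k, IsArtinianRing (A ⧸ 𝔞 k))
    (hc : ∀ a : ℕ → A, (∀ n, a (n + 1) - a n ∈ 𝔞 n) → ∃ x, ∀ n, x - a n ∈ 𝔞 n)
    (h𝔫 : Antitone 𝔫) (hsep : ∀ t, (∀ n, t ∈ 𝔫 n) → t = 0)
    (hcont : ∀ n, ∃ k, 𝔞 k ≤ (𝔫 n).comap β) (hdense : ∀ t n, ∃ a, t - β a ∈ 𝔫 n) :
    Function.Surjective β ∧ ∀ k, ∃ n, ∀ t ∈ 𝔫 n, ∃ a ∈ 𝔞 k, β a = t := by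
  have hanti : Antitone fun n => (𝔫 n).comap β := fun i j h => Ideal.comap_mono (h𝔫 h)
  have hker : ∀ a ∈ ⨅ n, (𝔫 n).comap β, β a = 0 := fun a ha =>
    hsep _ fun n => (Ideal.mem_iInf.mp ha n : _)
  -- The contractions of the `𝔫 n` intersect in the kernel of `β`, because `S` is separated.
  -- Chevalley's theorem thus says that small values of `β` are already values at elements of `𝔞 k`.
  have hlift : ∀ k, ∃ n, ∀ a, β a ∈ 𝔫 n → ∃ b ∈ 𝔞 k, β b = β a := fun k => by
    obtain ⟨n, hn⟩ := exists_le_sup_iInf h𝔞 hart hc hanti hcont k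
    refine ⟨n, fun a ha => ?_⟩
    obtain ⟨b, hb, c, hc, rfl⟩ := Submodule.mem_sup.mp (hn (show a ∈ (𝔫 n).comap β from ha))
    exact ⟨b, hb, by rw [map_add, hker c hc, add_zero]⟩
  have hsurj : Function.Surjective β := fun t => by
    choose n₀ hn₀ using hlift
    -- The summand `k` makes the errors tend to zero, and the running maximum gives monotonicity and
    -- `n₀ k ≤ n k`.
    let n : ℕ → ℕ := fun k => k + (Finset.range (k + 1)).sup n₀
    have hn : ∀ k, n₀ k ≤ n k := fun k =>
      (Finset.le_sup (f := n₀) (by simp)).trans (Nat.le_add_left _ _)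
    have hnm : Monotone n := fun i j h => add_le_add h (Finset.sup_mono (by simpa using h))
    -- A better approximation `b` from density need not be close to `a`. Since `β (b - a)` is small,
    -- the difference can be replaced by some `c ∈ 𝔞 k` with the same value, and `a + c` is close to
    -- `a`.
    have hstep : ∀ k a, t - β a ∈ 𝔫 (n k) → ∃ b, t - β b ∈ 𝔫 (n (k + 1)) ∧ b - a ∈ 𝔞 k :=
      fun k a ha => by
        obtain ⟨b, hb⟩ := hdense t (n (k + 1))
        have h1 : β (b - a) ∈ 𝔫 (n₀ k) := by
          have h2 := sub_mem ha (h𝔫 (hnm (Nat.le_succ k)) hb)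
          rw [sub_sub_sub_cancel_left, ← map_sub] at h2
          exact h𝔫 (hn k) h2
        obtain ⟨c, hc, hcb⟩ := hn₀ k _ h1
        refine ⟨a + c, ?_, by simpa using hc⟩
        rw [map_add, hcb, ← map_add, add_sub_cancel]
        exact hb
    let seq : ∀ k, {a : A // t - β a ∈ 𝔫 (n k)} := fun k =>
      Nat.rec ⟨(hdense t (n 0)).choose, (hdense t (n 0)).choose_spec⟩
        (fun k b => ⟨(hstep k b.1 b.2).choose, (hstep k b.1 b.2).choose_spec.1⟩) k
    obtain ⟨x, hx⟩ := hc (fun k => (seq k).1) fun k =>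
      (hstep k (seq k).1 (seq k).2).choose_spec.2
    refine ⟨x, (sub_eq_zero.mp (hsep _ fun j => ?_)).symm⟩
    obtain ⟨k, hk⟩ := hcont j
    let l := max j k
    have h1 : t - β (seq l).1 ∈ 𝔫 j :=
      h𝔫 ((le_max_left j k).trans (Nat.le_add_right _ _)) (seq l).2
    have h2 : β (x - (seq l).1) ∈ 𝔫 j := hk (h𝔞 (le_max_right j k) (hx l))
    rw [map_sub] at h2
    simpa using sub_mem h1 h2
  refine ⟨hsurj, fun k => ?_⟩
  obtain ⟨n, hn⟩ := hlift k
  refine ⟨n, fun t ht => ?_⟩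
  obtain ⟨a, rfl⟩ := hsurj t
  exact hn a ht

end Chevalley

namespace FormalScheme

variable {X Y Z : FormalScheme.{u}}

/-! ### The ordinary closed subschemes of a chart -/

/-- The quotient of a topological ring by an open ideal. -/
abbrev quotientRing {B : TopCommRingCat.{u}} (J : OpenIdeal B) : TopCommRingCat.{u} :=
  TopCommRingCat.of (B ⧸ J.1)

theorem discreteTopology_quotientRing {B : TopCommRingCat.{u}} (J : OpenIdeal B) :
    DiscreteTopology (quotientRing J) :=
  Spf.discreteTopology_quotient J

theorem isAdmissibleRing_quotientRing {B : TopCommRingCat.{u}} (J : OpenIdeal B) :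
    IsAdmissibleRing (quotientRing J) :=
  have := discreteTopology_quotientRing J
  IsAdmissibleRing.of_discreteTopology _

/-- The quotient map by an open ideal. -/
def quotientHom {B : TopCommRingCat.{u}} (J : OpenIdeal B) : B ⟶ quotientRing J :=
  ⟨Ideal.Quotient.mk J.1, Spf.continuous_mk J⟩

/-- The immersion of the ordinary scheme given by an open ideal of the ring of a chart. -/
def quotientImmersion (c : AffineChart X.toPresheafedSpace) (J : OpenIdeal c.ring) :
    Spf.formalScheme (quotientRing J) (isAdmissibleRing_quotientRing J) ⟶ X :=
  Spf.mapHom c.isAdmissible (isAdmissibleRing_quotientRing J) (quotientHom J) ≫ chartHom c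

theorem isImmersion_quotientImmersion (c : AffineChart X.toPresheafedSpace)
    (J : OpenIdeal c.ring) : IsImmersion (quotientImmersion c J) :=
  have := discreteTopology_quotientRing J
  (Spf.isClosedImmersion_mapHom c.isAdmissible _ (quotientHom J)
    Ideal.Quotient.mk_surjective).isImmersion_comp_chartHom c

theorem isOrdinary_formalScheme {A : TopCommRingCat.{u}} (hA : IsAdmissibleRing A)
    [DiscreteTopology A] : (Spf.formalScheme A hA).IsOrdinary := fun x =>
  ⟨⟨A, hA, 𝟙 (Spf A), (inferInstance : PresheafedSpace.IsOpenImmersion (𝟙 (Spf A)))⟩, ⟨x, rfl⟩, ‹_›⟩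

theorem IsPseudoImmersion.isImmersion_quotientImmersion_comp {f : Y ⟶ X}
    (hf : IsPseudoImmersion f) (c : AffineChart Y.toPresheafedSpace) (J : OpenIdeal c.ring) :
    IsImmersion (quotientImmersion c J ≫ f) :=
  have := discreteTopology_quotientRing J
  hf _ _ (isOrdinary_formalScheme _) (isImmersion_quotientImmersion c J)

/-- For an ideal of definition `J` of a chart ring, the chart is homeomorphic to the spectrum of the
quotient by `J`, which is an ordinary scheme and hence is embedded in the discrete space `X`. -/
theorem IsPseudoImmersion.discreteTopology {f : Y ⟶ X} (hf : IsPseudoImmersion f)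
    [DiscreteTopology X.carrier] : DiscreteTopology Y.carrier := by
  refine discreteTopology_iff_isOpen_singleton.mpr fun y => ?_
  obtain ⟨c, p, rfl⟩ := Y.exists_chart y
  obtain ⟨J, hJ⟩ := c.isAdmissible.exists_idealOfDefinition
  let J' : OpenIdeal c.ring := ⟨J, hJ.isOpen⟩
  have hd := discreteTopology_quotientRing J'
  have h1 := (hf.isImmersion_quotientImmersion_comp c J').isEmbedding
  have h2 : DiscreteTopology (SpfPoint (quotientRing J')) :=
    @Topology.IsEmbedding.discreteTopology _ X.carrier _ _ _ ‹_› h1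
  have h3 : IsHomeomorph (Spf.mapPoint (quotientHom J').2) := by
    refine isHomeomorph_iff_isEmbedding_surjective.mpr
      ⟨Spf.isEmbedding_mapPoint _ Ideal.Quotient.mk_surjective, fun q => ?_⟩
    refine (Set.ext_iff.mp (Spf.range_mapPoint (quotientHom J').2
      Ideal.Quotient.mk_surjective) q).mpr ?_
    refine (show RingHom.ker (quotientHom J').1 = J from Ideal.mk_ker).le.trans (hJ.le q)
  obtain ⟨q, rfl⟩ := h3.surjective p
  have h4 := h3.isOpenMap {q} (isOpen_discrete _)
  rw [Set.image_singleton] at h4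
  have h5 := c.isOpenImmersion.base_open.isOpenMap _ h4
  exact (congrArg IsOpen Set.image_singleton).mp h5

/-! ### Discrete spaces of fields -/

section FieldScheme

/-- The product of the fields `κ t` for the points `t` of an open set. -/
def FieldSections {T : TopCat.{u}} (κ : T → Type u) (U : Opens T) : Type u := ∀ t : U, κ t.1

variable {T : TopCat.{u}} (κ : T → Type u) [∀ t, Field (κ t)]

instance (U : Opens T) : CommRing (FieldSections κ U) :=
  inferInstanceAs (CommRing (∀ t : U, κ t.1))

instance (U : Opens T) : TopologicalSpace (FieldSections κ U) :=
  ⨅ t : U, TopologicalSpace.induced (fun s : FieldSections κ U => s t) ⊥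

instance (U : Opens T) : IsTopologicalRing (FieldSections κ U) :=
  let : ∀ t : U, TopologicalSpace (κ t.1) := fun _ => ⊥
  have : ∀ t : U, DiscreteTopology (κ t.1) := fun _ => ⟨rfl⟩
  inferInstanceAs (IsTopologicalRing (∀ t : U, κ t.1))

variable {κ} in
theorem continuous_fieldSections_iff {S : Type*} [TopologicalSpace S] {U : Opens T}
    {g : S → FieldSections κ U} :
    Continuous g ↔ ∀ t : U, @Continuous _ _ _ ⊥ fun x => g x t := by
  refine continuous_iInf_rng.trans (forall_congr' fun t => continuous_induced_rng)

variable {κ} in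
theorem continuous_fieldSections_apply {U : Opens T} (t : U) :
    @Continuous _ _ _ ⊥ fun s : FieldSections κ U => s t :=
  continuous_fieldSections_iff.mp continuous_id t

/-- The sheaf of products of the fields `κ t`. -/
def fieldPresheaf : T.Presheaf TopCommRingCat.{u} where
  obj U := TopCommRingCat.of (FieldSections κ U.unop)
  map {U V} i := ⟨RingHom.pi fun t : V.unop =>
      Pi.evalRingHom (fun t : U.unop => κ t.1) ⟨t.1, i.unop.le t.2⟩,
    continuous_fieldSections_iff.mpr fun _ => continuous_fieldSections_apply _⟩
  map_id _ := rfl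
  map_comp _ _ := rfl

theorem isSheaf_fieldPresheaf : (fieldPresheaf κ).IsSheaf := by
  refine TopCommRingCat.isSheaf_of_existsUnique_gluing _ (fun ι U s hs => ?_) fun ι U => ?_
  · have hs' : ∀ i j (t : T) (hi : t ∈ U i) (hj : t ∈ U j),
        (s i : FieldSections κ (U i)) ⟨t, hi⟩ = (s j : FieldSections κ (U j)) ⟨t, hj⟩ :=
      fun i j t hi hj => congrFun (hs i j) ⟨t, hi, hj⟩
    choose k hk using fun t : (iSup U : Opens T) => Opens.mem_iSup.mp t.2
    refine ⟨fun t => (s (k t) : FieldSections κ (U (k t))) ⟨t.1, hk t⟩, fun i => ?_,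
      fun t' ht' => ?_⟩
    · exact funext fun t => hs' _ _ _ _ _
    · exact funext fun t => congrFun (ht' (k t)) ⟨t.1, hk t⟩
  · refine le_iInf fun t => ?_
    obtain ⟨i, hi⟩ := Opens.mem_iSup.mp t.2
    refine (iInf_le _ i).trans ?_
    refine continuous_iff_le_induced.mp ?_
    have h := @continuous_induced_dom _ _ ((fieldPresheaf κ).map (Opens.leSupr U i).op).1
      (inferInstanceAs (TopologicalSpace (FieldSections κ (U i))))
    exact @Continuous.comp _ _ _ (_) _ (_) _ _ (continuous_fieldSections_apply ⟨t.1, hi⟩) h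

/-- The topologically ringed space of a family of fields. -/
def fieldSpace : PresheafedSpace TopCommRingCat.{u} := ⟨T, fieldPresheaf κ⟩

/-- The field `κ t` as a discrete ring. -/
def fieldRing (t : T) : TopCommRingCat.{u} :=
  let : TopologicalSpace (κ t) := ⊥
  have : DiscreteTopology (κ t) := ⟨rfl⟩
  TopCommRingCat.of (κ t)

instance (t : T) : DiscreteTopology (fieldRing κ t) := ⟨rfl⟩

theorem isAdmissibleRing_fieldRing (t : T) : IsAdmissibleRing (fieldRing κ t) :=
  IsAdmissibleRing.of_discreteTopology _

instance (t : T) : Unique (SpfPoint (fieldRing κ t)) where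
  default := ⟨(⊥ : PrimeSpectrum (κ t)), isOpen_discrete _⟩
  uniq _ := Subtype.ext (Subsingleton.elim (α := PrimeSpectrum (κ t)) _ _)

open Classical in
/-- The map on sections of the inclusion of a point. -/
def fieldChartApp (t : T) (U : Opens T) (V : Opens (Spf.top (fieldRing κ t)))
    (hV : t ∉ U → V = ⊥) : FieldSections κ U →+* Spf.sections V :=
  -- When `t ∉ U` the target consists of sections over the empty set and is the zero ring, so the
  -- zero map is a ring homomorphism.
  if h : t ∈ U then
    (Spf.ofRing V).comp (Pi.evalRingHom (fun t : U => κ t.1) ⟨t, h⟩)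
  else
    have : Subsingleton (Spf.sections V) :=
      (Spf.formalScheme _ (isAdmissibleRing_fieldRing κ t)).subsingleton_sections (hV h)
    { toFun _ := 0
      map_one' := Subsingleton.elim _ _
      map_mul' _ _ := Subsingleton.elim _ _
      map_zero' := Subsingleton.elim _ _
      map_add' _ _ := Subsingleton.elim _ _ }

theorem fieldChartApp_apply {t : T} {U : Opens T} {V : Opens (Spf.top (fieldRing κ t))}
    (hV : t ∉ U → V = ⊥) (h : t ∈ U) (s : FieldSections κ U) :
    fieldChartApp κ t U V hV s = Spf.ofRing (A := fieldRing κ t) V (s ⟨t, h⟩) := by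
  rw [fieldChartApp, dif_pos h]
  rfl

theorem continuous_fieldChartApp {t : T} {U : Opens T} {V : Opens (Spf.top (fieldRing κ t))}
    (hV : t ∉ U → V = ⊥) : Continuous (fieldChartApp κ t U V hV) := by
  by_cases h : t ∈ U
  · rw [funext (fieldChartApp_apply κ hV h)]
    exact Spf.continuous_ofRing.comp (continuous_fieldSections_apply (κ := κ) ⟨t, h⟩)
  · have : Subsingleton (Spf.sections V) :=
      (Spf.formalScheme _ (isAdmissibleRing_fieldRing κ t)).subsingleton_sections (hV h)
    exact continuous_of_const fun _ _ => Subsingleton.elim _ _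

/-- The inclusion of a point. -/
def fieldChartMap (t : T) : Spf (fieldRing κ t) ⟶ fieldSpace κ where
  base := TopCat.ofHom ⟨fun _ => t, continuous_const⟩
  c :=
    { app U := ⟨fieldChartApp κ t U.unop _ fun h => eq_bot_iff.mpr fun _ hp => h hp,
        continuous_fieldChartApp κ _⟩
      naturality U V i := by
        refine Subtype.ext (RingHom.ext fun s => ?_)
        by_cases h : t ∈ V.unop
        · refine (fieldChartApp_apply κ (fun h' => (h' h).elim) h _).trans ?_
          exact (congrArg (Spf.res (A := fieldRing κ t)
            (show (Opens.map (TopCat.ofHom ⟨fun _ => t, continuous_const⟩)).obj V.unop ≤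
              (Opens.map (TopCat.ofHom ⟨fun _ => t, continuous_const⟩)).obj U.unop from
              fun _ hp => i.unop.le hp)) (fieldChartApp_apply κ
            (fun h' => (h' (i.unop.le h)).elim) (i.unop.le h) s)).symm
        · exact ((Spf.formalScheme _ (isAdmissibleRing_fieldRing κ t)).subsingleton_sections
            (eq_bot_iff.mpr fun _ hp => h hp)).elim _ _ }

theorem fieldChartApp_bijective {t : T} {U : Opens T} {V : Opens (Spf.top (fieldRing κ t))}
    (hV : t ∉ U → V = ⊥) (hU : ∀ t' ∈ U, t' = t) (hUV : t ∈ U → V = ⊤) :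
    Function.Bijective (fieldChartApp κ t U V hV) := by
  let J : OpenIdeal (fieldRing κ t) := ⟨⊥, isOpen_discrete _⟩
  have hJ : t ∈ U → Spf.openOf V J = ⊤ := fun h => by
    rw [hUV h]
    rfl
  constructor
  · refine (injective_iff_map_eq_zero _).mpr fun s hs => funext fun ⟨t', h⟩ => ?_
    obtain rfl := hU t' h
    rw [fieldChartApp_apply κ hV h] at hs
    have h1 := (Spf.ofRing_component_eq_zero_iff (hJ h) (s ⟨t', h⟩)).mp (by rw [hs]; rfl)
    exact h1
  · intro σ
    by_cases h : t ∈ U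
    · obtain ⟨a, ha⟩ := Spf.exists_ofRing_component_eq (hJ h) σ
      let a' : κ t := a
      refine ⟨fun t' => (hU t'.1 t'.2).symm ▸ a', ?_⟩
      exact (fieldChartApp_apply κ hV h _).trans (Spf.sections_ext_bot ha.symm)
    · have : Subsingleton (Spf.sections V) :=
        (Spf.formalScheme _ (isAdmissibleRing_fieldRing κ t)).subsingleton_sections (hV h)
      exact ⟨0, Subsingleton.elim _ _⟩

theorem isHomeomorph_fieldChartApp {t : T} {U : Opens T} {V : Opens (Spf.top (fieldRing κ t))}
    (hV : t ∉ U → V = ⊥) (hU : ∀ t' ∈ U, t' = t) (hUV : t ∈ U → V = ⊤) :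
    IsHomeomorph (fieldChartApp κ t U V hV) := by
  let J : OpenIdeal (fieldRing κ t) := ⟨⊥, isOpen_discrete _⟩
  have hs : Subsingleton (PrimeSpectrum (fieldRing κ t ⧸ J.1)) :=
    (Spf.ofSpec_injective J).subsingleton
  have hd : DiscreteTopology (Spf.sections V) :=
    Spf.discreteTopology_sections (Set.Subsingleton.isCompact fun p _ q _ => hs.elim p q)
  exact ⟨continuous_fieldChartApp κ hV, fun _ _ => isOpen_discrete _,
    fieldChartApp_bijective κ hV hU hUV⟩

theorem _root_.TopCommRingCat.isIso_of_isHomeomorph {R S : TopCommRingCat.{u}} (f : R ⟶ S)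
    (hf : IsHomeomorph f.1) : IsIso f := by
  have : IsIso ((forget₂ TopCommRingCat.{u} TopCat.{u}).map f) :=
    (TopCat.isIso_iff_isHomeomorph _).mpr hf
  exact isIso_of_reflects_iso f (forget₂ TopCommRingCat.{u} TopCat.{u})

theorem isOpenImmersion_fieldChartMap [DiscreteTopology T] (t : T) :
    PresheafedSpace.IsOpenImmersion (fieldChartMap κ t) := by
  have hop : Topology.IsOpenEmbedding (fieldChartMap κ t).base := by
    refine .of_continuous_injective_isOpenMap (ContinuousMap.continuous _)
      (fun p q _ => Subsingleton.elim (α := SpfPoint (fieldRing κ t)) _ _)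
      fun _ _ => isOpen_discrete (α := T) _
  refine ⟨hop, fun U => TopCommRingCat.isIso_of_isHomeomorph _ ?_⟩
  refine isHomeomorph_fieldChartApp κ (fun h => eq_bot_iff.mpr fun _ hp => h hp) ?_ ?_
  · rintro _ ⟨_, _, rfl⟩
    rfl
  · exact fun h => eq_top_iff.mpr fun _ _ => h

/-- The chart given by a point. -/
def fieldChart [DiscreteTopology T] (t : T) : AffineChart (fieldSpace κ) :=
  ⟨fieldRing κ t, isAdmissibleRing_fieldRing κ t, fieldChartMap κ t,
    isOpenImmersion_fieldChartMap κ t⟩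

/-- The ordinary scheme given by a family of fields on a discrete space. -/
def fieldScheme [DiscreteTopology T] : FormalScheme.{u} where
  toPresheafedSpace := fieldSpace κ
  isSheaf := isSheaf_fieldPresheaf κ
  exists_chart (t : T) := ⟨fieldChart κ t, (default : SpfPoint (fieldRing κ t)), rfl⟩

theorem isOrdinary_fieldScheme [DiscreteTopology T] : (fieldScheme κ).IsOrdinary := fun (t : T) =>
  ⟨fieldChart κ t, ⟨(default : SpfPoint (fieldRing κ t)), rfl⟩,
    inferInstanceAs (DiscreteTopology (fieldRing κ t))⟩

end FieldScheme

end FormalScheme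

theorem Spf.not_isUnitAt_of_component_eq_zero {A : Type u} [CommRing A] [TopologicalSpace A]
    [IsTopologicalRing A] {U : Opens (Spf.top A)} {s : Spf.sections U} {J : OpenIdeal A}
    (hs : s.1 J = 0) {p : SpfPoint A} (hp : p ∈ U) (h : J.1 ≤ p.1.asIdeal) :
    ¬ Spf.IsUnitAt s p hp := by
  obtain ⟨q, rfl⟩ := Spf.exists_ofSpec_eq h
  rw [Spf.isUnitAt_iff, hs, map_zero]
  exact not_isUnit_zero

theorem Spf.isCompact_openOf_of_subsingleton {A : Type u} [CommRing A] [TopologicalSpace A]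
    [IsTopologicalRing A] {V : Opens (Spf.top A)} (hV : (V : Set (SpfPoint A)).Subsingleton)
    (J : OpenIdeal A) : IsCompact (Spf.openOf V J : Set (PrimeSpectrum.Top (A ⧸ J.1))) :=
  Set.Subsingleton.isCompact fun _ hp _ hq => Spf.ofSpec_injective J (hV hp hq)

/-! ### Points and sections in a chart -/

namespace AffineChart

variable {X : FormalScheme.{u}} (c : AffineChart X.toPresheafedSpace)

/-- The point of a formal scheme given by a point of a chart. -/
def point (p : SpfPoint c.ring) : X.carrier := c.map.base p

/-- The inverse image of an open subset in a chart. -/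
def preimage (U : Opens X.carrier) : Opens (Spf.top c.ring) := (Opens.map c.map.base).obj U

/-- The pullback of sections to a chart. -/
def pull (U : Opens X.carrier) : X.sections U →+* Spf.sections (c.preimage U) :=
  (c.map.c.app (op U)).1

theorem point_injective : Function.Injective c.point := c.isOpenImmersion.base_open.injective

theorem point_mem_range (p : SpfPoint c.ring) : c.point p ∈ c.range := ⟨p, rfl⟩

theorem continuous_pull (U : Opens X.carrier) : Continuous (c.pull U) := (c.map.c.app (op U)).2

theorem isHomeomorph_pull {U : Opens X.carrier} (hU : U ≤ c.range) : IsHomeomorph (c.pull U) :=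
  c.isHomeomorph_app hU

theorem pull_res {U V : Opens X.carrier} (h : V ≤ U) (s : X.sections U) :
    c.pull V (X.res h s) =
      Spf.res (show c.preimage V ≤ c.preimage U from fun _ hx => h hx) (c.pull U s) :=
  FormalScheme.app_res (FormalScheme.chartHom c) h s

theorem isUnit_pull_iff {U : Opens X.carrier} (hU : U ≤ c.range) (s : X.sections U) :
    IsUnit (c.pull U s) ↔ IsUnit s :=
  MulEquiv.isUnit_map (RingEquiv.ofBijective (c.pull U) (c.isHomeomorph_pull hU).bijective)

end AffineChart

namespace FormalScheme

variable {X Y : FormalScheme.{u}}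

theorem exists_point_eq (x : X.carrier) :
    ∃ (c : AffineChart X.toPresheafedSpace) (p : SpfPoint c.ring), c.point p = x :=
  X.exists_chart x

/-! ### Formal schemes with discrete underlying space -/

section Discrete

variable [DiscreteTopology X.carrier] [DiscreteTopology Y.carrier]

/-- A point of a discrete formal scheme as an open subset. -/
def pt (x : X.carrier) : Opens X.carrier := ⟨{x}, isOpen_discrete _⟩

theorem mem_pt (x : X.carrier) : x ∈ pt x := rfl

theorem eq_of_mem_pt {x y : X.carrier} (h : y ∈ pt x) : y = x := h

theorem pt_le {x : X.carrier} {U : Opens X.carrier} (h : x ∈ U) : pt x ≤ U := by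
  rintro _ rfl
  exact h

theorem isBasis_pt : Opens.IsBasis (Set.range (pt (X := X))) :=
  Opens.isBasis_iff_nbhd.mpr fun {_ x} hx => ⟨pt x, ⟨x, rfl⟩, mem_pt x, pt_le hx⟩

theorem isUnit_res_pt_iff (c : AffineChart X.toPresheafedSpace) (p : SpfPoint c.ring)
    {U : Opens X.carrier} (h : c.point p ∈ U) (s : X.sections U) :
    IsUnit (X.res (pt_le h) s) ↔ Spf.IsUnitAt (c.pull U s) p h := by
  rw [← c.isUnit_pull_iff (pt_le (c.point_mem_range p)), c.pull_res, Spf.isUnit_iff]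
  refine ⟨fun H => H p (mem_pt _), fun H q hq => ?_⟩
  obtain rfl := c.point_injective (eq_of_mem_pt hq)
  exact H

theorem isUnit_pt_iff (c : AffineChart X.toPresheafedSpace) (p : SpfPoint c.ring)
    (s : X.sections (pt (c.point p))) :
    IsUnit s ↔ Spf.IsUnitAt (c.pull _ s) p (mem_pt (c.point p)) := by
  rw [← isUnit_res_pt_iff, res_self]

/-- Over an open point, sections are the stalk; locality is the corresponding property of values in
the chart. -/
instance isLocalRing_sections_pt (x : X.carrier) : IsLocalRing (X.sections (pt x)) := by
  have := nontrivial_sections (mem_pt x)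
  refine IsLocalRing.of_isUnit_or_isUnit_one_sub_self fun s => ?_
  obtain ⟨c, p, rfl⟩ := exists_point_eq x
  rw [isUnit_pt_iff c p, isUnit_pt_iff c p, map_sub, map_one]
  exact or_iff_not_imp_left.mpr Spf.isUnitAt_one_sub

theorem subsingleton_preimage_pt (c : AffineChart X.toPresheafedSpace) (x : X.carrier) :
    (c.preimage (pt x) : Set (SpfPoint c.ring)).Subsingleton :=
  fun _ hp _ hq => c.point_injective ((eq_of_mem_pt hp).trans (eq_of_mem_pt hq).symm)

theorem isOpen_pull_component_eq_zero (c : AffineChart X.toPresheafedSpace) (x : X.carrier)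
    (J : OpenIdeal c.ring) : IsOpen {s : X.sections (pt x) | (c.pull (pt x) s).1 J = 0} :=
  (Spf.isOpen_component_eq_zero J (Spf.isCompact_openOf_of_subsingleton
    (subsingleton_preimage_pt c x) J)).preimage (c.continuous_pull (pt x))

/-- It contains the open set of sections whose component at the open prime of the point vanishes.
Hence the residue map is continuous for the discrete topology on the residue field. -/
theorem isOpen_maximalIdeal_pt (x : X.carrier) :
    IsOpen (IsLocalRing.maximalIdeal (X.sections (pt x)) : Set (X.sections (pt x))) := by
  obtain ⟨c, p, rfl⟩ := exists_point_eq x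
  refine AddSubgroup.isOpen_of_mem_nhds
    (IsLocalRing.maximalIdeal (X.sections (pt (c.point p)))).toAddSubgroup
    (g := 0) (Filter.mem_of_superset ((isOpen_pull_component_eq_zero c (c.point p)
      ⟨p.1.asIdeal, p.2⟩).mem_nhds ?_) fun s hs => ?_)
  · change (c.pull _ 0).1 _ = 0
    rw [map_zero]
    rfl
  · refine (IsLocalRing.mem_maximalIdeal s).mpr fun hu => ?_
    exact Spf.not_isUnitAt_of_component_eq_zero hs (mem_pt (c.point p)) le_rfl
      ((isUnit_pt_iff c p s).mp hu)

/-! ### The residue fields of a discrete formal scheme -/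

variable (Y) in
/-- The residue field of a point. -/
abbrev residueField (y : Y.carrier) : Type u := IsLocalRing.ResidueField (Y.sections (pt y))

/-- The value of a section in the residue field of a point. -/
def residue {U : Opens Y.carrier} {y : Y.carrier} (hy : y ∈ U) : Y.sections U →+* residueField Y y :=
  (IsLocalRing.residue (Y.sections (pt y))).comp (Y.res (pt_le hy))

theorem residue_res {U V : Opens Y.carrier} (h : V ≤ U) {y : Y.carrier} (hy : y ∈ V)
    (s : Y.sections U) : residue hy (Y.res h s) = residue (h hy) s :=
  congrArg (IsLocalRing.residue (Y.sections (pt y))) (res_res h (pt_le hy) s)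

theorem residue_eq_zero_iff {U : Opens Y.carrier} {y : Y.carrier} (hy : y ∈ U) (s : Y.sections U) :
    residue hy s = 0 ↔ ¬ IsUnit (Y.res (pt_le hy) s) :=
  (IsLocalRing.residue_eq_zero_iff _).trans (IsLocalRing.mem_maximalIdeal _)

theorem continuous_residue {U : Opens Y.carrier} {y : Y.carrier} (hy : y ∈ U) :
    @Continuous _ _ _ ⊥ (residue (Y := Y) hy) := by
  let : TopologicalSpace (residueField Y y) := ⊥
  refine Continuous.comp (g := IsLocalRing.residue (Y.sections (pt y))) ?_
    (Y.presheaf.map (homOfLE (pt_le hy)).op).2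
  exact continuous_of_isOpen_of_sub_mem (isOpen_maximalIdeal_pt y) fun a b h => Ideal.Quotient.eq.mpr h

variable (Y) in
/-- The family of residue fields of a discrete formal scheme as an ordinary scheme. -/
abbrev residueScheme : FormalScheme.{u} := fieldScheme (T := Y.carrier) (residueField Y)

/-- The map from the sections to the products of the residue fields. -/
def residueApp (U : Opens Y.carrier) : Y.sections U →+* FieldSections (residueField Y) U :=
  RingHom.pi fun y : U => residue y.2

theorem residueApp_eq_zero_iff {U : Opens Y.carrier} (s : Y.sections U) :
    residueApp U s = 0 ↔ ∀ (y : Y.carrier) (hy : y ∈ U), ¬ IsUnit (Y.res (pt_le hy) s) := by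
  refine funext_iff.trans ⟨fun h y hy => ?_, fun h y => ?_⟩
  · exact (residue_eq_zero_iff hy s).mp (h ⟨y, hy⟩)
  · exact (residue_eq_zero_iff y.2 s).mpr (h y.1 y.2)

theorem residueApp_pt_surjective (y : Y.carrier) : Function.Surjective (residueApp (pt y)) := by
  intro t
  obtain ⟨s, hs⟩ := IsLocalRing.residue_surjective (t ⟨y, mem_pt y⟩)
  refine ⟨s, funext fun ⟨z, hz⟩ => ?_⟩
  obtain rfl := eq_of_mem_pt hz
  exact (congrArg _ (res_self _ s)).trans hs

variable (Y) in
/-- The inclusion of the residue fields. -/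
def residueHom : residueScheme Y ⟶ Y where
  hom :=
    { base := 𝟙 Y.carrier
      c :=
        { app U := ⟨residueApp U.unop, continuous_fieldSections_iff.mpr fun y =>
            continuous_residue y.2⟩
          naturality U V i := Subtype.ext (RingHom.ext fun s => funext fun y =>
            residue_res i.unop.le y.2 s) } }
  isLocalHom y := by
    refine isLocalHom_stalkMap _ y fun U s V hV hy hu => ⟨pt y, pt_le (hV hy), mem_pt _, ?_⟩
    by_contra hs
    have h1 := (residue_eq_zero_iff (Y := Y) (U := U) (y := y) (hV hy) s).mpr hs
    have h2 := hu.map (Pi.evalRingHom (fun y : V => residueField Y y.1) ⟨y, hy⟩)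
    exact h2.ne_zero h1

/-! ### Kernel sheaves, and injectivity of pseudo-immersions -/

/-- The kernel of a morphism as an ideal sheaf. -/
def kerSheaf {X Y : FormalScheme.{u}} (f : Y ⟶ X) : IdealSheaf X where
  ideal U := RingHom.ker (Hom.app f U)
  res_mem {U V} h s hs := by
    rw [RingHom.mem_ker] at hs ⊢
    rw [app_res, hs, map_zero]
  mem_of_locally U s h := by
    refine eq_of_locally_eq fun y hy => ?_
    obtain ⟨V, hV, hyV, hs⟩ := h (f.hom.base y) hy
    refine ⟨Hom.preimage f V, fun _ hz => hV hz, hyV, ?_⟩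
    rw [map_zero]
    exact (app_res f hV s).symm.trans hs

variable (Y) in
-- The kernel consists of the sections that are invertible nowhere. On a chart it is `I^△` for the
-- intersection `I` of all open primes: `I` is open as it contains an ideal of definition, and over
-- the reduced ring modulo `I` a nowhere invertible section vanishes.
theorem isClosedImmersion_residueHom : IsClosedImmersion (residueHom Y) := by
  refine ⟨kerSheaf (residueHom Y), fun x => ?_, ?_, ?_, fun U => rfl, _, isBasis_pt, ?_⟩
  · obtain ⟨c, p, rfl⟩ := exists_point_eq x
    let I : Ideal c.ring := ⨅ p : SpfPoint c.ring, p.1.asIdeal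
    obtain ⟨J, hJ⟩ := c.isAdmissible.exists_idealOfDefinition
    have hI : IsOpen (I : Set c.ring) := Ideal.isOpen_of_le (le_iInf hJ.le) hJ.isOpen
    have hred : IsReduced (c.ring ⧸ I) := by
      refine (Ideal.isRadical_iff_quotient_reduced I).mp fun a ⟨n, ha⟩ => ?_
      exact Ideal.mem_iInf.mpr fun p => p.1.isPrime.mem_of_pow_mem n (Ideal.mem_iInf.mp ha p)
    refine ⟨c, c.point_mem_range p, I, ?_, fun U hU s => ?_⟩
    · exact AddSubgroup.isClosed_of_isOpen I.toAddSubgroup hI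
    · refine (residueApp_eq_zero_iff s).trans ⟨fun h K hK => ?_, fun h y hy => ?_⟩
      · refine Spf.component_eq_zero (J := ⟨I, hI⟩) (s := c.pull U s) hK ?_
        refine SpecSections.eq_zero_of_forall_not_isUnit_value fun q hq hu => ?_
        exact h _ hq ((isUnit_res_pt_iff c (Spf.ofSpec ⟨I, hI⟩ q) hq s).mpr
          ((Spf.isUnitAt_iff _ q hq).mpr hu))
      · obtain ⟨p, rfl⟩ := hU hy
        exact fun hu => Spf.not_isUnitAt_of_component_eq_zero (J := ⟨p.1.asIdeal, p.2⟩)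
          (h _ (iInf_le _ p)) hy le_rfl ((isUnit_res_pt_iff c p hy s).mp hu)
  · exact Topology.IsEmbedding.id
  · refine (Set.range_id).trans (Set.eq_univ_of_forall fun y U hy h => ?_).symm
    exact (residueApp_eq_zero_iff (1 : Y.sections U)).mp h y hy (by rw [map_one]; exact isUnit_one)
  · rintro _ ⟨y, rfl⟩
    have hd : DiscreteTopology (FieldSections (residueField Y) (pt y)) := by
      refine discreteTopology_iff_isOpen_singleton.mpr fun t => ?_
      have h1 := @IsOpen.preimage _ _ _ ⊥ _
        (continuous_fieldSections_apply (κ := residueField Y) (U := pt y) ⟨y, mem_pt y⟩)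
        {t ⟨y, mem_pt y⟩} trivial
      refine (congrArg IsOpen (Set.ext fun t' => ⟨fun h => ?_, fun h => ?_⟩)).mp h1
      · refine funext fun ⟨z, hz⟩ => ?_
        obtain rfl := eq_of_mem_pt hz
        exact h
      · exact congrFun h _
    exact ⟨residueApp_pt_surjective y, ((residueHom Y).hom.c.app (op (pt y))).2, fun S _ =>
      isOpen_discrete (α := FieldSections (residueField Y) (pt y)) _⟩

/-- The residue fields form a single ordinary test scheme with all the points of `Y`, so points in
different charts are separated as well. -/
theorem IsPseudoImmersion.injective {f : Y ⟶ X} (hf : IsPseudoImmersion f) :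
    Function.Injective f.hom.base :=
  (hf _ _ (isOrdinary_fieldScheme _) (isClosedImmersion_residueHom Y).isImmersion)
    |>.isEmbedding.injective

end Discrete

end FormalScheme

/-! ### Global sections of formal spectra, and closed ideals -/

namespace Spf

variable {A : Type u} [CommRing A] [TopologicalSpace A] [IsTopologicalRing A]

/-- The global sections of a formal spectrum come from the ring. -/
theorem ofRing_surjective (hA : IsAdmissibleRing A) {U : Opens (top A)}
    (hU : ∀ J : OpenIdeal A, openOf U J = ⊤) : Function.Surjective (ofRing U) := fun s => by
  obtain ⟨I, hI, hb⟩ := hA.exists_basis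
  have hIo : ∀ n, IsOpen (I n : Set A) := fun n => AddSubgroup.isOpen_of_mem_nhds
    (Submodule.toAddSubgroup (I n)) (hb.mem_of_mem trivial)
  choose a ha using fun n => exists_ofRing_component_eq (hU ⟨I n, hIo n⟩) s
  have hsub : ∀ (J : OpenIdeal A) (b c : A), b - c ∈ J.1 ↔ (ofRing U b).1 J = (ofRing U c).1 J :=
    fun J b c => by
      rw [← ofRing_component_eq_zero_iff (hU J), map_sub]
      exact sub_eq_zero
  obtain ⟨x, hx⟩ := exists_forall_sub_mem_of_completeSpace hA.complete hI hb a fun n => by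
    refine (hsub ⟨I n, hIo n⟩ _ _).mpr ((component_eq (J := ⟨I (n + 1), hIo (n + 1)⟩)
      (hI (Nat.le_succ n)) (ha (n + 1))).symm.trans (ha n))
  refine ⟨x, sections_ext fun J => ?_⟩
  obtain ⟨n, -, hn⟩ := hb.mem_iff.mp (J.2.mem_nhds J.1.zero_mem)
  exact component_eq (J := ⟨I n, hIo n⟩) hn (((hsub ⟨I n, hIo n⟩ _ _).mp (hx n)).trans (ha n).symm)

/-- The evaluation of sections at an open ideal. -/
def component (U : Opens (top A)) (J : OpenIdeal A) :
    sections U →+* SpecSections (A ⧸ J.1) (openOf U J) :=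
  (Pi.evalRingHom _ J).comp (sections U).subtype

end Spf

/-- A closed ideal in a ring whose topology is given by ideals is an intersection of open ideals. -/
theorem Ideal.mem_of_forall_isOpen {A : Type u} [CommRing A] [TopologicalSpace A]
    [IsTopologicalRing A] (hA : IsAdmissibleRing A) {I : Ideal A} (hI : IsClosed (I : Set A))
    {a : A} (h : ∀ K : OpenIdeal A, I ≤ K.1 → a ∈ K.1) : a ∈ I := by
  obtain ⟨𝔞, -, hb⟩ := hA.exists_basis
  refine (hI.closure_eq ▸ mem_closure_iff_nhds_zero.mpr fun N hN => ?_ : a ∈ (I : Set A))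
  obtain ⟨n, -, hn⟩ := hb.mem_iff.mp hN
  have ho : IsOpen (𝔞 n : Set A) := AddSubgroup.isOpen_of_mem_nhds
    (Submodule.toAddSubgroup (𝔞 n)) (hb.mem_of_mem trivial)
  obtain ⟨i, hi, b, hb, hab⟩ := Submodule.mem_sup.mp
    (h ⟨I ⊔ 𝔞 n, Ideal.isOpen_of_le le_sup_right ho⟩ le_sup_left)
  refine ⟨i, hi, hn ?_⟩
  rw [← hab]
  simpa using neg_mem hb

namespace AffineChart

variable {X : FormalScheme.{u}} (c : AffineChart X.toPresheafedSpace)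

theorem openOf_preimage_range (J : OpenIdeal c.ring) :
    Spf.openOf (c.preimage c.range) J = ⊤ :=
  eq_top_iff.mpr fun q _ => c.point_mem_range (Spf.ofSpec J q)

/-- The map from the ring of a chart to the sections over the chart. -/
def ofRing : c.ring →+* X.sections c.range :=
  (RingEquiv.ofBijective (c.pull c.range)
    (c.isHomeomorph_pull le_rfl).bijective).symm.toRingHom.comp (Spf.ofRing (c.preimage c.range))

theorem pull_ofRing (a : c.ring) :
    c.pull c.range (c.ofRing a) = Spf.ofRing (c.preimage c.range) a :=
  (RingEquiv.ofBijective (c.pull c.range)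
    (c.isHomeomorph_pull le_rfl).bijective).apply_symm_apply _

theorem ofRing_surjective : Function.Surjective c.ofRing :=
  (RingEquiv.ofBijective (c.pull c.range) (c.isHomeomorph_pull le_rfl).bijective).symm.surjective.comp
    (Spf.ofRing_surjective c.isAdmissible c.openOf_preimage_range)

theorem continuous_ofRing : Continuous c.ofRing := by
  refine (c.isHomeomorph_pull le_rfl).isEmbedding.continuous_iff.mpr ?_
  exact (Spf.continuous_ofRing (U := c.preimage c.range)).congr fun a => (c.pull_ofRing a).symm

end AffineChart

/-! ### Closedness of kernel sheaves over a discrete space -/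

namespace FormalScheme

variable {X Y : FormalScheme.{u}}

theorem continuous_res {U V : Opens X.carrier} (h : V ≤ U) : Continuous (X.res h) :=
  (X.presheaf.map (homOfLE h).op).2

theorem Hom.continuous_app (f : Y ⟶ X) (U : Opens X.carrier) : Continuous (Hom.app f U) :=
  (f.hom.c.app (op U)).2

/-- Zero is cut out by the vanishing of the components at all points and open ideals; each condition
defines an open, hence closed, subgroup. -/
theorem isClosed_singleton_zero [DiscreteTopology X.carrier] (V : Opens X.carrier) :
    IsClosed ({0} : Set (X.sections V)) := by
  choose c p hp using exists_point_eq (X := X)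
  have h : ({0} : Set (X.sections V)) = ⋂ (x : V) (J : OpenIdeal (c x.1).ring),
      {s | ((c x.1).pull (pt x.1) (X.res (pt_le x.2) s)).1 J = 0} := by
    refine Set.ext fun s => ⟨?_, fun hs => eq_of_locally_eq fun x hx =>
      ⟨pt x, pt_le hx, mem_pt x, ?_⟩⟩
    · rintro rfl
      refine Set.mem_iInter₂.mpr fun x J => ?_
      change Spf.component _ J _ = 0
      rw [map_zero, map_zero, map_zero]
    · refine ((c x).isHomeomorph_pull ?_).injective (Spf.sections_ext fun J => ?_)
      · exact pt_le ⟨p x, hp x⟩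
      · refine (Set.mem_iInter₂.mp hs ⟨x, hx⟩ J).trans ?_
        change _ = Spf.component _ J _
        rw [map_zero, map_zero, map_zero]
  rw [h]
  refine isClosed_iInter fun x => isClosed_iInter fun J => ?_
  refine IsClosed.preimage (continuous_res (pt_le x.2)) (t := {s | ((c x.1).pull (pt x.1) s).1 J = 0}) ?_
  exact AddSubgroup.isClosed_of_isOpen
    (((Spf.component _ J).comp ((c x.1).pull (pt x.1))).toAddMonoidHom.ker)
    (isOpen_pull_component_eq_zero (c x.1) x.1 J)

section Discrete

variable [DiscreteTopology X.carrier] [DiscreteTopology Y.carrier]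

/-- On a discrete formal scheme a section can be extended by zero. -/
theorem exists_extension_by_zero {U V : Opens X.carrier} (h : V ≤ U) (s : X.sections V) :
    ∃ t : X.sections U, X.res h t = s ∧
      ∀ (W : Opens X.carrier) (hW : W ≤ U), W ⊓ V = ⊥ → X.res hW t = 0 := by
  let V' : Opens X.carrier := ⟨(U : Set X.carrier) \ V, isOpen_discrete _⟩
  have hV' : V' ≤ U := fun _ hx => hx.1
  obtain ⟨t, h1, h2⟩ := exists_gluing₂ h hV' (fun x hx => (em (x ∈ V)).imp id fun h => ⟨hx, h⟩)
    (eq_bot_iff.mpr fun x hx => hx.2.2 hx.1) s 0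
  refine ⟨t, h1, fun W hW hWV => ?_⟩
  have hWV' : W ≤ V' := fun x hx => ⟨hW hx, fun hxV => (hWV.le ⟨hx, hxV⟩ : x ∈ (⊥ : Opens _))⟩
  rw [← res_res hV' hWV', h2, map_zero]

theorem res_surjective {U V : Opens X.carrier} (h : V ≤ U) : Function.Surjective (X.res h) :=
  fun s => (exists_extension_by_zero h s).imp fun _ ht => ht.1

/-- On a chart the candidate is the ideal of ring elements with zero pullback to `Y`. A section over
a smaller open set is compared with its extension by zero, which comes from an element of the ring.
-/
theorem isClosed_kerSheaf (f : Y ⟶ X) : (kerSheaf f).IsClosed := fun x => by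
  obtain ⟨c, p, rfl⟩ := exists_point_eq x
  let I : Ideal c.ring := RingHom.ker ((Hom.app f c.range).comp c.ofRing)
  have hI : IsClosed (I : Set c.ring) :=
    (isClosed_singleton_zero _).preimage ((Hom.continuous_app f _).comp c.continuous_ofRing)
  refine ⟨c, c.point_mem_range p, I, hI, fun U hU s => ?_⟩
  obtain ⟨t, hts, ht0⟩ := exists_extension_by_zero hU s
  obtain ⟨a, rfl⟩ := c.ofRing_surjective t
  have haI : a ∈ I ↔ Hom.app f U s = 0 := by
    refine ⟨fun h => ?_, fun h => ?_⟩
    · have h1 : Hom.app f c.range (c.ofRing a) = 0 := h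
      rw [← hts, app_res, h1, map_zero]
    · refine eq_of_locally_eq (X := Y) fun y hy => ?_
      by_cases hyU : f.hom.base y ∈ U
      · refine ⟨Hom.preimage f U, fun _ hz => hU hz, hyU, ?_⟩
        rw [map_zero]
        refine (app_res f hU (c.ofRing a)).symm.trans ?_
        rw [hts, h]
      · have hle : pt (f.hom.base y) ≤ c.range := pt_le hy
        refine ⟨Hom.preimage f (pt (f.hom.base y)), fun _ hz => hle hz, rfl, ?_⟩
        rw [map_zero]
        refine (app_res f hle (c.ofRing a)).symm.trans ?_
        rw [ht0 _ _ (eq_bot_iff.mpr ?_), map_zero]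
        rintro z ⟨hz, hzU⟩
        exact hyU (eq_of_mem_pt hz ▸ hzU)
  refine Iff.trans (Iff.trans Iff.rfl haI.symm) ⟨fun h K hK => ?_, fun h => ?_⟩
  · change (c.pull U s).1 K = 0
    rw [← hts, c.pull_res, c.pull_ofRing]
    have h1 := (Spf.ofRing_component_eq_zero_iff (c.openOf_preimage_range K) a).mpr (hK h)
    exact (congrArg _ h1).trans (map_zero _)
  · refine Ideal.mem_of_forall_isOpen c.isAdmissible hI fun K hK => ?_
    refine (Spf.ofRing_component_eq_zero_iff (c.openOf_preimage_range K) a).mp ?_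
    rw [← c.pull_ofRing]
    refine SpecSections.ext_value fun q hq => ?_
    rw [map_zero]
    -- Vanishing of the component of `a` at `K` is checked at each point: in `U` by the hypothesis
    -- on `s`, outside `U` because the extension is zero there.
    have key : ∀ (W : Opens X.carrier) (hW : W ≤ c.range) (_ : c.point (Spf.ofSpec K q) ∈ W),
        (c.pull W (X.res hW (c.ofRing a))).1 K = 0 →
          SpecSections.value q hq ((c.pull c.range (c.ofRing a)).1 K) = 0 := fun W hW hqW h0 => by
      rw [c.pull_res] at h0
      have h1 := SpecSections.value_res (Spf.openOf_mono (show c.preimage W ≤ c.preimage c.range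
        from fun _ hx => hW hx) K) q hqW ((c.pull c.range (c.ofRing a)).1 K)
      refine h1.symm.trans ((congrArg _ h0).trans (map_zero _))
    by_cases hqU : c.point (Spf.ofSpec K q) ∈ U
    · exact key U hU hqU (by rw [hts]; exact h K hK)
    · refine key (pt (c.point (Spf.ofSpec K q))) (pt_le hq) (mem_pt _) ?_
      rw [ht0 _ _ (eq_bot_iff.mpr ?_), map_zero]
      · rfl
      · rintro z ⟨hz, hzU⟩
        exact hqU (eq_of_mem_pt hz ▸ hzU)

end Discrete

end FormalScheme

/-! ### Pseudo-immersions into a discrete Noetherian formal scheme -/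

namespace FormalScheme

variable {X Y : FormalScheme.{u}}

section Discrete

variable [DiscreteTopology X.carrier]

/-- The spectrum of the quotient embeds in the discrete space `X`, so this Noetherian ring has
dimension at most zero. -/
theorem isArtinianRing_quotient (c : AffineChart X.toPresheafedSpace) [IsNoetherianRing c.ring]
    (J : OpenIdeal c.ring) : IsArtinianRing (c.ring ⧸ J.1) := by
  have h1 : DiscreteTopology (SpfPoint c.ring) :=
    @Topology.IsEmbedding.discreteTopology _ X.carrier _ _ _ ‹_›
      c.isOpenImmersion.base_open.isEmbedding
  have h2 : DiscreteTopology (PrimeSpectrum (c.ring ⧸ J.1)) :=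
    (Spf.isEmbedding_ofSpec J).discreteTopology
  exact isArtinianRing_iff_krullDimLE_zero.mpr
    (PrimeSpectrum.discreteTopology_iff_finite_and_krullDimLE_zero.mp h2).2

/-- A pseudo-immersion into a discrete formal scheme has dense image on sections. -/
theorem IsPseudoImmersion.exists_app_component_eq {f : Y ⟶ X} (hf : IsPseudoImmersion f)
    (d : AffineChart Y.toPresheafedSpace) (q : SpfPoint d.ring) {x : X.carrier}
    (hx : f.hom.base (d.point q) = x)
    (t : Spf.sections (d.preimage (Hom.preimage f (pt x)))) (J : OpenIdeal d.ring) :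
    ∃ r : X.sections (pt x), (d.pull (Hom.preimage f (pt x)) (Hom.app f (pt x) r)).1 J = t.1 J := by
  -- Intersecting with `q` guarantees a point of the test scheme above `x`; `J` alone might be the
  -- unit ideal.
  let K : OpenIdeal d.ring := J.inf ⟨q.1.asIdeal, q.2⟩
  have hd := discreteTopology_quotientRing K
  have hker : RingHom.ker (quotientHom K).1 = K.1 := Ideal.mk_ker
  have hs : Function.Surjective (quotientHom K).1 := Ideal.Quotient.mk_surjective
  obtain ⟨z, hz⟩ : q ∈ Set.range (Spf.mapPoint (quotientHom K).2) :=
    (Set.ext_iff.mp (Spf.range_mapPoint (quotientHom K).2 hs) q).mpr (hker.le.trans inf_le_right)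
  have hzx : (quotientImmersion d K ≫ f).hom.base z = x :=
    (congrArg (fun q => f.hom.base (d.point q)) hz).trans hx
  obtain ⟨U, hU, hzU, hq⟩ := (hf.isImmersion_quotientImmersion_comp d K).exists_isOpenQuotientMap z
    (pt x) hzx
  obtain rfl : U = pt x := le_antisymm hU (pt_le (hzx ▸ hzU))
  obtain ⟨r, hr⟩ := hq.surjective (Spf.pullback (quotientHom K).2 _ t)
  refine ⟨r, ?_⟩
  have h1 : Spf.pullback (quotientHom K).2 _
      (d.pull (Hom.preimage f (pt x)) (Hom.app f (pt x) r) - t) = 0 := by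
    rw [map_sub, sub_eq_zero]
    exact hr
  exact Spf.component_eq (J := K) inf_le_left
    (sub_eq_zero.mp ((Spf.pullback_eq_zero_iff (quotientHom K).2 hs _).mp h1 K hker.le))

/-- Surjectivity and openness come from Chevalley's theorem applied to `β`, the map from a
Noetherian adic chart ring of `X` to the sections of `Y` over the fibre, which is at most one point.
-/
theorem IsPseudoImmersion.isOpenQuotientMap_app (hX : X.IsNoetherian) {f : Y ⟶ X}
    (hf : IsPseudoImmersion f) (x : X.carrier) : IsOpenQuotientMap (Hom.app f (pt x)) := by
  have hY := hf.discreteTopology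
  by_cases hxf : ∃ y, f.hom.base y = x
  swap
  · have : Subsingleton (Y.sections (Hom.preimage f (pt x))) :=
      subsingleton_sections (eq_bot_iff.mpr fun y hy => hxf ⟨y, hy⟩)
    exact ⟨fun y => ⟨0, Subsingleton.elim _ _⟩, Hom.continuous_app f _,
        fun _ _ => isOpen_discrete _⟩
  obtain ⟨y, hyx⟩ := hxf
  obtain ⟨d, q, rfl⟩ := exists_point_eq y
  obtain ⟨c, hxc, hnoeth, I, hI⟩ := hX.exists_chart x
  let T : Opens Y.carrier := Hom.preimage f (pt x)
  have hT : ∀ z ∈ T, z = d.point q := fun z hz => hf.injective (Eq.trans hz hyx.symm)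
  have hTd : T ≤ d.range := fun z hz => hT z hz ▸ d.point_mem_range q
  have hTs : (d.preimage T : Set (SpfPoint d.ring)).Subsingleton := fun a ha b hb =>
    d.point_injective ((hT _ ha).trans (hT _ hb).symm)
  have hpull := d.isHomeomorph_pull hTd
  obtain ⟨J, hJ, hJb⟩ := d.isAdmissible.exists_basis
  have hJo : ∀ n, IsOpen (J n : Set d.ring) := fun n => AddSubgroup.isOpen_of_mem_nhds
    (Submodule.toAddSubgroup (J n)) (hJb.mem_of_mem trivial)
  have hIo : ∀ n, IsOpen ((I ^ n : Ideal c.ring) : Set c.ring) := (isAdic_iff.mp hI).1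
  let γ : c.ring →+* X.sections (pt x) := (X.res (pt_le hxc)).comp c.ofRing
  have hγ : Continuous γ := (continuous_res _).comp c.continuous_ofRing
  have hγs : Function.Surjective γ := (res_surjective _).comp c.ofRing_surjective
  let β : c.ring →+* Spf.sections (d.preimage T) := (d.pull T).comp ((Hom.app f (pt x)).comp γ)
  have hβ : Continuous β := (d.continuous_pull T).comp ((Hom.continuous_app f _).comp hγ)
  -- The kernels of the components along a countable basis of open ideals of the chart of `Y`: open
  -- ideals with zero intersection.
  let 𝔫 : ℕ → Ideal (Spf.sections (d.preimage T)) := fun n =>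
    RingHom.ker (Spf.component (d.preimage T) ⟨J n, hJo n⟩)
  have h𝔫o : ∀ n, IsOpen (𝔫 n : Set (Spf.sections (d.preimage T))) := fun n =>
    Spf.isOpen_component_eq_zero _ (Spf.isCompact_openOf_of_subsingleton hTs _)
  obtain ⟨hβs, hβo⟩ := surjective_and_exists_le_map (𝔞 := fun n => I ^ n) (𝔫 := 𝔫) β
    (fun m n h => Ideal.pow_le_pow_right h)
    (fun k => isArtinianRing_quotient c ⟨I ^ k, hIo k⟩)
    (exists_forall_sub_mem_of_completeSpace c.isAdmissible.complete
      (fun m n h => Ideal.pow_le_pow_right h) hI.hasBasis_nhds_zero)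
    (fun m n h s hs => Spf.component_eq_zero (J := ⟨J n, hJo n⟩) (hJ h) hs)
    (fun t ht => Spf.sections_ext fun K => by
      obtain ⟨n, -, hn⟩ := hJb.mem_iff.mp (K.2.mem_nhds K.1.zero_mem)
      exact Spf.component_eq_zero (J := ⟨J n, hJo n⟩) hn (ht n))
    (fun n => by
      obtain ⟨k, -, hk⟩ := hI.hasBasis_nhds_zero.mem_iff.mp (((h𝔫o n).preimage hβ).mem_nhds
        (show β 0 ∈ 𝔫 n by rw [map_zero]; exact zero_mem _))
      exact ⟨k, hk⟩)
    (fun t n => by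
      obtain ⟨r, hr⟩ := hf.exists_app_component_eq d q hyx t ⟨J n, hJo n⟩
      obtain ⟨a, rfl⟩ := hγs r
      refine ⟨a, ?_⟩
      change Spf.component _ _ _ = 0
      rw [map_sub, sub_eq_zero]
      exact hr.symm)
  have hβopen : IsOpenMap β := by
    refine IsTopologicalAddGroup.isOpenMap_iff_nhds_zero.mpr fun N hN => ?_
    obtain ⟨k, -, hk⟩ := hI.hasBasis_nhds_zero.mem_iff.mp hN
    obtain ⟨n, hn⟩ := hβo k
    refine Filter.mem_of_superset ((h𝔫o n).mem_nhds (zero_mem (𝔫 n))) fun t ht => ?_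
    obtain ⟨a, ha, rfl⟩ := hn t ht
    exact hk ha
  have happ : Function.Surjective (Hom.app f (pt x)) := fun t => by
    obtain ⟨a, ha⟩ := hβs (d.pull T t)
    exact ⟨γ a, hpull.injective ha⟩
  refine ⟨happ, Hom.continuous_app f _, ?_⟩
  -- Openness of `β` descends to the map on sections: `γ` is a continuous surjection and the
  -- pullback to the chart is a homeomorphism.
  refine IsOpenMap.of_comp_of_surjective (f := γ) (g := Hom.app f (pt x)) (fun S hS => ?_) hγ hγs
  have h1 := (hβopen S hS).preimage hpull.continuous
  have h2 : (d.pull T) ⁻¹' (β '' S) = (Hom.app f (pt x) ∘ γ) '' S := by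
    refine (congrArg _ (Set.image_comp (d.pull T) (Hom.app f (pt x) ∘ γ) S)).trans ?_
    exact Set.preimage_image_eq _ hpull.injective
  exact h2 ▸ h1

theorem IsPseudoImmersion.isClosedImmersion (hX : X.IsNoetherian) {f : Y ⟶ X}
    (hf : IsPseudoImmersion f) : IsClosedImmersion f := by
  have hY := hf.discreteTopology
  refine ⟨kerSheaf f, isClosed_kerSheaf f, ?_, Set.ext fun x => ⟨?_, fun hx => ?_⟩, fun U => rfl,
    _, isBasis_pt, ?_⟩
  · exact (Topology.IsOpenEmbedding.of_continuous_injective_isOpenMap (ContinuousMap.continuous _)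
      hf.injective fun _ _ => isOpen_discrete _).isEmbedding
  · rintro ⟨y, rfl⟩ U hy h
    have := nontrivial_sections (U := Hom.preimage f U) hy
    exact one_ne_zero ((map_one (Hom.app f U)).symm.trans h)
  · by_contra hxf
    have : Subsingleton (Y.sections (Hom.preimage f (pt x))) :=
      subsingleton_sections (eq_bot_iff.mpr fun y hy => hxf ⟨y, hy⟩)
    exact hx (pt x) (mem_pt x) (Subsingleton.elim _ _)
  · rintro _ ⟨x, rfl⟩
    exact hf.isOpenQuotientMap_app hX x

end Discrete

end FormalScheme

theorem mainTheorem2 (X : FormalScheme.{u}) (hX : X.IsNoetherian) :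
    (∀ (Y : FormalScheme.{u}) (f : Y ⟶ X),
        FormalScheme.IsPseudoImmersion f → FormalScheme.IsImmersion f) ↔
      DiscreteTopology X.carrier :=
  ⟨FormalScheme.discreteTopology_of_isImmersion hX,
    fun _ _ _ hf => (hf.isClosedImmersion hX).isImmersion⟩
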